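/- **Model.** A job $j$ has an arrival time $a_j\ge 0$, a deadline $d_j$ and an execution time $c_j>0$. A processor is busy, in standby, or off; it uses $\psi_b$ units of energy per unit of time when busy, $\psi_\sigma$ in standby ($0<\psi_\sigma\le\psi_b$) and none when off, and every turn-on costs $E_w\ge 0$. Let $\mathcal B=E_w/\psi_\sigma$ be the break-even time. A schedule on finitely many processors specifies, for each processor, a finite set of separated time intervals during which it is on, and which job (if any) occupies it at each time. Its energy is the sum, over the processors, of $E_w$ times the number of on-intervals and of the integral over these intervals of $\psi_b$ (when occupied by a job) or $\psi_\sigma$ (otherwise). It is feasible for a set of jobs if each job $j$ of the set is executed on one processor, within $[a_j,d_j]$, for a total time of at least $c_j$ (with preemption allowed). For a job set $\mathcal J$ let $\mathcal J(t)=\{j\in\mathcal J: a_j\le t\}$. **Algorithm $\mathcal S$** (on two processors $M_1,M_2$, with parameter $\lambda\in[0,1]$). Let $Q(t)$ be the set of jobs of $\mathcal J(t)$ not finished at time $t$, and $W(t,t^\dagger)$ the total remaining execution time at time $t$ of the jobs of $Q(t)$ with deadline at most $t^\dagger$. The energy-efficient anchor of $j$ is $h_j=\max\{a_j,d_j-\lambda\mathcal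 B\}$. The system is off if both processors are off; it is in standby if it is not off and no processor is executing a job. Initially the system is off and the urgency flag is false. At every time $t$ the following rules are applied in this order, except that (B) governs which jobs are executed in the resulting state. (A) (a) If the system is off and either $h_j\le t$ for some $j\in Q(t)$ or $W(t,t^\dagger)\ge t^\dagger-t$ for some $t^\dagger>t$, turn on $M_1$. (b) If the urgency flag is false and $W(t,t^\dagger)>t^\dagger-t$ for some $t^\dagger>t$, turn on $M_1$ if it is off, turn on $M_2$, set $t^*:=t$, and set the urgency flag to true. (B) If the urgency flag is true, run earliest-deadline-first (EDF, ties broken arbitrarily) on $M_1$ with the jobs of $Q(t)$ that arrived before $t^*$, and on $M_2$ with the other jobs of $Q(t)$. If it is false and the system is not off, run EDF with the jobs of $Q(t)$ on the processor that is on. (C) (a) If the urgency flag is true and no job of $Q(t)$ arrived before $t^*$, turn off $M_1$ and set the flag to false. (b) If the urgency flag is false, the system is in standby and $t-t_1\ge\mathcal B$, where $t_1$ is the time at which $M_1$ was last turned on, turn off all processors. **Theorem.** Let $\mathcal J$ be a finite set of jobs such that for all $\ell<r$ $$\sum_{j\in\mathcal J:\ \ell\le a_j,\ d_j\le r} c_j\le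 r-\ell .$$ Then, with $\lambda=1$, algorithm $\mathcal S$ is well defined on $\mathcal J$ (it has a run, with finitely many turn-ons, for all times $t\ge 0$), and every schedule it produces (it uses at most two processors) is feasible for $\mathcal J$ and $4$-competitive: for every $T\ge 0$, the energy it consumes up to time $T$ is at most $4$ times the energy of any schedule, on any number of processors, that is feasible for $\mathcal J(T)$; and its total energy is at most $4$ times the energy of any schedule, on any number of processors, that is feasible for $\mathcal J$. -/

import Mathlib

open Set Filter Topology MeasureTheory

noncomputable section

namespace PowerSched

/-- A job with its arrival time, deadline and execution time. -/
structure Job where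
  arrival : ℝ
  deadline : ℝ
  exec : ℝ
  arrival_nonneg : 0 ≤ arrival
  exec_pos : 0 < exec

/-- The energy parameters: the energy of one turn-on, and the energy per unit of time of a processor
that is busy, respectively in standby.  A processor that is off consumes nothing. -/
structure PowerModel where
  wake : ℝ
  busy : ℝ
  standby : ℝ
  wake_nonneg : 0 ≤ wake
  standby_pos : 0 < standby
  standby_le_busy : standby ≤ busy

/-- The break-even time. -/
def PowerModel.breakEven (P : PowerModel) : ℝ := P.wake / P.standby

/-- Schedulability condition: for every interval `(l, r)`, the jobs that arrive at or after `l` and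
are due by `r` have total execution time at most `r - l`. -/
def EDFCondition {ι : Type*} [Fintype ι] (J : ι → Job) : Prop :=
  ∀ l r : ℝ, l < r →
    ∑ j with l ≤ (J j).arrival ∧ (J j).deadline ≤ r, (J j).exec ≤ r - l

/-- A schedule on `k` processors.  `on m` is the set of the intervals `[ℓ, r)` (stored as pairs)
during which processor `m` is turned on, and `job m t` is the job that occupies processor `m` at
time `t` (`none` if there is none).  Between two on-intervals of a processor it is really off. -/
structure Schedule (ι : Type*) (k : ℕ) where
  on : Fin k → Finset (ℝ × ℝ)
  job : Fin k → ℝ → Option ι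
  on_nonneg : ∀ m, ∀ I ∈ on m, 0 ≤ I.1
  on_lt : ∀ m, ∀ I ∈ on m, I.1 < I.2
  on_separated : ∀ m, ∀ I ∈ on m, ∀ I' ∈ on m, I ≠ I' → I.2 < I'.1 ∨ I'.2 < I.1
  job_measurable : ∀ m x, MeasurableSet {t | job m t = x}

namespace Schedule

variable {ι : Type*} {k : ℕ}

/-- The amount of time, within the set `A` of times, that processor `m` is on and executes `j`. -/
def executed (S : Schedule ι k) (m : Fin k) (j : ι) (A : Set ℝ) : ℝ :=
  ∑ I ∈ S.on m, ∫ t in Ico I.1 I.2 ∩ A, {s | S.job m s = some j}.indicator (fun _ => (1 : ℝ)) t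

/-- `S` is feasible for the jobs in `A`: each of them is executed, on one processor and between its
arrival and its deadline, for at least its execution time. -/
def Feasible (S : Schedule ι k) (J : ι → Job) (A : Set ι) : Prop :=
  ∀ j ∈ A, ∃ m, (J j).exec ≤ S.executed m j (Icc (J j).arrival (J j).deadline)

/-- The power drawn by processor `m` at time `t`, provided that it is on. -/
def power (S : Schedule ι k) (P : PowerModel) (m : Fin k) (t : ℝ) : ℝ :=
  if (S.job m t).isSome then P.busy else P.standby

/-- The total energy consumption. -/
def energy (S : Schedule ι k) (P : PowerModel) : ℝ :=
  ∑ m, (P.wake * (S.on m).card + ∑ I ∈ S.on m, ∫ t in Ico I.1 I.2, S.power P m t)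

/-- The energy consumed up to time `T`, including the turn-ons at time `T`. -/
def energyUpTo (S : Schedule ι k) (P : PowerModel) (T : ℝ) : ℝ :=
  ∑ m, (P.wake * ((S.on m).filter (fun I => I.1 ≤ T)).card +
    ∑ I ∈ S.on m, ∫ t in Ico I.1 I.2 ∩ Iic T, S.power P m t)

/-- The remaining execution time of job `j` at time `t`. -/
def remaining (S : Schedule ι k) (J : ι → Job) (j : ι) (t : ℝ) : ℝ :=
  (J j).exec - ∑ m, S.executed m j (Icc 0 t)

/-- `Q(t)`: the jobs that have arrived by time `t` and are not finished at time `t`. -/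
def queue (S : Schedule ι k) (J : ι → Job) (t : ℝ) : Set ι :=
  {j | (J j).arrival ≤ t ∧ 0 < S.remaining J j t}

open Classical in
/-- `W(t, x)`: the total remaining execution time of the jobs of `Q(t)` that are due by `x`. -/
def workload [Fintype ι] (S : Schedule ι k) (J : ι → Job) (t x : ℝ) : ℝ :=
  ∑ j with j ∈ S.queue J t ∧ (J j).deadline ≤ x, S.remaining J j t

end Schedule

/-- The energy-efficient anchor of a job. -/
def anchor (P : PowerModel) (lam : ℝ) (j : Job) : ℝ :=
  max j.arrival (j.deadline - lam * P.breakEven)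

/-- What the online algorithm remembers: which of the processors `M₁` (index `0`) and `M₂`
(index `1`) are on, the urgency flag, the time `t₁` at which `M₁` was last turned on, and the time
`t*` at which the urgency flag was last raised. -/
@[ext]
structure SysState where
  on : Fin 2 → Bool
  urgent : Bool
  t1 : ℝ
  tStar : ℝ

namespace SysState

/-- At the beginning both processors are off and the urgency flag is false. -/
def initial : SysState := ⟨fun _ => false, false, 0, 0⟩

def IsOff (s : SysState) : Prop := ∀ m, s.on m = false

def turnOnM1 (s : SysState) (t : ℝ) : SysState :=
  { s with on := Function.update s.on 0 true, t1 := t }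

open Classical in
/-- Rule (A), first part: if the system is off, and the anchor of an unfinished job is reached or
the unfinished jobs leave no slack (`Q` is the queue and `W x` the work in it due by `x`), then turn
on `M₁`. -/
def wakeUp {ι : Type*} (P : PowerModel) (lam : ℝ) (J : ι → Job) (Q : Set ι) (W : ℝ → ℝ) (t : ℝ)
    (s : SysState) : SysState :=
  if s.IsOff ∧ ((∃ j ∈ Q, anchor P lam (J j) ≤ t) ∨ ∃ x, t < x ∧ x - t ≤ W x) then
    s.turnOnM1 t
  else s

open Classical in
/-- Rule (A), second part: if the urgency flag is false and the unfinished jobs do not fit on one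
processor, then turn on `M₁` if it is off, turn on `M₂`, and raise the flag. -/
def raiseUrgency (W : ℝ → ℝ) (t : ℝ) (s : SysState) : SysState :=
  if s.urgent = false ∧ ∃ x, t < x ∧ x - t < W x then
    let s' := if s.on 0 = false then s.turnOnM1 t else s
    { s' with on := Function.update s'.on 1 true, urgent := true, tStar := t }
  else s

open Classical in
/-- Rule (C), first part: if the urgency flag is true and no unfinished job arrived before `t*`,
then turn off `M₁` and clear the flag. -/
def clearUrgency {ι : Type*} (J : ι → Job) (Q : Set ι) (s : SysState) : SysState :=
  if s.urgent = true ∧ ∀ j ∈ Q, s.tStar ≤ (J j).arrival then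
    { s with on := Function.update s.on 0 false, urgent := false }
  else s

open Classical in
/-- Rule (C), second part: if the urgency flag is false, the system is in standby (it is not off,
and there is no unfinished job to execute) and at least the break-even time has passed since `M₁`
was turned on, then turn off all processors. -/
def shutDown {ι : Type*} (P : PowerModel) (Q : Set ι) (t : ℝ) (s : SysState) : SysState :=
  if s.urgent = false ∧ ¬ s.IsOff ∧ Q = ∅ ∧ P.breakEven ≤ t - s.t1 then
    { s with on := fun _ => false }
  else s

/-- All switching rules, applied at time `t` to the state just before `t`. -/
def update {ι : Type*} (P : PowerModel) (lam : ℝ) (J : ι → Job) (Q : Set ι) (W : ℝ → ℝ) (t : ℝ)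
    (s : SysState) : SysState :=
  ((((s.wakeUp P lam J Q W t).raiseUrgency W t).clearUrgency J Q).shutDown P Q t)

/-- Rule (B): the jobs of the queue `Q` that processor `m` may execute in state `s`.  When the
urgency flag is true, `M₁` gets the jobs that arrived before `t*` and `M₂` gets the others;
otherwise the processor that is on gets all of them. -/
def eligible {ι : Type*} (J : ι → Job) (Q : Set ι) (s : SysState) (m : Fin 2) : Set ι :=
  {j ∈ Q | s.on m = true ∧
    (s.urgent = true → if m = 0 then (J j).arrival < s.tStar else s.tStar ≤ (J j).arrival)}

end SysState

/-- Earliest deadline first: execute an available job whose deadline is smallest (ties are broken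
arbitrarily), and nothing if and only if no job is available. -/
def EDFChoice {ι : Type*} (J : ι → Job) (A : Set ι) : Option ι → Prop
  | none => A = ∅
  | some j => j ∈ A ∧ ∀ i ∈ A, (J j).deadline ≤ (J i).deadline

/-- The schedule `S` on two processors is produced by the online algorithm with parameter `lam` on
the jobs `J`; `σ t` is the state of the algorithm at time `t`, after the rules have been applied at
time `t`.  The state is piecewise constant in time; at every time it results from the state just
before by the switching rules, which see only the jobs that have arrived. -/
structure IsRun {ι : Type*} [Fintype ι] (P : PowerModel) (lam : ℝ) (J : ι → Job)
    (S : Schedule ι 2) (σ : ℝ → SysState) : Prop where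
  init : σ 0 = SysState.initial.update P lam J (S.queue J 0) (S.workload J 0) 0
  step : ∀ t, 0 < t → ∃ s : SysState, (∀ᶠ u in 𝓝[<] t, σ u = s) ∧
    σ t = s.update P lam J (S.queue J t) (S.workload J t) t
  right : ∀ t, 0 ≤ t → ∀ᶠ u in 𝓝[>] t, σ u = σ t
  on_iff : ∀ t, 0 ≤ t → ∀ m, (σ t).on m = true ↔ ∃ I ∈ S.on m, t ∈ Ico I.1 I.2
  edf : ∀ t, 0 ≤ t → ∀ m, EDFChoice J ((σ t).eligible J (S.queue J t) m) (S.job m t)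

/-- `S` is a `ρ`-competitive schedule for the jobs `J`: at every time `T`, the energy consumed up to
`T` is at most `ρ` times the energy of any schedule, on any number of processors, that is feasible
for the jobs which have arrived by `T`; and the total energy is at most `ρ` times the energy of any
feasible schedule for all jobs. -/
def IsCompetitive {ι : Type*} {k : ℕ} (ρ : ℝ) (P : PowerModel) (J : ι → Job)
    (S : Schedule ι k) : Prop :=
  (∀ T : ℝ, 0 ≤ T → ∀ (n : ℕ) (O : Schedule ι n), O.Feasible J {j | (J j).arrival ≤ T} →
    S.energyUpTo P T ≤ ρ * O.energy P) ∧
  ∀ (n : ℕ) (O : Schedule ι n), O.Feasible J univ → S.energy P ≤ ρ * O.energy P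

end PowerSched

end

/-!
Measure energy in units of time: a turn-on costs the break-even time `B`, a unit of idle on-time
costs one, and a unit of busy time costs at least one. As long as only one processor is on, its idle
time after a turn-on is at most `B`; when the urgency flag is raised, jobs with total execution time
at least `B` have arrived since the system was last turned off, and this pays for the turn-on of
`M₂`. Hence the turn-ons and the idle time cost at most `2B` for each turn-on of `M₁`, plus the
total execution time `C` of the arrived jobs.

Let `O` be a feasible schedule. An off-time of the system followed by an on-time is a period; it
lasts at least `B`. Unless an on-interval of `O` begins or ends within the period, either `O` is on
throughout, or `O` is off throughout. In the last case the turn-on at time `w` was not caused by an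
anchor `d_j - B`, since `O` executes `j` after the period; so there is an `x` such that the jobs
which arrived in the period and are due by `x` take at least the time `x - w`. As `O` executes them
after the period and before `x`, the whole of `[w, x]` can be charged to the time `O` spends on
them. So `B` times the number of turn-ons of `M₁` is at most `2B` times the number of turn-ons of
`O` plus the on-time of `O`; and `C` is at most the on-time of `O`.

A run exists because the algorithm can be advanced from event to event: between two events the
state and the executed jobs are constant, and each event decreases a bound on the number of events
to come.
-/

noncomputable section

namespace PowerSched

section Work

variable {ι : Type*}

/-- The jobs that arrive during the set `I` of times. -/
def arriving (J : ι → Job) (I : Set ℝ) : Set ι := {j | (J j).arrival ∈ I}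

/-- The jobs that are due by time `x`. -/
def dueBy (J : ι → Job) (x : ℝ) : Set ι := {j | (J j).deadline ≤ x}

/-- The execution times of the jobs, as a function on the index type. -/
abbrev execTimes (J : ι → Job) : ι → ℝ := fun j => (J j).exec

/-- The jobs that have arrived by time `t` and have a positive remaining execution time `r`. It is
`Q(t)` for remaining execution times that need not come from a schedule. -/
def openJobs (J : ι → Job) (r : ι → ℝ) (t : ℝ) : Set ι := {j | (J j).arrival ≤ t ∧ 0 < r j}

theorem execTimes_nonneg (J : ι → Job) (j : ι) : 0 ≤ execTimes J j := (J j).exec_pos.le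

theorem arriving_union (J : ι → Job) (I I' : Set ℝ) :
    arriving J (I ∪ I') = arriving J I ∪ arriving J I' := rfl

theorem disjoint_arriving {J : ι → Job} {I I' : Set ℝ} (h : Disjoint I I') :
    Disjoint (arriving J I) (arriving J I') := h.preimage _

variable [Fintype ι]

/-- The total amount of work of the jobs in `A`, when job `j` stands for the amount `f j`. -/
def work (f : ι → ℝ) (A : Set ι) : ℝ := ∑ j, A.indicator f j

/-- The total amount of work of the jobs that arrive during `I` and are due by `x`. -/
def workDue (J : ι → Job) (f : ι → ℝ) (I : Set ℝ) (x : ℝ) : ℝ := work f (arriving J I ∩ dueBy J x)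

variable {A B : Set ι} {f g : ι → ℝ} {j : ι}

theorem work_congr (h : ∀ j ∈ A, f j = g j) : work f A = work g A :=
  Finset.sum_congr rfl fun _ _ => congrFun (indicator_congr h) _

theorem work_congr_set (h : ∀ j, ¬(j ∈ A ↔ j ∈ B) → f j = 0) : work f A = work f B := by
  classical
  refine Finset.sum_congr rfl fun j _ => ?_
  by_cases hj : j ∈ A ↔ j ∈ B
  · simp only [indicator_apply, hj]
  · simp only [indicator_apply, h j hj, ite_self]

theorem work_mono_set (hf : ∀ j, 0 ≤ f j) (h : A ⊆ B) : work f A ≤ work f B :=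
  Finset.sum_le_sum fun j _ => indicator_le_indicator_of_subset h hf j

theorem work_mono (h : ∀ j, f j ≤ g j) : work f A ≤ work g A :=
  Finset.sum_le_sum fun _ _ => indicator_le_indicator (h _)

theorem work_nonneg (h : ∀ j ∈ A, 0 ≤ f j) : 0 ≤ work f A :=
  Finset.sum_nonneg fun _ _ => indicator_nonneg h _

theorem work_eq_zero (h : ∀ j ∈ A, f j = 0) : work f A = 0 :=
  Finset.sum_eq_zero fun j _ => indicator_apply_eq_zero.2 (h j)

theorem le_work (hf : ∀ j, 0 ≤ f j) (hj : j ∈ A) : f j ≤ work f A := by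
  rw [← indicator_of_mem hj f]
  exact Finset.single_le_sum (fun i _ => indicator_nonneg (fun i _ => hf i) i) (Finset.mem_univ j)

theorem eq_zero_of_work_nonpos (hf : ∀ j, 0 ≤ f j) (h : work f A ≤ 0) (hj : j ∈ A) : f j = 0 :=
  ((le_work hf hj).trans h).antisymm (hf j)

theorem exists_pos_of_work_pos (h : 0 < work f A) : ∃ j ∈ A, 0 < f j := by
  contrapose! h
  exact Finset.sum_nonpos fun j _ => indicator_nonpos h j

theorem work_sub (f g : ι → ℝ) (A : Set ι) : work (f - g) A = work f A - work g A := by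
  simp only [work, indicator_sub', Pi.sub_apply, Finset.sum_sub_distrib]

theorem work_progress {C : Set ι} {r r' : ι → ℝ} (f : ι → ℝ)
    (h : ∀ j, ¬(j ∈ A ↔ j ∈ C) → r' j = r j) :
    work (f - r') A - work (f - r) A = work r C - work r' C := by
  have hsub : work (r - r') A = work (r - r') C :=
    work_congr_set fun j hj => sub_eq_zero.2 (h j hj).symm
  simp only [work_sub] at hsub ⊢
  linarith

theorem work_union (f : ι → ℝ) (h : Disjoint A B) : work f (A ∪ B) = work f A + work f B := by
  simp only [work, indicator_union_of_disjoint h, Finset.sum_add_distrib]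

theorem work_univ (f : ι → ℝ) : work f univ = ∑ j, f j := by
  simp only [work, indicator_univ]

variable {J : ι → Job}

theorem workDue_union (J : ι → Job) (f : ι → ℝ) {I I' : Set ℝ} (h : Disjoint I I') (x : ℝ) :
    workDue J f (I ∪ I') x = workDue J f I x + workDue J f I' x := by
  rw [workDue, arriving_union, union_inter_distrib_right, work_union]
  · rfl
  · exact (disjoint_arriving h).mono inter_subset_left inter_subset_left

theorem work_arriving_union (J : ι → Job) (f : ι → ℝ) {I I' : Set ℝ} (h : Disjoint I I') :
    work f (arriving J (I ∪ I')) = work f (arriving J I) + work f (arriving J I') := by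
  rw [arriving_union, work_union _ (disjoint_arriving h)]

theorem workDue_mono_set (hf : ∀ j, 0 ≤ f j) {I I' : Set ℝ} (h : I ⊆ I') (x : ℝ) :
    workDue J f I x ≤ workDue J f I' x :=
  work_mono_set hf (inter_subset_inter_left _ (preimage_mono h))

theorem workDue_openJobs (hf : ∀ j, 0 ≤ f j) (t x : ℝ) :
    work f (openJobs J f t ∩ dueBy J x) = workDue J f (Iic t) x := by
  refine work_congr_set fun j hj => ?_
  by_contra hne
  exact hj (and_congr_left' (and_iff_left ((hf j).lt_of_ne' hne)))

theorem exists_workDue_eq (J : ι → Job) (I : Set ℝ) :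
    ∃ x, ∀ f, workDue J f I x = work f (arriving J I) := by
  obtain ⟨x, hx⟩ := (finite_range fun j => (J j).deadline).bddAbove
  have hsub : arriving J I ⊆ dueBy J x := fun j _ => hx (mem_range_self j)
  exact ⟨x, fun f => by rw [workDue, inter_eq_left.2 hsub]⟩

end Work

theorem PowerModel.breakEven_nonneg (P : PowerModel) : 0 ≤ P.breakEven :=
  div_nonneg P.wake_nonneg P.standby_pos.le

theorem PowerModel.standby_mul_breakEven (P : PowerModel) : P.standby * P.breakEven = P.wake :=
  mul_div_cancel₀ _ P.standby_pos.ne'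

section Demand

variable {ι : Type*} [Fintype ι] {J : ι → Job}

theorem EDFCondition.workDue_le (hJ : EDFCondition J) {l x : ℝ} (h : l < x) :
    workDue J (execTimes J) (Ici l) x ≤ x - l := by
  classical
  refine le_trans (le_of_eq ?_) (hJ l x h)
  rw [Finset.sum_filter]
  refine Finset.sum_congr rfl fun j _ => ?_
  rw [indicator_apply]
  congr 1

theorem EDFCondition.arrival_lt_deadline (hJ : EDFCondition J) (j : ι) :
    (J j).arrival < (J j).deadline := by
  by_contra! hc
  have hpos := (J j).exec_pos
  have hdemand := hJ.workDue_le (l := (J j).arrival) (x := (J j).arrival + (J j).exec / 2)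
    (by linarith)
  have hexec : (J j).exec ≤
      workDue J (execTimes J) (Ici (J j).arrival) ((J j).arrival + (J j).exec / 2) :=
    le_work (execTimes_nonneg J) ⟨le_refl (J j).arrival, show (J j).deadline ≤ _ by linarith⟩
  linarith

end Demand

namespace SysState

/-- The arrival times of the jobs that processor `m` is responsible for in state `s`. -/
def window (s : SysState) (m : Fin 2) : Set ℝ :=
  {a | s.urgent = true → if m = 0 then a < s.tStar else s.tStar ≤ a}

variable {s : SysState} {t : ℝ}

theorem window_of_calm (h : s.urgent = false) (m : Fin 2) : s.window m = univ :=
  eq_univ_of_forall fun _ hu => by simp [h] at hu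

theorem window_zero_of_urgent (h : s.urgent = true) : s.window 0 = Iio s.tStar := by
  ext; simp [window, h]

theorem window_one_of_urgent (h : s.urgent = true) : s.window 1 = Ici s.tStar := by
  ext; simp [window, h]

theorem Ici_subset_window_one (h : s.tStar ≤ t) : Ici t ⊆ s.window 1 :=
  fun _ ha _ => h.trans ha

end SysState

section Phases

variable {ι : Type*} [Fintype ι] {P : PowerModel} {J : ι → Job} {e w : ℝ}

/-- What justifies turning the system on at time `w` after it was last turned off at time `e`. -/
def Trigger (P : PowerModel) (J : ι → Job) (e w : ℝ) : Prop :=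
  (∃ j, (J j).arrival ∈ Ioc e w ∧ (J j).deadline ≤ w + P.breakEven) ∨
    ∃ x, w < x ∧ x - w ≤ workDue J (execTimes J) (Ioc e w) x

theorem Trigger.exists_arrival_mem (h : Trigger P J e w) : ∃ j, (J j).arrival ∈ Ioc e w := by
  obtain ⟨j, hj, -⟩ | ⟨x, hwx, hx⟩ := h
  · exact ⟨j, hj⟩
  · obtain ⟨j, hj, -⟩ := exists_pos_of_work_pos ((sub_pos.2 hwx).trans_le hx)
    exact ⟨j, hj.1⟩

/-- The busy period certificate for the deadline `x`: from some time `y ≥ a` until `t`, a processor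
has been executing work that arrived since `y` and is due by `x`, so that what remains of the jobs
that arrived during `I` is at most the work that arrived since `y`, minus the elapsed time. -/
def BusyBound (J : ι → Job) (r : ι → ℝ) (I : Set ℝ) (a t x : ℝ) : Prop :=
  ∃ y ∈ Icc a t, workDue J r I x + (t - y) ≤ workDue J (execTimes J) (Icc y t) x

theorem BusyBound.workDue_le {r : ι → ℝ} {I : Set ℝ} {a t x : ℝ} (h : BusyBound J r I a t x)
    (hJ : EDFCondition J) (htx : t < x) : workDue J r I x ≤ x - t := by
  obtain ⟨y, hy, hle⟩ := h
  have hdemand := hJ.workDue_le (hy.2.trans_lt htx)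
  have hmono : workDue J (execTimes J) (Icc y t) x ≤ workDue J (execTimes J) (Ici y) x :=
    workDue_mono_set (execTimes_nonneg J) Icc_subset_Ici_self x
  linarith

/-- Facts about the remaining execution times `r` at time `t`, where the system was last turned off
at time `e`. -/
structure RemainingInvariant (J : ι → Job) (t e : ℝ) (r : ι → ℝ) : Prop where
  nonneg : ∀ j, 0 ≤ r j
  le_exec : ∀ j, r j ≤ (J j).exec
  future : ∀ j, t ≤ (J j).arrival → r j = (J j).exec
  past : ∀ j, (J j).arrival ≤ e → r j = 0
  due : ∀ j, (J j).deadline ≤ t → r j = 0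
  e_le : e ≤ t

/-- The system is off, and the rules have not yet been applied at time `t`. -/
structure PreOffPhase (P : PowerModel) (J : ι → Job) (t e : ℝ) (r : ι → ℝ) (s : SysState) :
    Prop where
  base : RemainingInvariant J t e r
  off : s.IsOff
  calm : s.urgent = false
  unstarted : ∀ j, e < (J j).arrival → r j = (J j).exec
  early : ∀ j, (J j).arrival ∈ Ioo e t → t + P.breakEven ≤ (J j).deadline
  fits : ∀ x, t ≤ x → workDue J r (Iio t) x ≤ x - t

/-- The system is off. -/
structure OffPhase (P : PowerModel) (J : ι → Job) (t e : ℝ) (r : ι → ℝ) (s : SysState) : Prop where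
  base : RemainingInvariant J t e r
  off : s.IsOff
  calm : s.urgent = false
  unstarted : ∀ j, e < (J j).arrival → r j = (J j).exec
  relaxed : ∀ j ∈ openJobs J r t, t < anchor P 1 (J j)
  loose : ∀ x, t < x → workDue J r (Iic t) x < x - t

/-- Only `M₁` is on, and the rules have not yet been applied at time `t`. By `slack`, the pending
work due by `x` can exceed the time left only if `M₁` has been executing jobs due by `x` ever since
it was turned on: otherwise `BusyBound` applies from the last time it was not. -/
structure PreSinglePhase (P : PowerModel) (J : ι → Job) (t e : ℝ) (r : ι → ℝ) (s : SysState) :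
    Prop where
  base : RemainingInvariant J t e r
  on0 : s.on 0 = true
  on1 : s.on 1 = false
  calm : s.urgent = false
  e_lt : e < s.t1
  t1_le : s.t1 ≤ t
  trig : Trigger P J e s.t1
  early : ∀ j, (J j).arrival ∈ Ioo e s.t1 → s.t1 + P.breakEven ≤ (J j).deadline
  fits : ∀ x, t ≤ x → workDue J r (Iio t) x ≤ x - t
  slack : ∀ x, workDue J r (Iic t) x + (t - s.t1) ≤ workDue J (execTimes J) (Ioc e t) x ∨
    BusyBound J r (Iic t) s.t1 t x
  idle : (t - s.t1) - work (execTimes J - r) (arriving J (Ioi e)) ≤ P.breakEven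

/-- Only `M₁` is on. -/
structure SinglePhase (P : PowerModel) (J : ι → Job) (t e : ℝ) (r : ι → ℝ) (s : SysState) : Prop
    extends PreSinglePhase P J t e r s where
  loose : ∀ x, t < x → workDue J r (Iic t) x ≤ x - t
  awake : (openJobs J r t).Nonempty ∨ t < s.t1 + P.breakEven

/-- `M₂` is on, since time `s.tStar`. -/
structure RaisedPhase (P : PowerModel) (J : ι → Job) (t e : ℝ) (r : ι → ℝ) (s : SysState) :
    Prop where
  base : RemainingInvariant J t e r
  on1 : s.on 1 = true
  e_lt : e < s.t1
  t1_le : s.t1 ≤ s.tStar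
  tStar_le : s.tStar ≤ t
  trig : Trigger P J e s.t1
  bulk : P.breakEven ≤ work (execTimes J) (arriving J (Ioc e s.tStar))
  slack : ∀ x, BusyBound J r (Iic t ∩ s.window 1) s.tStar t x

/-- The urgency flag is true, and the rules have not yet been applied at time `t`. -/
structure PreUrgentPhase (P : PowerModel) (J : ι → Job) (t e : ℝ) (r : ι → ℝ) (s : SysState) :
    Prop extends RaisedPhase P J t e r s where
  on0 : s.on 0 = true
  flag : s.urgent = true
  oldDone : t - s.t1 ≤ work (execTimes J - r) (arriving J (Ioo e s.tStar))
  fitsOld : ∀ x, t ≤ x → workDue J r (Iio s.tStar) x ≤ x - t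

/-- The urgency flag is true. -/
structure UrgentPhase (P : PowerModel) (J : ι → Job) (t e : ℝ) (r : ι → ℝ) (s : SysState) : Prop
    extends PreUrgentPhase P J t e r s where
  busy : ∃ j ∈ openJobs J r t, (J j).arrival < s.tStar

/-- Only `M₂` is on, and the rules have not yet been applied at time `t`. -/
structure PreTailPhase (P : PowerModel) (J : ι → Job) (t e : ℝ) (r : ι → ℝ) (s : SysState) :
    Prop extends RaisedPhase P J t e r s where
  on0 : s.on 0 = false
  calm : s.urgent = false
  oldDone : ∀ j, (J j).arrival < s.tStar → r j = 0
  idle : (t - s.tStar) - work (execTimes J - r) (arriving J (Ici s.tStar)) ≤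
    work (execTimes J) (arriving J (Ioc e s.tStar))

/-- Only `M₂` is on. -/
structure TailPhase (P : PowerModel) (J : ι → Job) (t e : ℝ) (r : ι → ℝ) (s : SysState) : Prop
    extends PreTailPhase P J t e r s where
  awake : (openJobs J r t).Nonempty ∨ t < s.t1 + P.breakEven

end Phases

section Segments

variable {ι : Type*} [Fintype ι] {P : PowerModel} {J : ι → Job} {s : SysState} {t u e a x : ℝ}
  {r r' : ι → ℝ} {m : Fin 2}

/-- The evolution of the remaining execution times from `r` at time `u` to `r'` at time `t` while
the system is in state `s` and no job arrives strictly in between. -/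
structure Segment (P : PowerModel) (J : ι → Job) (s : SysState) (u : ℝ) (r : ι → ℝ) (t : ℝ)
    (r' : ι → ℝ) : Prop where
  lt : u < t
  quiet : ∀ j, (J j).arrival ≤ u ∨ t ≤ (J j).arrival
  nonneg : ∀ j, 0 ≤ r' j
  anti : ∀ j, r' j ≤ r j
  unarrived : ∀ j, t ≤ (J j).arrival → r' j = r j
  frozen : s.IsOff → r' = r
  drain : ∀ m, s.on m = true → ∀ x, workDue J r' (Iic u ∩ s.window m) x =
    max 0 (workDue J r (Iic u ∩ s.window m) x - (t - u))
  stay_off : s.IsOff → (∀ j ∈ openJobs J r u, t ≤ anchor P 1 (J j)) ∧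
    ∀ x, t ≤ x → workDue J r (Iic u) x ≤ x - t
  stay_on : s.urgent = false → ¬ s.IsOff → work r (arriving J (Iic u)) < t - u →
    t ≤ s.t1 + P.breakEven
  stay_urgent : s.urgent = true → t - u ≤ work r (arriving J (Iic u ∩ s.window 0))

namespace Segment

theorem arriving_Iio (h : Segment P J s u r t r') : arriving J (Iio t) = arriving J (Iic u) := by
  ext j
  exact ⟨fun hj => (h.quiet j).resolve_right (not_le.2 hj), fun hj => lt_of_le_of_lt hj h.lt⟩

theorem workDue_Iio (h : Segment P J s u r t r') (f : ι → ℝ) (x : ℝ) :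
    workDue J f (Iio t) x = workDue J f (Iic u) x := by
  rw [workDue, h.arriving_Iio, workDue]

theorem eq_zero (h : Segment P J s u r t r') {j : ι} (hj : r j = 0) : r' j = 0 :=
  ((h.anti j).trans hj.le).antisymm (h.nonneg j)

theorem remainingInvariant (h : Segment P J s u r t r') (hJ : EDFCondition J)
    (hb : RemainingInvariant J u e r)
    (hdue : ∀ j, (J j).arrival ≤ u → (J j).deadline ∈ Ioc u t → r' j = 0) :
    RemainingInvariant J t e r' where
  nonneg := h.nonneg
  le_exec j := (h.anti j).trans (hb.le_exec j)
  future j hj := by rw [h.unarrived j hj, hb.future j (h.lt.le.trans hj)]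
  past j hj := h.eq_zero (hb.past j hj)
  due j hj := by
    have harr := (h.quiet j).resolve_right ((hJ.arrival_lt_deadline j).trans_le hj).not_ge
    rcases le_or_gt (J j).deadline u with hu | hu
    · exact h.eq_zero (hb.due j hu)
    · exact hdue j harr ⟨hu, hj⟩
  e_le := hb.e_le.trans h.lt.le

theorem work_arriving_window (h : Segment P J s u r t r') (hm : s.on m = true) :
    work r' (arriving J (Iic u ∩ s.window m)) =
      max 0 (work r (arriving J (Iic u ∩ s.window m)) - (t - u)) := by
  obtain ⟨x, hx⟩ := exists_workDue_eq J (Iic u ∩ s.window m)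
  rw [← hx, ← hx, h.drain m hm]

theorem workDue_le (h : Segment P J s u r t r') (hm : s.on m = true) (hx : t ≤ x)
    (hfits : workDue J r (Iic u ∩ s.window m) x ≤ x - u) :
    workDue J r' (Iic u ∩ s.window m) x ≤ x - t := by
  rw [h.drain m hm]
  exact max_le (sub_nonneg.2 hx) (by linarith)

theorem eq_zero_of_fits (h : Segment P J s u r t r') (hm : s.on m = true) {j : ι}
    (hj : (J j).arrival ∈ Iic u ∩ s.window m) (hd : (J j).deadline ≤ t)
    (hfits : workDue J r (Iic u ∩ s.window m) (J j).deadline ≤ (J j).deadline - u) : r' j = 0 := by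
  have hdrain := h.drain m hm (J j).deadline
  rw [max_eq_left (by linarith)] at hdrain
  exact eq_zero_of_work_nonpos h.nonneg hdrain.le ⟨hj, le_refl (J j).deadline⟩

theorem workDue_Iic_inter (h : Segment P J s u r t r') (hb : RemainingInvariant J u e r)
    {I : Set ℝ} (hI : Ici t ⊆ I) (x : ℝ) :
    workDue J r' (Iic t ∩ I) x =
      workDue J r' (Iic u ∩ I) x + workDue J (execTimes J) (Ioc u t) x := by
  have hnew : workDue J (execTimes J) (Ioc u t) x = workDue J r' (Ioc u t) x :=
    work_congr fun j hj => by
      rw [h.unarrived j ((h.quiet j).resolve_left hj.1.1.not_ge), hb.future j hj.1.1.le]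
  have hdisj : Disjoint (Iic u ∩ I) (Ioc u t) :=
    (Iic_disjoint_Ioc le_rfl).mono_left inter_subset_left
  rw [hnew, ← workDue_union J r' hdisj]
  refine work_congr_set fun j hj => absurd (and_congr_left fun _ => ?_) hj
  refine ⟨fun ⟨hjt, hjI⟩ => ?_, ?_⟩
  · exact (le_or_gt (J j).arrival u).imp (fun hju => ⟨hju, hjI⟩) fun hju => ⟨hju, hjt⟩
  · rintro (⟨hju, hjI⟩ | ⟨hju, hjt⟩)
    · exact ⟨hju.trans h.lt.le, hjI⟩
    · exact ⟨hjt, hI ((h.quiet j).resolve_left hju.not_ge)⟩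

theorem workDue_window (h : Segment P J s u r t r') (hb : RemainingInvariant J u e r)
    (hm : s.on m = true) (hI : Ici t ⊆ s.window m) (x : ℝ) :
    workDue J r' (Iic t ∩ s.window m) x + (t - u) =
        workDue J r (Iic u ∩ s.window m) x + workDue J (execTimes J) (Ioc u t) x ∨
      workDue J r' (Iic t ∩ s.window m) x = workDue J (execTimes J) (Icc t t) x := by
  have hnew : workDue J (execTimes J) (Ioc u t) x = workDue J (execTimes J) (Icc t t) x :=
    work_congr_set fun j hj => absurd (and_congr_left fun _ => and_congr_left fun _ =>
      ⟨fun hju => (h.quiet j).resolve_left hju.not_ge, h.lt.trans_le⟩) hj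
  rw [h.workDue_Iic_inter hb hI, h.drain m hm]
  rcases max_choice 0 (workDue J r (Iic u ∩ s.window m) x - (t - u)) with h0 | h0
  · exact Or.inr (by rw [h0, zero_add, hnew])
  · exact Or.inl (by rw [h0]; ring)

theorem busyBound (h : Segment P J s u r t r') (hb : RemainingInvariant J u e r)
    (hm : s.on m = true) (hI : Ici t ⊆ s.window m) (ha : a ≤ u)
    (hbusy : BusyBound J r (Iic u ∩ s.window m) a u x) :
    BusyBound J r' (Iic t ∩ s.window m) a t x := by
  rcases h.workDue_window hb hm hI x with heq | heq
  · obtain ⟨y, hy, hle⟩ := hbusy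
    refine ⟨y, ⟨hy.1, hy.2.trans h.lt.le⟩, ?_⟩
    rw [← Icc_union_Ioc_eq_Icc hy.2 h.lt.le, workDue_union]
    · linarith
    · exact (Iic_disjoint_Ioc le_rfl).mono_left Icc_subset_Iic_self
  · exact ⟨t, ⟨ha.trans h.lt.le, le_rfl⟩, by linarith⟩

theorem sub_work_eq_or_le (h : Segment P J s u r t r') (hcalm : s.urgent = false)
    (hm : s.on m = true) {A : Set ι} (hA : ∀ j, (J j).arrival ≤ u → j ∉ A → r j = 0) :
    work (execTimes J - r') A - work (execTimes J - r) A = t - u ∨ t ≤ s.t1 + P.breakEven := by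
  have hdrain := h.work_arriving_window hm
  rw [SysState.window_of_calm hcalm, inter_univ] at hdrain
  rcases lt_or_ge (work r (arriving J (Iic u))) (t - u) with hlt | hge
  · exact .inr (h.stay_on hcalm (fun hoff => by simp [hoff m] at hm) hlt)
  · left
    rw [work_progress (C := arriving J (Iic u)), hdrain, max_eq_right (by linarith), sub_sub_cancel]
    intro j hj
    by_cases hju : (J j).arrival ≤ u
    · have hr := hA j hju fun hjA => hj ⟨fun _ => hju, fun _ => hjA⟩
      rw [h.eq_zero hr, hr]
    · exact h.unarrived j ((h.quiet j).resolve_left hju)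

end Segment

theorem OffPhase.segment (hp : OffPhase P J u e r s) (hJ : EDFCondition J)
    (h : Segment P J s u r t r') : PreOffPhase P J t e r' s := by
  obtain rfl := h.frozen hp.off
  obtain ⟨hanchor, hfits⟩ := h.stay_off hp.off
  refine ⟨h.remainingInvariant hJ hp.base fun j hj hd => ?_, hp.off, hp.calm, hp.unstarted,
    fun j hj => ?_, fun x hx => (h.workDue_Iio _ x).trans_le (hfits x hx)⟩
  · exact eq_zero_of_work_nonpos hp.base.nonneg ((hfits t le_rfl).trans_eq (sub_self t)) ⟨hj, hd.2⟩
  · have hju := (h.quiet j).resolve_right hj.2.not_ge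
    have hpos : 0 < r' j := (hp.unstarted j hj.1).symm ▸ (J j).exec_pos
    have hdead := (le_max_iff.1 (hanchor j ⟨hju, hpos⟩)).resolve_left hj.2.not_ge
    linarith

theorem SinglePhase.segment (hp : SinglePhase P J u e r s) (hJ : EDFCondition J)
    (h : Segment P J s u r t r') : PreSinglePhase P J t e r' s := by
  have hwindow (I : Set ℝ) : I ∩ s.window 0 = I := by
    rw [SysState.window_of_calm hp.calm, inter_univ]
  have hsub : Ici t ⊆ s.window 0 := SysState.window_of_calm hp.calm 0 ▸ subset_univ _
  have hbase : RemainingInvariant J t e r' := h.remainingInvariant hJ hp.base fun j hj hd =>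
    h.eq_zero_of_fits hp.on0 (by rwa [hwindow]) hd.2 (by rw [hwindow]; exact hp.loose _ hd.1)
  have hfits (x : ℝ) (hx : t ≤ x) : workDue J r' (Iio t) x ≤ x - t := by
    rw [h.workDue_Iio, ← hwindow (Iic u)]
    exact h.workDue_le hp.on0 hx (by rw [hwindow]; exact hp.loose x (h.lt.trans_le hx))
  refine ⟨hbase, hp.on0, hp.on1, hp.calm, hp.e_lt, hp.t1_le.trans h.lt.le, hp.trig, hp.early, hfits,
    fun x => ?_, ?_⟩
  · have hold := hp.slack x
    have hbusy := h.busyBound (x := x) hp.base hp.on0 hsub hp.t1_le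
    have hnew := h.workDue_window hp.base hp.on0 hsub x
    rw [hwindow, hwindow] at hbusy hnew
    rcases hold with hold | hold
    · rcases hnew with hnew | hnew
      · left
        rw [← Ioc_union_Ioc_eq_Ioc hp.base.e_le h.lt.le,
          workDue_union _ _ (Ioc_disjoint_Ioc_of_le le_rfl)]
        linarith
      · exact .inr ⟨t, ⟨hp.t1_le.trans h.lt.le, le_rfl⟩, by linarith⟩
    · exact .inr (hbusy hold)
  · have hidle := hp.idle
    rcases h.sub_work_eq_or_le hp.calm hp.on0 (A := arriving J (Ioi e))
      fun j _ hj => hp.base.past j (not_lt.1 hj) with hprog | hle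
    · linarith
    · have hdone : 0 ≤ work (execTimes J - r') (arriving J (Ioi e)) :=
        work_nonneg fun j _ => sub_nonneg.2 (hbase.le_exec j)
      linarith

theorem RaisedPhase.segment (hp : RaisedPhase P J u e r s) (hJ : EDFCondition J)
    (h : Segment P J s u r t r')
    (hold : ∀ j, (J j).arrival ∉ s.window 1 → (J j).deadline ∈ Ioc u t → r' j = 0) :
    RaisedPhase P J t e r' s where
  base := h.remainingInvariant hJ hp.base fun j hj hd => by
    by_cases hw : (J j).arrival ∈ s.window 1
    · exact h.eq_zero_of_fits hp.on1 ⟨hj, hw⟩ hd.2 ((hp.slack _).workDue_le hJ hd.1)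
    · exact hold j hw hd
  on1 := hp.on1
  e_lt := hp.e_lt
  t1_le := hp.t1_le
  tStar_le := hp.tStar_le.trans h.lt.le
  trig := hp.trig
  bulk := hp.bulk
  slack x := h.busyBound hp.base hp.on1
    (SysState.Ici_subset_window_one (hp.tStar_le.trans h.lt.le)) hp.tStar_le (hp.slack x)

theorem UrgentPhase.segment (hp : UrgentPhase P J u e r s) (hJ : EDFCondition J)
    (h : Segment P J s u r t r') : PreUrgentPhase P J t e r' s := by
  have hwindow : Iic u ∩ s.window 0 = Iio s.tStar := by
    rw [SysState.window_zero_of_urgent hp.flag]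
    exact inter_eq_right.2 fun a ha => ha.le.trans hp.tStar_le
  have hraised : RaisedPhase P J t e r' s := hp.toRaisedPhase.segment hJ h fun j hj hd => by
    rw [SysState.window_one_of_urgent hp.flag, mem_Ici, not_le] at hj
    exact h.eq_zero_of_fits hp.on0 (hwindow ▸ hj) hd.2 (hwindow ▸ hp.fitsOld _ hd.1.le)
  refine ⟨hraised, hp.on0, hp.flag, ?_, fun x hx => ?_⟩
  · have hdrain := h.work_arriving_window hp.on0
    rw [max_eq_right (sub_nonneg.2 (h.stay_urgent hp.flag)), hwindow] at hdrain
    have hprog := work_progress (A := arriving J (Ioo e s.tStar)) (C := arriving J (Iio s.tStar))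
      (r := r) (r' := r') (execTimes J) fun j hj => by
        have hje : (J j).arrival ≤ e := by
          by_contra! hje
          exact hj ⟨And.right, fun hjt => ⟨hje, hjt⟩⟩
        rw [hraised.base.past j hje, hp.base.past j hje]
    have hold := hp.oldDone
    linarith
  · rw [← hwindow]
    exact h.workDue_le hp.on0 hx (hwindow ▸ hp.fitsOld x (h.lt.le.trans hx))

theorem TailPhase.segment (hp : TailPhase P J u e r s) (hJ : EDFCondition J)
    (h : Segment P J s u r t r') : PreTailPhase P J t e r' s := by
  have hraised : RaisedPhase P J t e r' s := hp.toRaisedPhase.segment hJ h fun j hj =>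
    absurd (SysState.window_of_calm hp.calm 1 ▸ mem_univ _) hj
  refine ⟨hraised, hp.on0, hp.calm, fun j hj => h.eq_zero (hp.oldDone j hj), ?_⟩
  have hidle := hp.idle
  rcases h.sub_work_eq_or_le hp.calm hp.on1 (A := arriving J (Ici s.tStar))
    fun j _ hj => hp.oldDone j (not_le.1 hj) with hprog | hle
  · linarith
  · have hdone : 0 ≤ work (execTimes J - r') (arriving J (Ici s.tStar)) :=
      work_nonneg fun j _ => sub_nonneg.2 (hraised.base.le_exec j)
    linarith [hp.bulk, hp.t1_le]

end Segments

namespace SysState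

variable {ι : Type*} {P : PowerModel} {J : ι → Job} {s : SysState} {t : ℝ} {Q : Set ι} {W : ℝ → ℝ}

/-- The state after the urgency flag has been raised at time `t` while `M₁` is on. -/
def raised (s : SysState) (t : ℝ) : SysState :=
  { s with on := Function.update s.on 1 true, urgent := true, tStar := t }

/-- The state after the urgency flag has been cleared. -/
def cleared (s : SysState) : SysState :=
  { s with on := Function.update s.on 0 false, urgent := false }

/-- The state after all processors have been turned off. -/
def halted (s : SysState) : SysState := { s with on := fun _ => false }

/-- The switching rules for `λ = 1`, applied at time `t` to state `s` when the remaining execution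
times are `r`. -/
def updateAt [Fintype ι] (P : PowerModel) (J : ι → Job) (r : ι → ℝ) (t : ℝ) (s : SysState) :
    SysState :=
  s.update P 1 J (openJobs J r t) (workDue J r (Iic t)) t

theorem not_isOff_of_on {m : Fin 2} (h : s.on m = true) : ¬ s.IsOff :=
  fun hoff => Bool.false_ne_true ((hoff m).symm.trans h)

theorem wakeUp_of_on {lam : ℝ} {m : Fin 2} (h : s.on m = true) : s.wakeUp P lam J Q W t = s :=
  if_neg fun hc => not_isOff_of_on h hc.1

theorem raiseUrgency_of_fits (h : ∀ x, t < x → W x ≤ x - t) : s.raiseUrgency W t = s :=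
  if_neg fun ⟨_, x, hx, hW⟩ => (h x hx).not_gt hW

theorem raiseUrgency_of_urgent (h : s.urgent = true) : s.raiseUrgency W t = s :=
  if_neg fun hc => by simp [h] at hc

theorem raiseUrgency_of_on (h0 : s.on 0 = true) (hcalm : s.urgent = false) {x : ℝ} (hx : t < x)
    (hW : x - t < W x) : s.raiseUrgency W t = s.raised t := by
  rw [raiseUrgency, if_pos ⟨hcalm, x, hx, hW⟩]
  simp [h0, raised]

theorem clearUrgency_of_calm (h : s.urgent = false) : s.clearUrgency J Q = s :=
  if_neg fun hc => by simp [h] at hc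

theorem clearUrgency_of_busy (h : ∃ j ∈ Q, (J j).arrival < s.tStar) : s.clearUrgency J Q = s :=
  let ⟨j, hj, hjt⟩ := h
  if_neg fun hc => (hc.2 j hj).not_gt hjt

theorem shutDown_of_awake (h : Q.Nonempty ∨ t < s.t1 + P.breakEven) : s.shutDown P Q t = s :=
  if_neg fun hc => h.elim (fun h => h.ne_empty hc.2.2.1) fun h => by linarith [hc.2.2.2]

theorem shutDown_of_idle {m : Fin 2} (hm : s.on m = true) (hcalm : s.urgent = false) (hQ : Q = ∅)
    (ht : s.t1 + P.breakEven ≤ t) : s.shutDown P Q t = s.halted :=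
  if_pos ⟨hcalm, not_isOff_of_on hm, hQ, by linarith⟩

end SysState

section Transitions

variable {ι : Type*} [Fintype ι] {P : PowerModel} {J : ι → Job} {s : SysState} {t e x : ℝ}
  {r : ι → ℝ}

open SysState

namespace RemainingInvariant

theorem workDue_Iic (h : RemainingInvariant J t e r) (x : ℝ) :
    workDue J r (Iic t) x = workDue J r (Ioc e t) x :=
  work_congr_set fun j hj => h.past j <| by
    by_contra! hje
    exact hj (and_congr_left' ⟨fun hjt => ⟨hje, hjt⟩, And.right⟩)

theorem workDue_le_exec (h : RemainingInvariant J t e r) (I : Set ℝ) (x : ℝ) :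
    workDue J r I x ≤ workDue J (execTimes J) I x :=
  work_mono h.le_exec

theorem workDue_sub_le (h : RemainingInvariant J t e r) (x : ℝ) :
    workDue J (execTimes J) (Ioc e t) x - workDue J r (Iic t) x ≤
      work (execTimes J - r) (arriving J (Ioo e t)) := by
  rw [h.workDue_Iic, workDue, workDue, ← work_sub,
    work_congr_set (B := arriving J (Ioo e t) ∩ dueBy J x)]
  · exact work_mono_set (fun j => sub_nonneg.2 (h.le_exec j)) inter_subset_left
  · refine fun j hj => sub_eq_zero.2 (h.future j ?_).symm
    by_contra! hjt
    exact hj (and_congr_left' ⟨fun hje => ⟨hje.1, hjt⟩, fun hje => ⟨hje.1, hje.2.le⟩⟩)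

omit [Fintype ι] in
theorem eq_zero_of_not_open (h : RemainingInvariant J t e r) {j : ι} (hj : j ∉ openJobs J r t)
    (hjt : (J j).arrival ≤ t) : r j = 0 :=
  (not_lt.1 fun hr => hj ⟨hjt, hr⟩).antisymm (h.nonneg j)

theorem offPhase (h : RemainingInvariant J t e r) (hQ : openJobs J r t = ∅)
    (hs : s.urgent = false) : OffPhase P J t t r s.halted := by
  have hzero (j : ι) (hj : (J j).arrival ≤ t) : r j = 0 :=
    h.eq_zero_of_not_open (hQ ▸ notMem_empty j) hj
  refine ⟨⟨h.nonneg, h.le_exec, h.future, hzero, h.due, le_rfl⟩, fun _ => rfl, hs,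
    fun j hj => h.future j hj.le, fun j hj => absurd hj (hQ ▸ notMem_empty j), fun x hx => ?_⟩
  rw [workDue, work_eq_zero fun j hj => hzero j hj.1]
  exact sub_pos.2 hx

end RemainingInvariant

theorem OffPhase.updateAt_eq (h : OffPhase P J t e r s) : s.updateAt P J r t = s := by
  have hwake : s.wakeUp P 1 J (openJobs J r t) (workDue J r (Iic t)) t = s := by
    refine if_neg fun hc => ?_
    obtain ⟨j, hj, ha⟩ | ⟨x, hx, hW⟩ := hc.2
    · exact (h.relaxed j hj).not_ge ha
    · exact (h.loose x hx).not_ge hW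
  rw [updateAt, update, hwake, raiseUrgency_of_fits fun x hx => (h.loose x hx).le,
    clearUrgency_of_calm h.calm]
  exact if_neg fun hc => hc.2.1 h.off

theorem SinglePhase.updateAt_eq (h : SinglePhase P J t e r s) : s.updateAt P J r t = s := by
  rw [updateAt, update, wakeUp_of_on h.on0, raiseUrgency_of_fits h.loose,
    clearUrgency_of_calm h.calm, shutDown_of_awake h.awake]

theorem UrgentPhase.updateAt_eq (h : UrgentPhase P J t e r s) : s.updateAt P J r t = s := by
  rw [updateAt, update, wakeUp_of_on h.on0, raiseUrgency_of_urgent h.flag,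
    clearUrgency_of_busy h.busy, shutDown_of_awake (.inl (h.busy.imp fun _ => And.left))]

theorem PreTailPhase.workDue_le (h : PreTailPhase P J t e r s) (hJ : EDFCondition J)
    (hx : t < x) : workDue J r (Iic t) x ≤ x - t := by
  have hle := (h.slack x).workDue_le hJ hx
  rwa [window_of_calm h.calm, inter_univ] at hle

theorem TailPhase.updateAt_eq (h : TailPhase P J t e r s) (hJ : EDFCondition J) :
    s.updateAt P J r t = s := by
  rw [updateAt, update, wakeUp_of_on h.on1, raiseUrgency_of_fits fun x hx => h.workDue_le hJ hx,
    clearUrgency_of_calm h.calm, shutDown_of_awake h.awake]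

namespace PreSinglePhase

theorem overload_slack (h : PreSinglePhase P J t e r s) (hJ : EDFCondition J) (hx : t < x)
    (hW : x - t < workDue J r (Iic t) x) :
    workDue J r (Iic t) x + (t - s.t1) ≤ workDue J (execTimes J) (Ioc e t) x :=
  (h.slack x).resolve_right fun hs => (hs.workDue_le hJ hx).not_gt hW

theorem breakEven_le_of_overload (h : PreSinglePhase P J t e r s) (hJ : EDFCondition J)
    (hx : t < x) (hW : x - t < workDue J r (Iic t) x) : s.t1 + P.breakEven ≤ x := by
  by_contra! hlt
  have hslack := h.overload_slack hJ hx hW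
  have hdemand := hJ.workDue_le (h.t1_le.trans_lt hx)
  have hmono : workDue J (execTimes J) (Ioc e t) x ≤ workDue J (execTimes J) (Ici s.t1) x := by
    refine work_mono_set (execTimes_nonneg J) fun j ⟨hj, hd⟩ => ⟨?_, hd⟩
    by_contra! hj1
    exact hlt.not_ge ((h.early j ⟨hj.1, not_le.1 hj1⟩).trans hd)
  linarith

theorem exists_old_of_overload (h : PreSinglePhase P J t e r s) (hJ : EDFCondition J)
    (hx : t < x) (hW : x - t < workDue J r (Iic t) x) :
    ∃ j ∈ openJobs J r t, (J j).arrival < t := by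
  by_contra! hnew
  refine hW.not_ge (le_trans ?_ (hJ.workDue_le hx))
  calc workDue J r (Iic t) x = workDue J r (Icc t t) x := work_congr_set fun j hj => by
        by_contra hr
        have hpos := (h.base.nonneg j).lt_of_ne' hr
        exact hj (and_congr_left' ⟨fun hjt => ⟨hnew j ⟨hjt, hpos⟩, hjt⟩, And.right⟩)
    _ ≤ workDue J (execTimes J) (Icc t t) x := h.base.workDue_le_exec _ x
    _ ≤ workDue J (execTimes J) (Ici t) x :=
        workDue_mono_set (execTimes_nonneg J) Icc_subset_Ici_self x

theorem urgentPhase (h : PreSinglePhase P J t e r s) (hJ : EDFCondition J) (hx : t < x)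
    (hW : x - t < workDue J r (Iic t) x) : UrgentPhase P J t e r (s.raised t) where
  base := h.base
  on1 := by simp [raised]
  e_lt := h.e_lt
  t1_le := h.t1_le
  tStar_le := le_rfl
  trig := h.trig
  bulk := by
    have hslack := h.overload_slack hJ hx hW
    have hbreak := h.breakEven_le_of_overload hJ hx hW
    have hmono : workDue J (execTimes J) (Ioc e t) x ≤ work (execTimes J) (arriving J (Ioc e t)) :=
      work_mono_set (execTimes_nonneg J) inter_subset_left
    simp only [raised]
    linarith
  slack y := by
    refine ⟨t, ⟨le_rfl, le_rfl⟩, ?_⟩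
    rw [window_one_of_urgent rfl, sub_self, add_zero, inter_comm]
    exact h.base.workDue_le_exec _ y
  on0 := by simpa [raised] using h.on0
  flag := rfl
  oldDone := by
    have hslack := h.overload_slack hJ hx hW
    have hdone := h.base.workDue_sub_le x
    simp only [raised]
    linarith
  fitsOld := h.fits
  busy := h.exists_old_of_overload hJ hx hW

theorem rest_cases (h : PreSinglePhase P J t e r s) (hJ : EDFCondition J) {s' : SysState}
    (hs' : s' = ((s.raiseUrgency (workDue J r (Iic t)) t).clearUrgency J (openJobs J r t)).shutDown
      P (openJobs J r t) t) :
    s' = s ∧ SinglePhase P J t e r s ∨ s' = s.raised t ∧ UrgentPhase P J t e r (s.raised t) ∨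
      s' = s.halted ∧ openJobs J r t = ∅ ∧ s.t1 + P.breakEven ≤ t ∧
        OffPhase P J t t r s.halted := by
  by_cases hW : ∃ x, t < x ∧ x - t < workDue J r (Iic t) x
  · obtain ⟨x, hx, hWx⟩ := hW
    have hurgent := h.urgentPhase hJ hx hWx
    refine .inr (.inl ⟨?_, hurgent⟩)
    rw [hs', raiseUrgency_of_on h.on0 h.calm hx hWx, clearUrgency_of_busy hurgent.busy,
      shutDown_of_awake (.inl (hurgent.busy.imp fun _ => And.left))]
  · push Not at hW
    rw [raiseUrgency_of_fits hW, clearUrgency_of_calm h.calm] at hs'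
    by_cases hawake : (openJobs J r t).Nonempty ∨ t < s.t1 + P.breakEven
    · exact .inl ⟨hs'.trans (shutDown_of_awake hawake), h, hW, hawake⟩
    · push Not at hawake
      exact .inr (.inr ⟨hs'.trans (shutDown_of_idle h.on0 h.calm hawake.1 hawake.2), hawake.1,
        hawake.2, h.base.offPhase hawake.1 h.calm⟩)

theorem updateAt_cases (h : PreSinglePhase P J t e r s) (hJ : EDFCondition J) {s' : SysState}
    (hs' : s' = s.updateAt P J r t) :
    s' = s ∧ SinglePhase P J t e r s ∨ s' = s.raised t ∧ UrgentPhase P J t e r (s.raised t) ∨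
      s' = s.halted ∧ openJobs J r t = ∅ ∧ s.t1 + P.breakEven ≤ t ∧
        OffPhase P J t t r s.halted := by
  rw [updateAt, update, wakeUp_of_on h.on0] at hs'
  exact h.rest_cases hJ hs'

end PreSinglePhase

namespace PreOffPhase

theorem trigger (h : PreOffPhase P J t e r s)
    (hw : (∃ j ∈ openJobs J r t, anchor P 1 (J j) ≤ t) ∨
      ∃ x, t < x ∧ x - t ≤ workDue J r (Iic t) x) : Trigger P J e t := by
  obtain ⟨j, hj, ha⟩ | ⟨x, hx, hW⟩ := hw
  · have hje : e < (J j).arrival := not_le.1 fun hc => hj.2.ne' (h.base.past j hc)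
    have hdead := (le_max_right _ _).trans ha
    exact .inl ⟨j, ⟨hje, hj.1⟩, by linarith⟩
  · refine .inr ⟨x, hx, hW.trans ?_⟩
    rw [h.base.workDue_Iic]
    exact h.base.workDue_le_exec _ x

theorem preSinglePhase (h : PreOffPhase P J t e r s) (htrig : Trigger P J e t) :
    PreSinglePhase P J t e r (s.turnOnM1 t) where
  base := h.base
  on0 := by simp [turnOnM1]
  on1 := by simpa [turnOnM1] using h.off 1
  calm := h.calm
  e_lt := by
    obtain ⟨j, hj⟩ := htrig.exists_arrival_mem
    exact hj.1.trans_le hj.2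
  t1_le := le_rfl
  trig := htrig
  early := h.early
  fits := h.fits
  slack x := by
    simp only [turnOnM1, sub_self, add_zero, h.base.workDue_Iic]
    exact .inl (h.base.workDue_le_exec _ x)
  idle := by
    have hdone : 0 ≤ work (execTimes J - r) (arriving J (Ioi e)) :=
      work_nonneg fun j _ => sub_nonneg.2 (h.base.le_exec j)
    simp only [turnOnM1]
    linarith [P.breakEven_nonneg]

theorem updateAt_cases (h : PreOffPhase P J t e r s) (hJ : EDFCondition J) {s' : SysState}
    (hs' : s' = s.updateAt P J r t) :
    s' = s ∧ OffPhase P J t e r s ∨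
      s' = s.turnOnM1 t ∧ SinglePhase P J t e r (s.turnOnM1 t) ∨
      s' = (s.turnOnM1 t).raised t ∧ UrgentPhase P J t e r ((s.turnOnM1 t).raised t) := by
  by_cases hw : (∃ j ∈ openJobs J r t, anchor P 1 (J j) ≤ t) ∨
      ∃ x, t < x ∧ x - t ≤ workDue J r (Iic t) x
  · have htrig := h.trigger hw
    rw [updateAt, update, wakeUp, if_pos ⟨h.off, hw⟩] at hs'
    obtain hsingle | hurgent | ⟨-, hempty, -⟩ := (h.preSinglePhase htrig).rest_cases hJ hs'
    · exact .inr (.inl hsingle)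
    · exact .inr (.inr hurgent)
    · obtain ⟨j, hj⟩ := htrig.exists_arrival_mem
      have hopen : j ∈ openJobs J r t := ⟨hj.2, (h.unstarted j hj.1).symm ▸ (J j).exec_pos⟩
      simp [hempty] at hopen
  · push Not at hw
    have hoff : OffPhase P J t e r s := ⟨h.base, h.off, h.calm, h.unstarted, hw.1, hw.2⟩
    exact .inl ⟨hs'.trans hoff.updateAt_eq, hoff⟩

theorem initial (hJ : EDFCondition J) :
    PreOffPhase P J 0 (-1) (execTimes J) SysState.initial := by
  have hne (j : ι) : ¬ (J j).arrival < 0 := (J j).arrival_nonneg.not_gt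
  refine ⟨⟨execTimes_nonneg J, fun _ => le_rfl, fun _ _ => rfl, fun j hj => ?_, fun j hj => ?_,
    by norm_num⟩, fun _ => rfl, rfl, fun _ _ => rfl, fun j hj => absurd hj.2 (hne j),
    fun x hx => ?_⟩
  · linarith [(J j).arrival_nonneg]
  · linarith [(J j).arrival_nonneg, hJ.arrival_lt_deadline j]
  · rw [workDue, work_eq_zero fun j hj => absurd hj.1 (hne j)]
    exact sub_nonneg.2 hx

end PreOffPhase

namespace PreTailPhase

theorem shutDown_cases (h : PreTailPhase P J t e r s) {s' : SysState}
    (hs' : s' = s.shutDown P (openJobs J r t) t) :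
    s' = s ∧ TailPhase P J t e r s ∨
      s' = s.halted ∧ openJobs J r t = ∅ ∧ s.t1 + P.breakEven ≤ t ∧
        OffPhase P J t t r s.halted := by
  by_cases hawake : (openJobs J r t).Nonempty ∨ t < s.t1 + P.breakEven
  · exact .inl ⟨hs'.trans (shutDown_of_awake hawake), h, hawake⟩
  · push Not at hawake
    exact .inr ⟨hs'.trans (shutDown_of_idle h.on1 h.calm hawake.1 hawake.2), hawake.1, hawake.2,
      h.base.offPhase hawake.1 h.calm⟩

theorem updateAt_cases (h : PreTailPhase P J t e r s) (hJ : EDFCondition J) {s' : SysState}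
    (hs' : s' = s.updateAt P J r t) :
    s' = s ∧ TailPhase P J t e r s ∨
      s' = s.halted ∧ openJobs J r t = ∅ ∧ s.t1 + P.breakEven ≤ t ∧
        OffPhase P J t t r s.halted := by
  rw [updateAt, update, wakeUp_of_on h.on1, raiseUrgency_of_fits fun x hx => h.workDue_le hJ hx,
    clearUrgency_of_calm h.calm] at hs'
  exact h.shutDown_cases hs'

end PreTailPhase

namespace PreUrgentPhase

theorem preTailPhase (h : PreUrgentPhase P J t e r s)
    (hold : ∀ j ∈ openJobs J r t, s.tStar ≤ (J j).arrival) : PreTailPhase P J t e r s.cleared := by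
  have hzero (j : ι) (hj : (J j).arrival < s.tStar) : r j = 0 :=
    h.base.eq_zero_of_not_open (fun hopen => (hold j hopen).not_gt hj) (hj.le.trans h.tStar_le)
  refine ⟨⟨h.base, by simpa [cleared] using h.on1, h.e_lt, h.t1_le, h.tStar_le, h.trig, h.bulk,
    fun x => ?_⟩, by simp [cleared], rfl, hzero, ?_⟩
  · obtain ⟨y, hy, hle⟩ := h.slack x
    refine ⟨y, hy, le_of_eq_of_le (congrArg (· + _) (work_congr_set fun j hj => hzero j ?_)) hle⟩
    by_contra! hjt
    rw [window_of_calm rfl, inter_univ, window_one_of_urgent h.flag] at hj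
    exact hj (and_congr_left' ⟨fun hj' => ⟨hj', hjt⟩, And.left⟩)
  · have hnew : 0 ≤ work (execTimes J - r) (arriving J (Ici s.tStar)) :=
      work_nonneg fun j _ => sub_nonneg.2 (h.base.le_exec j)
    have hdone : work (execTimes J - r) (arriving J (Ioo e s.tStar)) ≤
        work (execTimes J) (arriving J (Ioc e s.tStar)) :=
      (work_mono fun j => sub_le_self _ (h.base.nonneg j)).trans
        (work_mono_set (execTimes_nonneg J) fun j hj => Ioo_subset_Ioc_self hj)
    simp only [cleared]
    linarith [h.oldDone, h.t1_le]

theorem updateAt_cases (h : PreUrgentPhase P J t e r s) {s' : SysState}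
    (hs' : s' = s.updateAt P J r t) :
    s' = s ∧ UrgentPhase P J t e r s ∨ s' = s.cleared ∧ TailPhase P J t e r s.cleared ∨
      s' = s.cleared.halted ∧ openJobs J r t = ∅ ∧ s.t1 + P.breakEven ≤ t ∧
        OffPhase P J t t r s.cleared.halted := by
  by_cases hbusy : ∃ j ∈ openJobs J r t, (J j).arrival < s.tStar
  · have hurgent : UrgentPhase P J t e r s := ⟨h, hbusy⟩
    exact .inl ⟨hs'.trans hurgent.updateAt_eq, hurgent⟩
  · push Not at hbusy
    have hclear : s.clearUrgency J (openJobs J r t) = s.cleared := if_pos ⟨h.flag, hbusy⟩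
    rw [updateAt, update, wakeUp_of_on h.on0, raiseUrgency_of_urgent h.flag, hclear] at hs'
    exact .inr ((h.preTailPhase hbusy).shutDown_cases hs')

end PreUrgentPhase

end Transitions

section Induction

theorem forall_nonneg_of_continuation {p : ℝ → Prop} (h0 : p 0)
    (right : ∀ t, 0 ≤ t → p t → ∀ᶠ v in 𝓝[>] t, p v)
    (left : ∀ t, 0 < t → (∀ v ∈ Ico 0 t, p v) → p t) {t : ℝ} (ht : 0 ≤ t) : p t := by
  have hclosed : IsClosed ({x | ∀ y ∈ Icc 0 x, p y} ∩ Icc 0 t) := by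
    refine isClosed_of_closure_subset fun x hx => ?_
    have hxt : x ∈ Icc 0 t := closure_minimal inter_subset_right isClosed_Icc hx
    have hbefore : ∀ y ∈ Ico 0 x, p y := fun y hy =>
      let ⟨z, hyz, hz⟩ := mem_closure_iff.1 hx (Ioi y) isOpen_Ioi hy.2
      hz.1 y ⟨hy.1, hyz.le⟩
    refine ⟨fun y hy => ?_, hxt⟩
    obtain rfl | hyx := hy.2.eq_or_lt
    · obtain rfl | hypos := hy.1.eq_or_lt
      · exact h0
      · exact left y hypos hbefore
    · exact hbefore y ⟨hy.1, hyx⟩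
  have hstart : (0 : ℝ) ∈ {x | ∀ y ∈ Icc 0 x, p y} := fun y hy => hy.2.antisymm hy.1 ▸ h0
  refine hclosed.Icc_subset_of_forall_mem_nhdsWithin hstart (fun x hx => ?_) ⟨ht, le_rfl⟩ t
    ⟨ht, le_rfl⟩
  obtain ⟨b, hb, hbp⟩ :=
    mem_nhdsGT_iff_exists_Ioo_subset.1 (right x hx.2.1 (hx.1 x ⟨hx.2.1, le_rfl⟩))
  filter_upwards [Ioo_mem_nhdsGT hb] with z hz y hy
  obtain hyx | hxy := le_or_gt y x
  · exact hx.1 y ⟨hy.1, hyx⟩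
  · exact hbp ⟨hxy, hy.2.trans_lt hz.2⟩

variable {ι : Type*} {J : ι → Job} {σ : ℝ → SysState} {u v t : ℝ}

/-- During `[u, t)` the state of the algorithm does not change, and no job arrives except possibly
at time `u`. -/
structure IsSteady (J : ι → Job) (σ : ℝ → SysState) (u t : ℝ) : Prop where
  nonneg : 0 ≤ u
  lt : u < t
  const : ∀ v ∈ Ico u t, σ v = σ u
  quiet : ∀ j, (J j).arrival ≤ u ∨ t ≤ (J j).arrival

theorem IsSteady.mono (h : IsSteady J σ u t) (huv : u < v) (hvt : v ≤ t) : IsSteady J σ u v :=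
  ⟨h.nonneg, huv, fun w hw => h.const w ⟨hw.1, hw.2.trans_le hvt⟩,
    fun j => (h.quiet j).imp_right hvt.trans⟩

theorem IsSteady.arrival_le (h : IsSteady J σ u t) {j : ι} (hj : (J j).arrival < t) :
    (J j).arrival ≤ u :=
  (h.quiet j).resolve_right hj.not_ge

variable [Fintype ι] {P : PowerModel} {S : Schedule ι 2} {lam : ℝ}

namespace IsRun

theorem eventually_isSteady (h : IsRun P lam J S σ) (ht : 0 ≤ t) :
    ∀ᶠ v in 𝓝[>] t, IsSteady J σ t v := by
  have hquiet : ∀ᶠ v in 𝓝[>] t, ∀ j, (J j).arrival ≤ t ∨ v ≤ (J j).arrival := by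
    refine eventually_all.2 fun j => ?_
    obtain hj | hj := le_or_gt (J j).arrival t
    · exact .of_forall fun _ => .inl hj
    · filter_upwards [Ioo_mem_nhdsGT hj] with v hv using .inr hv.2.le
  obtain ⟨b, hb, hconst⟩ := mem_nhdsGT_iff_exists_Ioo_subset.1 (h.right t ht)
  filter_upwards [Ioo_mem_nhdsGT hb, hquiet] with v hv hqv
  refine ⟨ht, hv.1, fun w hw => ?_, hqv⟩
  obtain rfl | htw := hw.1.eq_or_lt
  · rfl
  · exact hconst ⟨htw, hw.2.trans hv.2⟩

theorem exists_isSteady (h : IsRun P lam J S σ) (ht : 0 < t) : ∃ u, IsSteady J σ u t := by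
  obtain ⟨s, hs, -⟩ := h.step t ht
  have hquiet : ∀ᶠ v in 𝓝[<] t, ∀ j, (J j).arrival ≤ v ∨ t ≤ (J j).arrival := by
    refine eventually_all.2 fun j => ?_
    obtain hj | hj := le_or_gt t (J j).arrival
    · exact .of_forall fun _ => .inr hj
    · filter_upwards [Ioo_mem_nhdsLT hj] with v hv using .inl hv.1.le
  obtain ⟨b, hb, hconst⟩ := (mem_nhdsLT_iff_exists_Ioo_subset' ht).1 hs
  have hnear : ∀ᶠ v in 𝓝[<] t, v ∈ Ioo b t := Ioo_mem_nhdsLT hb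
  obtain ⟨u, hu, hqu, hu0⟩ := (hnear.and (hquiet.and (Ioo_mem_nhdsLT ht))).exists
  exact ⟨u, hu0.1.le, hu.2, fun v hv => (hconst ⟨hu.1.trans_le hv.1, hv.2⟩).trans (hconst hu).symm,
    hqu⟩

theorem induction (h : IsRun P lam J S σ) {p : ℝ → Prop} (h0 : p 0)
    (hstep : ∀ u t, IsSteady J σ u t → p u → p t) (ht : 0 ≤ t) : p t :=
  forall_nonneg_of_continuation h0
    (fun t ht hp => (h.eventually_isSteady ht).mono fun v hv => hstep t v hv hp)
    (fun t ht hp => let ⟨u, hu⟩ := h.exists_isSteady ht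
      hstep u t hu (hp u ⟨hu.nonneg, hu.lt⟩)) ht

theorem eq_update (h : IsRun P lam J S σ) (hs : IsSteady J σ u t) :
    σ t = (σ u).update P lam J (S.queue J t) (S.workload J t) t := by
  obtain ⟨s, hleft, hst⟩ := h.step t (hs.nonneg.trans_lt hs.lt)
  obtain ⟨v, hv, hmem⟩ := (hleft.and (Ioo_mem_nhdsLT hs.lt)).exists
  rw [hst, ← hv, hs.const v ⟨hmem.1.le, hmem.2⟩]

end IsRun

end Induction

section Execution

variable {ι : Type*} {k : ℕ}

namespace Schedule

/-- The times at which processor `m` is occupied by job `j`. -/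
def slot (S : Schedule ι k) (m : Fin k) (j : ι) : Set ℝ := {v | S.job m v = some j}

/-- The remaining execution times at time `t`, as a function on the index type. -/
abbrev remainingAt (S : Schedule ι k) (J : ι → Job) (t : ℝ) : ι → ℝ := fun j => S.remaining J j t

variable (S : Schedule ι k) (m : Fin k)

theorem measurableSet_slot (j : ι) : MeasurableSet (S.slot m j) := S.job_measurable m (some j)

/-- The times at which processor `m` is on. -/
def onSet (S : Schedule ι k) (m : Fin k) : Set ℝ := ⋃ I ∈ S.on m, Ico I.1 I.2

theorem mem_onSet {v : ℝ} : v ∈ S.onSet m ↔ ∃ I ∈ S.on m, v ∈ Ico I.1 I.2 := by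
  simp only [onSet, mem_iUnion, exists_prop]

theorem measurableSet_onSet : MeasurableSet (S.onSet m) :=
  Finset.measurableSet_biUnion _ fun _ _ => measurableSet_Ico

theorem sum_volume_on_inter {E : Set ℝ} (hE : MeasurableSet E) :
    ∑ I ∈ S.on m, volume.real (Ico I.1 I.2 ∩ E) = volume.real (S.onSet m ∩ E) := by
  rw [onSet, iUnion₂_inter, measureReal_biUnion_finset
    (h := fun I _ => (measure_inter_lt_top_of_left_ne_top measure_Ico_lt_top.ne).ne)]
  · intro I hI I' hI' hne
    refine Set.disjoint_left.2 fun v hv hv' => ?_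
    rcases S.on_separated m I hI I' hI' hne with h | h
    · exact (hv.1.2.trans (h.trans_le hv'.1.1)).false
    · exact (hv'.1.2.trans (h.trans_le hv.1.1)).false
  · exact fun I _ => measurableSet_Ico.inter hE

theorem executed_eq_volume (j : ι) {A : Set ℝ} (hA : MeasurableSet A) :
    S.executed m j A = volume.real (S.onSet m ∩ (A ∩ S.slot m j)) := by
  rw [← S.sum_volume_on_inter m (hA.inter (S.measurableSet_slot m j))]
  refine Finset.sum_congr rfl fun I _ => ?_
  rw [setIntegral_indicator (S.job_measurable m (some j)), setIntegral_const, smul_eq_mul,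
    mul_one, inter_assoc]
  rfl

theorem executed_zero (j : ι) : S.executed m j (Icc 0 0) = 0 := by
  rw [S.executed_eq_volume m j measurableSet_Icc, measureReal_def, Icc_self,
    measure_mono_null (t := {0}) (fun v hv => hv.2.1) (by simp), ENNReal.toReal_zero]

theorem remainingAt_zero (J : ι → Job) : S.remainingAt J 0 = execTimes J :=
  funext fun j => (congrArg _ (Finset.sum_eq_zero fun m _ => S.executed_zero m j)).trans
    (sub_zero _)

omit m in
theorem workload_eq [Fintype ι] {J : ι → Job} {t : ℝ} (h : ∀ j, 0 ≤ S.remaining J j t) :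
    S.workload J t = workDue J (S.remainingAt J t) (Iic t) := by
  classical
  funext x
  rw [← workDue_openJobs h, workload, Finset.sum_filter]
  exact Finset.sum_congr rfl fun j _ => by rw [indicator_apply]; congr

theorem volume_inter_biUnion_slot [Fintype ι] (A : Set ι) {E : Set ℝ} (hE : MeasurableSet E)
    (hfin : volume E ≠ ⊤) : volume.real (E ∩ ⋃ j ∈ A, S.slot m j) =
      work (fun j => volume.real (E ∩ S.slot m j)) A := by
  classical
  have hfilter : ⋃ j ∈ A, S.slot m j = ⋃ j ∈ Finset.univ.filter (· ∈ A), S.slot m j := by simp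
  rw [hfilter, inter_iUnion₂, measureReal_biUnion_finset
    (h := fun j _ => (measure_inter_lt_top_of_left_ne_top hfin).ne), Finset.sum_filter]
  · rfl
  · exact fun i _ j _ hne => Set.disjoint_left.2 fun v hv hv' =>
      hne (Option.some.inj (hv.2.symm.trans hv'.2))
  · exact fun j _ => hE.inter (S.measurableSet_slot m j)

end Schedule

theorem volume_Icc_inter_sub {E : Set ℝ} (hE : MeasurableSet E) {a u t : ℝ} (hu : a ≤ u)
    (hut : u ≤ t) : volume.real (Icc a t ∩ E) - volume.real (Icc a u ∩ E) =
      volume.real (Ioo u t ∩ E) := by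
  have hopen : volume.real (Ioo u t ∩ E) = volume.real (Ioc u t ∩ E) :=
    measureReal_congr (ae_eq_set_inter Ioo_ae_eq_Ioc (ae_eq_refl _))
  have hdisj : Disjoint (Icc a u ∩ E) (Ioc u t ∩ E) :=
    Set.disjoint_left.2 fun v hv hv' => hv.1.2.not_gt hv'.1.1
  rw [hopen, ← Icc_union_Ioc_eq_Icc hu hut, union_inter_distrib_right,
    measureReal_union hdisj (measurableSet_Ioc.inter hE)
      (measure_inter_lt_top_of_left_ne_top measure_Icc_lt_top.ne).ne
      (measure_inter_lt_top_of_left_ne_top measure_Ioc_lt_top.ne).ne, add_sub_cancel_left]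

namespace SysState

/-- At most one processor is on while the urgency flag is false, and `M₁` is on while it is true.
This makes every job the responsibility of at most one processor that is on. -/
structure Coherent (s : SysState) : Prop where
  of_calm : s.urgent = false → s.on 0 = false ∨ s.on 1 = false
  of_urgent : s.urgent = true → s.on 0 = true

variable {s : SysState}

theorem Coherent.eq_of_mem_window (h : s.Coherent) {m m' : Fin 2} {a : ℝ} (hm : s.on m = true)
    (hm' : s.on m' = true) (ha : a ∈ s.window m) (ha' : a ∈ s.window m') : m = m' := by
  cases hu : s.urgent
  · have hcalm := h.of_calm hu
    fin_cases m <;> fin_cases m' <;> simp_all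
  · have hlt := ha hu
    have hlt' := ha' hu
    fin_cases m <;> fin_cases m' <;> simp at hlt hlt' ⊢ <;> linarith

theorem Coherent.calm_of_isOff (h : s.Coherent) (hoff : s.IsOff) : s.urgent = false := by
  by_contra hu
  simpa [hoff 0] using h.of_urgent (by simpa using hu)

end SysState

variable [Fintype ι] {P : PowerModel} {J : ι → Job} {S : Schedule ι 2} {σ : ℝ → SysState}
  {lam u v t : ℝ} {m : Fin 2} {j : ι}

namespace IsRun

theorem mem_eligible (h : IsRun P lam J S σ) (hv : 0 ≤ v) (hj : v ∈ S.slot m j) :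
    j ∈ (σ v).eligible J (S.queue J v) m := by
  have hedf := h.edf v hv m
  rw [show S.job m v = some j from hj] at hedf
  exact hedf.1

theorem mem_onSet_iff (h : IsRun P lam J S σ) (hv : 0 ≤ v) : v ∈ S.onSet m ↔ (σ v).on m = true :=
  (S.mem_onSet m).trans (h.on_iff v hv m).symm

theorem executed_eq_volume_slot (h : IsRun P lam J S σ) {A : Set ℝ} (hA : A ⊆ Ici 0)
    (hmeas : MeasurableSet A) : S.executed m j A = volume.real (A ∩ S.slot m j) := by
  rw [S.executed_eq_volume m j hmeas, inter_eq_right.2]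
  exact fun v hv => (h.mem_onSet_iff (hA hv.1)).2 (h.mem_eligible (hA hv.1) hv.2).2.1

theorem executed_sub (h : IsRun P lam J S σ) (m : Fin 2) (j : ι) (hu : 0 ≤ u) (hut : u ≤ t) :
    S.executed m j (Icc 0 t) - S.executed m j (Icc 0 u) = volume.real (Ioo u t ∩ S.slot m j) := by
  rw [h.executed_eq_volume_slot Icc_subset_Ici_self measurableSet_Icc,
    h.executed_eq_volume_slot Icc_subset_Ici_self measurableSet_Icc,
    volume_Icc_inter_sub (S.measurableSet_slot m j) hu hut]

theorem remaining_sub (h : IsRun P lam J S σ) (j : ι) (hu : 0 ≤ u) (hut : u ≤ t) :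
    S.remaining J j u - S.remaining J j t = ∑ m, volume.real (Ioo u t ∩ S.slot m j) := by
  simp only [← fun m => h.executed_sub m j hu hut, Finset.sum_sub_distrib, Schedule.remaining]
  ring

theorem remaining_anti (h : IsRun P lam J S σ) (j : ι) (hu : 0 ≤ u) (hut : u ≤ t) :
    S.remaining J j t ≤ S.remaining J j u :=
  sub_nonneg.1 <| (Finset.sum_nonneg fun _ _ => measureReal_nonneg).trans_eq
    (h.remaining_sub j hu hut).symm

theorem continuousOn_remaining (h : IsRun P lam J S σ) (j : ι) :
    ContinuousOn (S.remaining J j) (Ici 0) := by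
  refine (LipschitzOnWith.of_le_add_mul 2 fun u hu v hv => ?_).continuousOn
  obtain huv | hvu := le_total u v
  · have hle (m : Fin 2) : volume.real (Ioo u v ∩ S.slot m j) ≤ v - u :=
      (measureReal_mono inter_subset_left measure_Ioo_lt_top.ne).trans_eq
        (Real.volume_real_Ioo_of_le huv)
    have hsub := h.remaining_sub j hu huv
    rw [Fin.sum_univ_two] at hsub
    rw [dist_comm, Real.dist_eq, abs_of_nonneg (sub_nonneg.2 huv)]
    push_cast
    linarith [hle 0, hle 1]
  · exact (h.remaining_anti j hv hvu).trans (le_add_of_nonneg_right (by positivity))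

theorem remaining_nonneg (h : IsRun P lam J S σ) (j : ι) (ht : 0 ≤ t) :
    0 ≤ S.remaining J j t := by
  by_contra! hneg
  obtain ⟨w, hw, hw0 : S.remaining J j w = 0⟩ := intermediate_value_Icc' ht
    ((h.continuousOn_remaining j).mono Icc_subset_Ici_self)
    ⟨hneg.le, ((J j).exec_pos.trans_eq (congrFun (S.remainingAt_zero J) j).symm).le⟩
  have hidle (m : Fin 2) : Ioo w t ∩ S.slot m j = ∅ := by
    refine eq_empty_of_forall_notMem fun v hv => ?_
    have hpos : 0 < S.remaining J j v :=
      (h.mem_eligible (hw.1.trans hv.1.1.le) hv.2).1.2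
    exact (hpos.trans_le ((h.remaining_anti j hw.1 hv.1.1.le).trans_eq hw0)).false
  have hsub := h.remaining_sub j hw.1 hw.2
  simp only [hidle, measureReal_empty, Finset.sum_const_zero] at hsub
  linarith

theorem workload_eq (h : IsRun P lam J S σ) (ht : 0 ≤ t) :
    S.workload J t = workDue J (S.remainingAt J t) (Iic t) :=
  S.workload_eq fun j => h.remaining_nonneg j ht

theorem eq_updateAt (h : IsRun P 1 J S σ) (hs : IsSteady J σ u t) :
    σ t = (σ u).updateAt P J (S.remainingAt J t) t := by
  rw [h.eq_update hs, h.workload_eq (hs.nonneg.trans hs.lt.le)]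
  rfl

theorem init_eq_updateAt (h : IsRun P 1 J S σ) :
    σ 0 = SysState.initial.updateAt P J (execTimes J) 0 := by
  rw [h.init, h.workload_eq le_rfl, ← S.remainingAt_zero J]
  rfl

theorem volume_slot_eq_zero (h : IsRun P lam J S σ) (hs : IsSteady J σ u t)
    (hj : (σ u).on m = true → (J j).arrival ∈ (σ u).window m → t ≤ (J j).arrival) :
    volume.real (Ioo u t ∩ S.slot m j) = 0 := by
  suffices Ioo u t ∩ S.slot m j = ∅ by rw [this, measureReal_empty]
  refine eq_empty_of_forall_notMem fun v ⟨hv, hvj⟩ => ?_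
  have hel := h.mem_eligible (hs.nonneg.trans hv.1.le) hvj
  rw [hs.const v ⟨hv.1.le, hv.2⟩] at hel
  exact (hj hel.2.1 hel.2.2).not_gt (hel.1.1.trans_lt hv.2)

theorem remaining_eq (h : IsRun P lam J S σ) (hs : IsSteady J σ u t)
    (hj : ∀ m, (σ u).on m = true → (J j).arrival ∈ (σ u).window m → t ≤ (J j).arrival) :
    S.remaining J j t = S.remaining J j u := by
  have hsub := h.remaining_sub j hs.nonneg hs.lt.le
  rw [Finset.sum_eq_zero fun m _ => h.volume_slot_eq_zero hs (hj m)] at hsub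
  linarith

theorem remainingAt_eq_of_isOff (h : IsRun P lam J S σ) (hs : IsSteady J σ u t)
    (hoff : (σ u).IsOff) : S.remainingAt J t = S.remainingAt J u :=
  funext fun _ => h.remaining_eq hs fun m hm => by simp [hoff m] at hm

theorem work_sub_eq_volume (h : IsRun P lam J S σ) (hs : IsSteady J σ u t) (hc : (σ u).Coherent)
    (hm : (σ u).on m = true) {A : Set ι} (hA : ∀ j ∈ A, (J j).arrival ∈ (σ u).window m) :
    work (S.remainingAt J u) A - work (S.remainingAt J t) A =
      volume.real (Ioo u t ∩ ⋃ j ∈ A, S.slot m j) := by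
  rw [← work_sub, S.volume_inter_biUnion_slot m A measurableSet_Ioo measure_Ioo_lt_top.ne]
  refine work_congr fun j hj => (h.remaining_sub j hs.nonneg hs.lt.le).trans ?_
  refine Finset.sum_eq_single m (fun m' _ hne => ?_) (by simp)
  exact h.volume_slot_eq_zero hs fun hm' hw =>
    (hne (hc.eq_of_mem_window hm' hm hw (hA j hj))).elim

theorem Ioo_subset_slots (h : IsRun P lam J S σ) (hs : IsSteady J σ u t) (hm : (σ u).on m = true)
    {x : ℝ} (hj : j ∈ arriving J (Iic u ∩ (σ u).window m) ∩ dueBy J x)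
    (hpos : 0 < S.remaining J j t) :
    Ioo u t ⊆ ⋃ i ∈ arriving J (Iic u ∩ (σ u).window m) ∩ dueBy J x, S.slot m i := by
  intro v hv
  have hv0 : 0 ≤ v := hs.nonneg.trans hv.1.le
  have hconst := hs.const v ⟨hv.1.le, hv.2⟩
  have hel : j ∈ (σ v).eligible J (S.queue J v) m := by
    rw [hconst]
    exact ⟨⟨hj.1.1.trans hv.1.le, hpos.trans_le (h.remaining_anti j hv0 hv.2.le)⟩, hm, hj.1.2⟩
  have hedf := h.edf v hv0 m
  cases hjob : S.job m v with
  | none =>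
    rw [hjob] at hedf
    exact absurd hel (eq_empty_iff_forall_notMem.1 hedf j)
  | some i =>
    have hi := h.mem_eligible hv0 hjob
    rw [hconst] at hi
    rw [hjob] at hedf
    exact mem_biUnion (x := i) ⟨⟨hs.arrival_le (hi.1.1.trans_lt hv.2), hi.2.2⟩,
      (hedf.2 j hel).trans hj.2⟩ hjob

theorem drain (h : IsRun P lam J S σ) (hs : IsSteady J σ u t) (hc : (σ u).Coherent)
    (hm : (σ u).on m = true) (x : ℝ) :
    workDue J (S.remainingAt J t) (Iic u ∩ (σ u).window m) x =
      max 0 (workDue J (S.remainingAt J u) (Iic u ∩ (σ u).window m) x - (t - u)) := by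
  have hsub := h.work_sub_eq_volume hs hc hm
    (A := arriving J (Iic u ∩ (σ u).window m) ∩ dueBy J x) fun j hj => hj.1.2
  have hnonneg : ∀ j, 0 ≤ S.remainingAt J t j :=
    fun j => h.remaining_nonneg j (hs.nonneg.trans hs.lt.le)
  simp only [workDue]
  obtain hzero | hpos := (work_nonneg fun j _ => hnonneg j).eq_or_lt
    (b := work (S.remainingAt J t) (arriving J (Iic u ∩ (σ u).window m) ∩ dueBy J x))
  · rw [← hzero, max_eq_left]
    rw [← hzero, sub_zero] at hsub
    exact sub_nonpos.2 <| hsub.trans_le <|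
      (measureReal_mono inter_subset_left measure_Ioo_lt_top.ne).trans_eq
        (Real.volume_real_Ioo_of_le hs.lt.le)
  · obtain ⟨j, hj, hjpos⟩ := exists_pos_of_work_pos hpos
    rw [inter_eq_left.2 (h.Ioo_subset_slots hs hm hj hjpos), Real.volume_real_Ioo_of_le hs.lt.le]
      at hsub
    rw [max_eq_right] <;> linarith

theorem remaining_eq_zero_of_drained (h : IsRun P lam J S σ) (hs : IsSteady J σ u t)
    (hc : (σ u).Coherent) (hm : (σ u).on m = true)
    (hlt : work (S.remainingAt J u) (arriving J (Iic u ∩ (σ u).window m)) ≤ t - u)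
    (hj : (J j).arrival ∈ Iic u ∩ (σ u).window m) : S.remaining J j t = 0 := by
  obtain ⟨x, hx⟩ := exists_workDue_eq J (Iic u ∩ (σ u).window m)
  have hdrain := h.drain hs hc hm x
  rw [hx, hx, max_eq_left (sub_nonpos.2 hlt)] at hdrain
  exact eq_zero_of_work_nonpos (f := S.remainingAt J t)
    (fun j => h.remaining_nonneg j (hs.nonneg.trans hs.lt.le))
    hdrain.le hj

end IsRun

end Execution

section Steadiness

namespace SysState

variable {ι : Type*} {P : PowerModel} {J : ι → Job} {Q : Set ι} {W : ℝ → ℝ} {lam t : ℝ}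
  {s : SysState} {m : Fin 2}

theorem update_ne_of_trigger (hoff : s.IsOff) (hcalm : s.urgent = false) (hQ : Q.Nonempty)
    (htrig : (∃ j ∈ Q, anchor P lam (J j) ≤ t) ∨ ∃ x, t < x ∧ x - t ≤ W x) :
    s.update P lam J Q W t ≠ s := by
  intro heq
  rw [update, shutDown_of_awake (.inl hQ), wakeUp, if_pos ⟨hoff, htrig⟩] at heq
  by_cases hW : ∃ x, t < x ∧ x - t < W x
  · obtain ⟨x, hx, hWx⟩ := hW
    rw [raiseUrgency_of_on (s := s.turnOnM1 t) (by simp [turnOnM1]) hcalm hx hWx] at heq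
    have hon := congrFun (congrArg SysState.on heq) 1
    unfold clearUrgency at hon
    split_ifs at hon <;> simp [raised, turnOnM1, hoff 1] at hon
  · push Not at hW
    rw [raiseUrgency_of_fits hW, clearUrgency_of_calm (s := s.turnOnM1 t) hcalm] at heq
    simpa [turnOnM1, hoff 0] using congrFun (congrArg SysState.on heq) 0

theorem update_ne_of_idle (hm : s.on m = true) (hcalm : s.urgent = false) (hQ : Q = ∅)
    (hW : ∀ x, t < x → W x ≤ x - t) (ht : s.t1 + P.breakEven ≤ t) :
    s.update P lam J Q W t ≠ s := by
  rw [update, wakeUp_of_on hm, raiseUrgency_of_fits hW, clearUrgency_of_calm hcalm,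
    shutDown_of_idle hm hcalm hQ ht]
  intro heq
  simpa [halted, hm] using congrFun (congrArg SysState.on heq) m

theorem update_ne_of_clear (hm : s.on m = true) (hflag : s.urgent = true)
    (hQ : ∀ j ∈ Q, s.tStar ≤ (J j).arrival) : s.update P lam J Q W t ≠ s := by
  intro heq
  rw [update, wakeUp_of_on hm, raiseUrgency_of_urgent hflag, clearUrgency,
    if_pos ⟨hflag, hQ⟩] at heq
  have hurgent := congrArg SysState.urgent heq
  unfold shutDown at hurgent
  split_ifs at hurgent <;> simp [hflag] at hurgent

end SysState

namespace IsRun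

variable {ι : Type*} [Fintype ι] {P : PowerModel} {J : ι → Job} {S : Schedule ι 2}
  {σ : ℝ → SysState} {u v t x : ℝ} {j : ι}

theorem updateAt_eq_self (h : IsRun P 1 J S σ) (hs : IsSteady J σ u t) (hv : v ∈ Ioo u t) :
    (σ u).updateAt P J (S.remainingAt J v) v = σ u :=
  (h.eq_updateAt (hs.mono hv.1 hv.2.le)).symm.trans (hs.const v ⟨hv.1.le, hv.2⟩)

theorem no_trigger_of_isOff (h : IsRun P 1 J S σ) (hs : IsSteady J σ u t) (hc : (σ u).Coherent)
    (hoff : (σ u).IsOff) (hv : v ∈ Ioo u t) :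
    (∀ j ∈ openJobs J (S.remainingAt J u) u, v < anchor P 1 (J j)) ∧
      ∀ x, v < x → workDue J (S.remainingAt J u) (Iic u) x < x - v := by
  have hfrozen := h.remainingAt_eq_of_isOff (hs.mono hv.1 hv.2.le) hoff
  have harrived : arriving J (Iic v) = arriving J (Iic u) := Subset.antisymm
    (fun j hj => hs.arrival_le (lt_of_le_of_lt hj hv.2)) fun j hj => le_trans hj hv.1.le
  have hfix := h.updateAt_eq_self hs hv
  rw [hfrozen] at hfix
  refine ⟨fun j hj => ?_, fun x hx => ?_⟩ <;> by_contra! hle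
  · have hmem : j ∈ openJobs J (S.remainingAt J u) v := ⟨hj.1.trans hv.1.le, hj.2⟩
    exact SysState.update_ne_of_trigger hoff (hc.calm_of_isOff hoff) ⟨j, hmem⟩
      (.inl ⟨j, hmem, hle⟩) hfix
  · rw [workDue, ← harrived] at hle
    obtain ⟨j, hj, hpos⟩ := exists_pos_of_work_pos ((sub_pos.2 hx).trans_le hle)
    have hmem : j ∈ openJobs J (S.remainingAt J u) v := ⟨hj.1, hpos⟩
    exact SysState.update_ne_of_trigger hoff (hc.calm_of_isOff hoff) ⟨j, hmem⟩
      (.inr ⟨x, hx, hle⟩) hfix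

theorem le_anchor_of_isOff (h : IsRun P 1 J S σ) (hs : IsSteady J σ u t) (hc : (σ u).Coherent)
    (hoff : (σ u).IsOff) (hj : j ∈ openJobs J (S.remainingAt J u) u) : t ≤ anchor P 1 (J j) := by
  by_contra! hlt
  obtain ⟨v, hv, hvt⟩ := exists_between (max_lt hs.lt hlt)
  rw [max_lt_iff] at hv
  exact ((h.no_trigger_of_isOff hs hc hoff ⟨hv.1, hvt⟩).1 j hj).not_gt hv.2

theorem workDue_le_of_isOff (h : IsRun P 1 J S σ) (hs : IsSteady J σ u t) (hc : (σ u).Coherent)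
    (hoff : (σ u).IsOff) (hx : t ≤ x) : workDue J (S.remainingAt J u) (Iic u) x ≤ x - t := by
  by_contra! hlt
  obtain ⟨v, hv, hvt⟩ := exists_between (max_lt hs.lt (sub_lt_comm.1 hlt))
  rw [max_lt_iff] at hv
  have hloose := (h.no_trigger_of_isOff hs hc hoff ⟨hv.1, hvt⟩).2 x (hvt.trans_le hx)
  linarith

theorem le_shutDown_of_calm (h : IsRun P 1 J S σ) (hs : IsSteady J σ u t) (hc : (σ u).Coherent)
    (hcalm : (σ u).urgent = false) (hon : ¬ (σ u).IsOff)
    (hwork : work (S.remainingAt J u) (arriving J (Iic u)) < t - u) :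
    t ≤ (σ u).t1 + P.breakEven := by
  by_contra! hlt
  obtain ⟨m, hm⟩ : ∃ m, (σ u).on m = true := by
    simpa only [SysState.IsOff, not_forall, Bool.not_eq_false] using hon
  obtain ⟨v, hv, hvt⟩ := exists_between
    (max_lt (max_lt hs.lt hlt) (lt_tsub_iff_left.1 hwork))
  simp only [max_lt_iff] at hv
  have hzero {j : ι} (hj : (J j).arrival ≤ v) : S.remaining J j v = 0 := by
    refine h.remaining_eq_zero_of_drained (hs.mono hv.1.1 hvt.le) hc hm ?_ ?_ <;>
      rw [SysState.window_of_calm hcalm, inter_univ]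
    · exact (lt_tsub_iff_left.2 hv.2).le
    · exact hs.arrival_le (hj.trans_lt hvt)
  refine SysState.update_ne_of_idle hm hcalm
    (eq_empty_of_forall_notMem fun j hj => hj.2.ne' (hzero hj.1)) (fun x hx => ?_) hv.1.2.le
    (h.updateAt_eq_self hs ⟨hv.1.1, hvt⟩)
  rw [workDue, work_eq_zero fun j hj => hzero hj.1]
  exact (sub_pos.2 hx).le

theorem sub_le_work_of_urgent (h : IsRun P 1 J S σ) (hs : IsSteady J σ u t) (hc : (σ u).Coherent)
    (hflag : (σ u).urgent = true) :
    t - u ≤ work (S.remainingAt J u) (arriving J (Iic u ∩ (σ u).window 0)) := by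
  by_contra! hlt
  obtain ⟨v, hv, hvt⟩ := exists_between (max_lt hs.lt (lt_tsub_iff_left.1 hlt))
  rw [max_lt_iff] at hv
  refine SysState.update_ne_of_clear (hc.of_urgent hflag) hflag (fun j hj => ?_)
    (h.updateAt_eq_self hs ⟨hv.1, hvt⟩)
  by_contra! hold
  refine hj.2.ne' (h.remaining_eq_zero_of_drained (hs.mono hv.1 hvt.le) hc (hc.of_urgent hflag)
    (lt_tsub_iff_left.2 hv.2).le ⟨hs.arrival_le (hj.1.trans_lt hvt), ?_⟩)
  rwa [SysState.window_zero_of_urgent hflag]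

theorem segment (h : IsRun P 1 J S σ) (hs : IsSteady J σ u t) (hc : (σ u).Coherent) :
    Segment P J (σ u) u (S.remainingAt J u) t (S.remainingAt J t) where
  lt := hs.lt
  quiet := hs.quiet
  nonneg j := h.remaining_nonneg j (hs.nonneg.trans hs.lt.le)
  anti j := h.remaining_anti j hs.nonneg hs.lt.le
  unarrived _ hj := h.remaining_eq hs fun _ _ _ => hj
  frozen := h.remainingAt_eq_of_isOff hs
  drain _ := h.drain hs hc
  stay_off hoff := ⟨fun _ => h.le_anchor_of_isOff hs hc hoff,
    fun _ => h.workDue_le_of_isOff hs hc hoff⟩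
  stay_on := h.le_shutDown_of_calm hs hc
  stay_urgent := h.sub_le_work_of_urgent hs hc

end IsRun

end Steadiness

section Phase

variable {ι : Type*} [Fintype ι] {P : PowerModel} {J : ι → Job} {s s' : SysState} {t u e e' : ℝ}
  {r r' : ι → ℝ}

/-- The invariant of the algorithm after the rules have been applied at time `t`. -/
def Phase (P : PowerModel) (J : ι → Job) (t e : ℝ) (r : ι → ℝ) (s : SysState) : Prop :=
  OffPhase P J t e r s ∨ SinglePhase P J t e r s ∨ UrgentPhase P J t e r s ∨ TailPhase P J t e r s

/-- The invariant of the algorithm before the rules are applied at time `t`. -/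
def PrePhase (P : PowerModel) (J : ι → Job) (t e : ℝ) (r : ι → ℝ) (s : SysState) : Prop :=
  PreOffPhase P J t e r s ∨ PreSinglePhase P J t e r s ∨ PreUrgentPhase P J t e r s ∨
    PreTailPhase P J t e r s

/-- The possible effects of the rules at time `t`: they turn state `s` into `s'`, and the time at
which the system was last turned off from `e` into `e'`. -/
inductive Transition (P : PowerModel) (J : ι → Job) (t : ℝ) (r : ι → ℝ) (e : ℝ) (s : SysState) :
    ℝ → SysState → Prop
  | stay (h : Phase P J t e r s) : Transition P J t r e s e s
  | wake (hp : PreOffPhase P J t e r s) (h : SinglePhase P J t e r (s.turnOnM1 t)) :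
      Transition P J t r e s e (s.turnOnM1 t)
  | wakeRaise (hp : PreOffPhase P J t e r s)
      (h : UrgentPhase P J t e r ((s.turnOnM1 t).raised t)) :
      Transition P J t r e s e ((s.turnOnM1 t).raised t)
  | raise (hp : PreSinglePhase P J t e r s) (h : UrgentPhase P J t e r (s.raised t)) :
      Transition P J t r e s e (s.raised t)
  | clear (hp : PreUrgentPhase P J t e r s) (h : TailPhase P J t e r s.cleared) :
      Transition P J t r e s e s.cleared
  | halt {s' : SysState} (hs : ¬ s.IsOff) (he : e < s.t1) (htrig : Trigger P J e s.t1)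
      (ht : s.t1 + P.breakEven ≤ t) (hp : PrePhase P J t e r s) (h : OffPhase P J t t r s') :
      Transition P J t r e s t s'

namespace Phase

theorem remainingInvariant (h : Phase P J t e r s) : RemainingInvariant J t e r := by
  rcases h with h | h | h | h <;> exact h.base

theorem coherent (h : Phase P J t e r s) : s.Coherent := by
  rcases h with h | h | h | h
  · exact ⟨fun _ => .inl (h.off 0), fun hu => by simp [h.calm] at hu⟩
  · exact ⟨fun _ => .inr h.on1, fun hu => by simp [h.calm] at hu⟩
  · exact ⟨fun hc => by simp [h.flag] at hc, fun _ => h.on0⟩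
  · exact ⟨fun _ => .inl h.on0, fun hu => by simp [h.calm] at hu⟩

theorem segment (hp : Phase P J u e r s) (hJ : EDFCondition J) (h : Segment P J s u r t r') :
    PrePhase P J t e r' s :=
  hp.imp (·.segment hJ h) <| Or.imp (·.segment hJ h) <| Or.imp (·.segment hJ h) (·.segment hJ h)

theorem off_or_on (h : Phase P J t e r s) :
    s.IsOff ∨ ¬ s.IsOff ∧ e < s.t1 ∧ s.t1 ≤ t ∧ Trigger P J e s.t1 := by
  rcases h with h | h | h | h
  · exact .inl h.off
  · exact .inr ⟨s.not_isOff_of_on h.on0, h.e_lt, h.t1_le, h.trig⟩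
  · exact .inr ⟨s.not_isOff_of_on h.on0, h.e_lt, h.t1_le.trans h.tStar_le, h.trig⟩
  · exact .inr ⟨s.not_isOff_of_on h.on1, h.e_lt, h.t1_le.trans h.tStar_le, h.trig⟩

end Phase

theorem PrePhase.remainingInvariant (h : PrePhase P J t e r s) : RemainingInvariant J t e r := by
  rcases h with h | h | h | h <;> exact h.base

theorem PrePhase.exists_transition (h : PrePhase P J t e r s) (hJ : EDFCondition J)
    (hs' : s' = s.updateAt P J r t) : ∃ e', Transition P J t r e s e' s' := by
  have hpre := h
  rcases h with h | h | h | h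
  · obtain ⟨rfl, hoff⟩ | ⟨rfl, hsingle⟩ | ⟨rfl, hurgent⟩ := h.updateAt_cases hJ hs'
    · exact ⟨e, .stay (.inl hoff)⟩
    · exact ⟨e, .wake h hsingle⟩
    · exact ⟨e, .wakeRaise h hurgent⟩
  · obtain ⟨rfl, hsingle⟩ | ⟨rfl, hurgent⟩ | ⟨rfl, -, ht, hoff⟩ := h.updateAt_cases hJ hs'
    · exact ⟨e, .stay (.inr (.inl hsingle))⟩
    · exact ⟨e, .raise h hurgent⟩
    · exact ⟨t, .halt (s.not_isOff_of_on h.on0) h.e_lt h.trig ht hpre hoff⟩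
  · obtain ⟨rfl, hurgent⟩ | ⟨rfl, htail⟩ | ⟨rfl, -, ht, hoff⟩ := h.updateAt_cases hs'
    · exact ⟨e, .stay (.inr (.inr (.inl hurgent)))⟩
    · exact ⟨e, .clear h htail⟩
    · exact ⟨t, .halt (s.not_isOff_of_on h.on0) h.e_lt h.trig ht hpre hoff⟩
  · obtain ⟨rfl, htail⟩ | ⟨rfl, -, ht, hoff⟩ := h.updateAt_cases hJ hs'
    · exact ⟨e, .stay (.inr (.inr (.inr htail)))⟩
    · exact ⟨t, .halt (s.not_isOff_of_on h.on1) h.e_lt h.trig ht hpre hoff⟩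

namespace Transition

theorem phase (h : Transition P J t r e s e' s') : Phase P J t e' r s' := by
  cases h with
  | stay h => exact h
  | wake _ h => exact .inr (.inl h)
  | wakeRaise _ h => exact .inr (.inr (.inl h))
  | raise _ h => exact .inr (.inr (.inl h))
  | clear _ h => exact .inr (.inr (.inr h))
  | halt _ _ _ _ _ h => exact .inl h

end Transition

end Phase

section Ledger

variable {ι : Type*} [Fintype ι] {P : PowerModel} {J : ι → Job} {s s' : SysState} {t u e e' : ℝ}
  {r r' : ι → ℝ} {n n' : Fin 2 → ℕ} {o o' : ℝ}

/-- The number of turn-ons of processor `m` when the state changes from `s` to `s'`. -/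
def SysState.turnOn (s s' : SysState) (m : Fin 2) : ℕ :=
  if s.on m = false ∧ s'.on m = true then 1 else 0

/-- A bound for the turn-ons and the standby time, measured in time, beyond two break-even times for
each turn-on of `M₁`.  At any time it is at most the work that has arrived. -/
def ledger (P : PowerModel) (J : ι → Job) (t e : ℝ) (r : ι → ℝ) (s : SysState) : ℝ :=
  work (execTimes J) (arriving J (Iic e)) +
    if s.on 1 = true then
      (t - s.tStar) - work (execTimes J - r) (arriving J (Ici s.tStar))
    else if s.on 0 = true then
      (t - s.t1) - work (execTimes J - r) (arriving J (Ioi e)) - P.breakEven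
    else 0

/-- Measured in time, the turn-ons and the standby time are bounded by two break-even times for each
turn-on of `M₁` and the ledger.  Here `n m` is the number of turn-ons of processor `m`, and `o` is
the total time for which the processors have been on. -/
def CostBound (P : PowerModel) (J : ι → Job) (t e : ℝ) (r : ι → ℝ) (s : SysState)
    (n : Fin 2 → ℕ) (o : ℝ) : Prop :=
  P.breakEven * (n 0 + n 1) + o - work (execTimes J - r) univ ≤
    2 * P.breakEven * n 0 + ledger P J t e r s

theorem SysState.turnOn_eq_one {m : Fin 2} (h : s.on m = false) (h' : s'.on m = true) :
    s.turnOn s' m = 1 := if_pos ⟨h, h'⟩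

theorem SysState.turnOn_eq_zero {m : Fin 2} (h : s'.on m = true → s.on m = true) :
    s.turnOn s' m = 0 := if_neg fun ⟨hoff, hon⟩ => by simp [h hon] at hoff

theorem ledger_of_isOff (h : s.IsOff) :
    ledger P J t e r s = work (execTimes J) (arriving J (Iic e)) := by
  simp [ledger, h 0, h 1]

theorem ledger_of_single (h0 : s.on 0 = true) (h1 : s.on 1 = false) :
    ledger P J t e r s = work (execTimes J) (arriving J (Iic e)) +
      ((t - s.t1) - work (execTimes J - r) (arriving J (Ioi e)) - P.breakEven) := by
  simp [ledger, h0, h1]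

theorem ledger_of_on1 (h1 : s.on 1 = true) :
    ledger P J t e r s = work (execTimes J) (arriving J (Iic e)) +
      ((t - s.tStar) - work (execTimes J - r) (arriving J (Ici s.tStar))) := by
  simp [ledger, h1]

theorem work_arriving_Iic_mono {a b : ℝ} (h : a ≤ b) :
    work (execTimes J) (arriving J (Iic a)) ≤ work (execTimes J) (arriving J (Iic b)) :=
  work_mono_set (execTimes_nonneg J) fun _ hj => le_trans hj h

theorem RaisedPhase.ledger_le (h : RaisedPhase P J t e r s)
    (hidle : (t - s.tStar) - work (execTimes J - r) (arriving J (Ici s.tStar)) ≤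
      work (execTimes J) (arriving J (Ioc e s.tStar))) :
    ledger P J t e r s ≤ work (execTimes J) (arriving J (Iic t)) := by
  have hmono := work_arriving_Iic_mono (J := J) h.tStar_le
  rw [← Iic_union_Ioc_eq_Iic (h.e_lt.le.trans h.t1_le),
    work_arriving_union J _ (Iic_disjoint_Ioc le_rfl)] at hmono
  rw [ledger_of_on1 h.on1]
  linarith

theorem PreUrgentPhase.idle (h : PreUrgentPhase P J t e r s) :
    (t - s.tStar) - work (execTimes J - r) (arriving J (Ici s.tStar)) ≤
      work (execTimes J) (arriving J (Ioc e s.tStar)) := by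
  have hnonneg : 0 ≤ work (execTimes J - r) (arriving J (Ici s.tStar)) :=
    work_nonneg fun j _ => sub_nonneg.2 (h.base.le_exec j)
  have hold : work (execTimes J - r) (arriving J (Ioo e s.tStar)) ≤
      work (execTimes J) (arriving J (Ioo e s.tStar)) :=
    work_mono fun j => sub_le_self _ (h.base.nonneg j)
  have hmono : work (execTimes J) (arriving J (Ioo e s.tStar)) ≤
      work (execTimes J) (arriving J (Ioc e s.tStar)) :=
    work_mono_set (execTimes_nonneg J) fun _ hj => Ioo_subset_Ioc_self hj
  linarith [h.oldDone, h.t1_le]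

theorem PrePhase.ledger_le (h : PrePhase P J t e r s) :
    ledger P J t e r s ≤ work (execTimes J) (arriving J (Iic t)) := by
  have hmono := work_arriving_Iic_mono (J := J) h.remainingInvariant.e_le
  rcases h with h | h | h | h
  · rwa [ledger_of_isOff h.off]
  · rw [ledger_of_single h.on0 h.on1]
    linarith [h.idle]
  · exact h.ledger_le h.idle
  · exact h.ledger_le h.idle

theorem Phase.ledger_le (h : Phase P J t e r s) :
    ledger P J t e r s ≤ work (execTimes J) (arriving J (Iic t)) := by
  rcases h with h | h | h | h
  · rw [ledger_of_isOff h.off]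
    exact work_arriving_Iic_mono h.base.e_le
  · exact PrePhase.ledger_le (.inr (.inl h.toPreSinglePhase))
  · exact PrePhase.ledger_le (.inr (.inr (.inl h.toPreUrgentPhase)))
  · exact PrePhase.ledger_le (.inr (.inr (.inr h.toPreTailPhase)))

theorem work_univ_eq (f : ι → ℝ) (a : ℝ) :
    work f univ = work f (arriving J (Iio a)) + work f (arriving J (Ici a)) := by
  rw [← work_arriving_union J f (Iio_disjoint_Ici le_rfl), Iio_union_Ici]
  rfl

/-- `M₁` is busy as long as the urgency flag is true, so its idle time counts only before that. -/
theorem Phase.ledger_segment (hp : Phase P J u e r s)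
    (h : Segment P J s u r t r') :
    ledger P J u e r s + (∑ m, if s.on m = true then t - u else 0) =
      ledger P J t e r' s +
        (work (execTimes J - r') univ - work (execTimes J - r) univ) := by
  rw [Fin.sum_univ_two]
  rcases hp with hp | hp | hp | hp
  · obtain rfl := h.frozen hp.off
    simp [ledger_of_isOff hp.off, hp.off 0, hp.off 1]
  · have hpast : ∀ j, ¬(j ∈ univ ↔ j ∈ arriving J (Ioi e)) → r' j = r j := fun j hj => by
      have hje : (J j).arrival ≤ e := by simpa [arriving] using hj
      rw [h.eq_zero (hp.base.past j hje), hp.base.past j hje]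
    have hall := work_progress (execTimes J) hpast
    have hnew := work_progress (r := r) (r' := r') (A := arriving J (Ioi e)) (execTimes J)
      fun _ hj => absurd Iff.rfl hj
    simp only [ledger_of_single hp.on0 hp.on1, hp.on0, hp.on1, if_true, Bool.false_eq_true,
      if_false]
    linarith
  · have hold := work_progress (r := r) (r' := r') (A := arriving J (Iio s.tStar))
      (C := arriving J (Iic u ∩ s.window 0)) (execTimes J) fun j hj => by
        rw [SysState.window_zero_of_urgent hp.flag] at hj
        exact absurd (iff_and_self.2 fun hj => le_trans (le_of_lt hj) hp.tStar_le) hj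
    have hdrain := h.work_arriving_window hp.on0
    rw [max_eq_right (sub_nonneg.2 (h.stay_urgent hp.flag))] at hdrain
    rw [work_univ_eq (J := J) _ s.tStar, work_univ_eq (J := J) _ s.tStar]
    simp only [ledger_of_on1 hp.on1, hp.on0, hp.on1, if_true]
    linarith
  · have hold : ∀ j, ¬(j ∈ univ ↔ j ∈ arriving J (Ici s.tStar)) → r' j = r j := fun j hj => by
      have hj' : (J j).arrival < s.tStar := by simpa [arriving] using hj
      rw [h.eq_zero (hp.oldDone j hj'), hp.oldDone j hj']
    have hall := work_progress (execTimes J) hold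
    have hnew := work_progress (r := r) (r' := r') (A := arriving J (Ici s.tStar)) (execTimes J)
      fun _ hj => absurd Iff.rfl hj
    simp only [ledger_of_on1 hp.on1, hp.on0, hp.on1, if_true, Bool.false_eq_true, if_false]
    linarith

theorem CostBound.segment (hc : CostBound P J u e r s n o) (hp : Phase P J u e r s)
    (h : Segment P J s u r t r')
    (ho : o' = o + ∑ m, if s.on m = true then t - u else 0) :
    CostBound P J t e r' s n o' := by
  have hledger := hp.ledger_segment h
  unfold CostBound at hc ⊢
  linarith

theorem RemainingInvariant.work_done_Ici (h : RemainingInvariant J t e r) :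
    work (execTimes J - r) (arriving J (Ici t)) = 0 :=
  work_eq_zero fun j hj => sub_eq_zero.2 (h.future j hj).symm

theorem Transition.ledger_le (h : Transition P J t r e s e' s') :
    P.breakEven * (s.turnOn s' 0 + s.turnOn s' 1) + ledger P J t e r s ≤
      2 * P.breakEven * s.turnOn s' 0 + ledger P J t e' r s' := by
  cases h with
  | stay h => simp [SysState.turnOn_eq_zero]
  | wake hp h =>
    have hunstarted : work (execTimes J - r) (arriving J (Ioi e)) = 0 :=
      work_eq_zero fun j hj => sub_eq_zero.2 (hp.unstarted j hj).symm
    rw [ledger_of_isOff hp.off, ledger_of_single h.on0 h.on1,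
      SysState.turnOn_eq_one (hp.off 0) h.on0,
      SysState.turnOn_eq_zero fun hon => by simp [h.on1] at hon]
    simp only [SysState.turnOnM1, hunstarted]
    norm_num
    linarith
  | wakeRaise hp h =>
    rw [ledger_of_isOff hp.off, ledger_of_on1 h.on1, SysState.turnOn_eq_one (hp.off 0) h.on0,
      SysState.turnOn_eq_one (hp.off 1) h.on1]
    simp only [SysState.raised, hp.base.work_done_Ici]
    norm_num
    linarith
  | raise hp h =>
    have hmono : work (execTimes J - r) (arriving J (Ioo e t)) ≤
        work (execTimes J - r) (arriving J (Ioi e)) :=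
      work_mono_set (fun j => sub_nonneg.2 (hp.base.le_exec j)) fun _ hj => hj.1
    have hold : t - s.t1 ≤ work (execTimes J - r) (arriving J (Ioo e t)) := h.oldDone
    rw [ledger_of_single hp.on0 hp.on1, ledger_of_on1 h.on1,
      SysState.turnOn_eq_zero fun _ => hp.on0, SysState.turnOn_eq_one hp.on1 h.on1]
    simp only [SysState.raised, hp.base.work_done_Ici]
    norm_num
    linarith
  | clear hp h =>
    rw [ledger_of_on1 hp.on1, ledger_of_on1 h.on1, SysState.turnOn_eq_zero fun _ => hp.on0,
      SysState.turnOn_eq_zero fun _ => hp.on1]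
    simp [SysState.cleared]
  | halt _ _ _ _ hp h =>
    have hon : ∀ m, s.turnOn s' m = 0 := fun m =>
      SysState.turnOn_eq_zero fun hon => by simp [h.off m] at hon
    simpa [hon, ledger_of_isOff h.off] using hp.ledger_le

theorem CostBound.transition (hc : CostBound P J t e r s n o) (h : Transition P J t r e s e' s')
    (hn : ∀ m, n' m = n m + s.turnOn s' m) : CostBound P J t e' r s' n' o := by
  have hledger := h.ledger_le
  unfold CostBound at hc ⊢
  rw [hn, hn]
  push_cast
  linarith

end Ledger

section History

variable {ι : Type*} [Fintype ι] {P : PowerModel} {J : ι → Job} {s s' : SysState} {t e e' : ℝ}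
  {r : ι → ℝ} {n n' : ℕ} {x x' : Fin 2 → ι → ℝ}

/-- There are `n` complete periods, each consisting of an off-time from `p` to `w` and an on-time
from `w` to `q`, the last of which ends at the given time.  The first one starts before time `0`. -/
inductive Periods (P : PowerModel) (J : ι → Job) : ℕ → ℝ → Prop
  | zero : Periods P J 0 (-1)
  | succ {n : ℕ} {p w q : ℝ} : Periods P J n p → p < w → w + P.breakEven ≤ q →
      Trigger P J p w → Periods P J (n + 1) q

/-- The `n` turn-ons of `M₁` correspond to the complete periods, the last of which ends at time `e`,
and, unless the system is off in state `s`, to the current one. -/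
def PeriodCount (P : PowerModel) (J : ι → Job) (e : ℝ) (s : SysState) (n : ℕ) : Prop :=
  s.IsOff ∧ Periods P J n e ∨ ¬ s.IsOff ∧ ∃ k, n = k + 1 ∧ Periods P J k e

theorem PeriodCount.periods (h : PeriodCount P J e s n) (hs : s.IsOff) : Periods P J n e :=
  (h.resolve_right fun hon => hon.1 hs).2

theorem PeriodCount.exists_periods (h : PeriodCount P J e s n) (hs : ¬ s.IsOff) :
    ∃ k, n = k + 1 ∧ Periods P J k e :=
  (h.resolve_left fun hoff => hs hoff.1).2

theorem PeriodCount.transition (hc : PeriodCount P J e s n) (h : Transition P J t r e s e' s')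
    (hn : n' = n + s.turnOn s' 0) : PeriodCount P J e' s' n' := by
  subst hn
  cases h with
  | stay h => rwa [SysState.turnOn_eq_zero id]
  | wake hp h =>
    rw [SysState.turnOn_eq_one (hp.off 0) h.on0]
    exact .inr ⟨SysState.not_isOff_of_on h.on0, n, rfl, hc.periods hp.off⟩
  | wakeRaise hp h =>
    rw [SysState.turnOn_eq_one (hp.off 0) h.on0]
    exact .inr ⟨SysState.not_isOff_of_on h.on0, n, rfl, hc.periods hp.off⟩
  | raise hp h =>
    rw [SysState.turnOn_eq_zero fun _ => hp.on0]
    exact .inr ⟨SysState.not_isOff_of_on h.on0, hc.exists_periods (s.not_isOff_of_on hp.on0)⟩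
  | clear hp h =>
    rw [SysState.turnOn_eq_zero fun _ => hp.on0]
    exact .inr ⟨SysState.not_isOff_of_on h.on1, hc.exists_periods (s.not_isOff_of_on hp.on0)⟩
  | halt hs he htrig ht _ h =>
    rw [SysState.turnOn_eq_zero fun hon => by simp [h.off 0] at hon]
    obtain ⟨k, rfl, hk⟩ := hc.exists_periods hs
    exact .inl ⟨h.off, hk.succ he ht htrig⟩

/-- The arrival times of the jobs of the current period that processor `m` may have executed. -/
def SysState.territory (s : SysState) (m : Fin 2) : Set ℝ :=
  {a | if m = 0 then s.on 1 = true → a < s.tStar else s.on 1 = true ∧ s.tStar ≤ a}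

/-- No job is executed on both processors; `x m j` is the time for which processor `m` has executed
job `j`. -/
structure Placement (J : ι → Job) (e : ℝ) (s : SysState) (x : Fin 2 → ι → ℝ) : Prop where
  sole_past : ∀ j, (J j).arrival ≤ e → x 0 j = 0 ∨ x 1 j = 0
  territory : ∀ m j, e < (J j).arrival → x m j ≠ 0 → (J j).arrival ∈ s.territory m

theorem Phase.mem_territory (hp : Phase P J t e r s) {m : Fin 2} {j : ι} (hm : s.on m = true)
    (hj : (J j).arrival ∈ s.window m) (hr : r j ≠ 0) : (J j).arrival ∈ s.territory m := by
  rcases hp with hp | hp | hp | hp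
  · simp [hp.off m] at hm
  · fin_cases m
    · simp [SysState.territory, hp.on1]
    · simp [hp.on1] at hm
  · fin_cases m
    · simpa [SysState.territory, hp.on1, SysState.window_zero_of_urgent hp.flag] using hj
    · simpa [SysState.territory, hp.on1, SysState.window_one_of_urgent hp.flag] using hj
  · fin_cases m
    · simp [hp.on0] at hm
    · simpa [SysState.territory, hp.on1] using not_lt.1 (mt (hp.oldDone j) hr)

omit [Fintype ι] in
theorem Placement.sole (h : Placement J e s x) (j : ι) : x 0 j = 0 ∨ x 1 j = 0 := by
  rcases le_or_gt (J j).arrival e with hj | hj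
  · exact h.sole_past j hj
  · by_contra! hx
    have h0 := h.territory 0 j hj hx.1
    have h1 := h.territory 1 j hj hx.2
    exact absurd (h0 h1.1) (not_lt.2 h1.2)

theorem Placement.segment (hx : Placement J e s x) (hp : Phase P J t e r s)
    (hdone : ∀ m j, r j = 0 → x' m j = x m j)
    (hidle : ∀ m j, ¬(s.on m = true ∧ (J j).arrival ∈ s.window m) → x' m j = x m j) :
    Placement J e s x' where
  sole_past j hj := by
    have hr := hp.remainingInvariant.past j hj
    rw [hdone 0 j hr, hdone 1 j hr]
    exact hx.sole j
  territory m j hj hne := by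
    by_cases hxm : x m j = 0
    · have hne' : x' m j ≠ x m j := hxm ▸ hne
      have hrun := not_imp_comm.1 (hidle m j) hne'
      exact hp.mem_territory hrun.1 hrun.2 fun hr => hne' (hdone m j hr)
    · exact hx.territory m j hj hxm

theorem Placement.transition (hx : Placement J e s x) (h : Transition P J t r e s e' s')
    (hstart : ∀ m j, r j = (J j).exec → x m j = 0) : Placement J e' s' x := by
  cases h with
  | stay h => exact hx
  | wake hp h =>
    refine ⟨hx.sole_past, fun m j hj hne => ?_⟩
    exact absurd (hstart m j (hp.unstarted j hj)) hne
  | wakeRaise hp h =>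
    refine ⟨hx.sole_past, fun m j hj hne => ?_⟩
    exact absurd (hstart m j (hp.unstarted j hj)) hne
  | raise hp h =>
    refine ⟨hx.sole_past, fun m j hj hne => ?_⟩
    have hjt : (J j).arrival < t := not_le.1 fun hjt => hne (hstart m j (hp.base.future j hjt))
    have hterr := hx.territory m j hj hne
    fin_cases m
    · exact fun _ => hjt
    · simp [SysState.territory, hp.on1] at hterr
  | clear hp h => exact ⟨hx.sole_past, hx.territory⟩
  | halt _ _ _ _ hp h =>
    refine ⟨fun j _ => hx.sole j, fun m j hj hne => ?_⟩
    exact absurd (hstart m j (hp.remainingInvariant.future j (le_of_lt hj))) hne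

end History

section Accounting

variable {ι : Type*} {k : ℕ}

namespace Schedule

variable (S : Schedule ι k) {m : Fin k} {I I' : ℝ × ℝ} {u t : ℝ}

/-- The number of times processor `m` has been turned on up to time `t`. -/
def turnOns (m : Fin k) (t : ℝ) : ℕ := ((S.on m).filter fun I => I.1 ≤ t).card

/-- The amount of time within `A` during which processor `m` is on. -/
def onTime (m : Fin k) (A : Set ℝ) : ℝ := volume.real (S.onSet m ∩ A)

theorem start_mem_onSet (hI : I ∈ S.on m) : I.1 ∈ S.onSet m :=
  (S.mem_onSet m).2 ⟨I, hI, left_mem_Ico.2 (S.on_lt m I hI)⟩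

theorem on_eq_of_touching (hI : I ∈ S.on m) (hI' : I' ∈ S.on m) (h : I'.1 ≤ I.2)
    (h' : I.1 ≤ I'.2) : I = I' := by
  by_contra hne
  exact (S.on_separated m I hI I' hI' hne).elim h.not_gt h'.not_gt

theorem exists_on_of_Ico_subset (hut : u < t) (h : Ico u t ⊆ S.onSet m) :
    ∃ I ∈ S.on m, I.1 ≤ u ∧ t ≤ I.2 := by
  obtain ⟨I, hI, hu⟩ := (S.mem_onSet m).1 (h ⟨le_rfl, hut⟩)
  refine ⟨I, hI, hu.1, not_lt.1 fun hend => ?_⟩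
  obtain ⟨I', hI', hv⟩ := (S.mem_onSet m).1 (h ⟨hu.2.le, hend⟩)
  obtain rfl := S.on_eq_of_touching hI hI' hv.1 (hu.1.trans (hu.2.le.trans hv.2.le))
  exact hv.2.false

theorem turnOns_eq (hut : u ≤ t) (h : ∀ I ∈ S.on m, u < I.1 → t < I.1) :
    S.turnOns m t = S.turnOns m u :=
  congrArg Finset.card <| Finset.filter_congr fun I hI =>
    ⟨fun ht => not_lt.1 fun hu => ht.not_gt (h I hI hu), fun hu => hu.trans hut⟩

theorem turnOns_eq_of_on (hut : u < t) (h : Ico u t ⊆ S.onSet m) :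
    S.turnOns m t = S.turnOns m u := by
  obtain ⟨I, hI, hu, ht⟩ := S.exists_on_of_Ico_subset hut h
  refine S.turnOns_eq hut.le fun I' hI' hu' => ?_
  by_contra! ht'
  obtain rfl := S.on_eq_of_touching hI hI' (ht'.trans ht)
    (hu.trans (hu'.le.trans (S.on_lt m I' hI').le))
  exact hu.not_gt hu'

theorem turnOns_eq_of_off (hut : u ≤ t) (h : ∀ v ∈ Icc u t, v ∉ S.onSet m) :
    S.turnOns m t = S.turnOns m u :=
  S.turnOns_eq hut fun I hI hu => not_le.1 fun ht => h I.1 ⟨hu.le, ht⟩ (S.start_mem_onSet hI)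

theorem turnOns_eq_add_one (hut : u < t) (h : ∀ v ∈ Ico u t, v ∉ S.onSet m)
    (ht : t ∈ S.onSet m) : S.turnOns m t = S.turnOns m u + 1 := by
  classical
  obtain ⟨I, hI, htI⟩ := (S.mem_onSet m).1 ht
  have huI : u < I.1 := not_le.1 fun hle =>
    h u ⟨le_rfl, hut⟩ ((S.mem_onSet m).2 ⟨I, hI, hle, hut.trans htI.2⟩)
  have hinsert : (S.on m).filter (fun I => I.1 ≤ t) =
      insert I ((S.on m).filter fun I => I.1 ≤ u) := by
    ext I'
    rw [Finset.mem_insert, Finset.mem_filter, Finset.mem_filter]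
    refine ⟨fun ⟨hI', ht'⟩ => ?_, ?_⟩
    · refine (le_or_gt I'.1 u).elim (fun hu' => .inr ⟨hI', hu'⟩) fun hu' => .inl ?_
      have hstart : t ≤ I'.1 := not_lt.1 fun hlt => h _ ⟨hu'.le, hlt⟩ (S.start_mem_onSet hI')
      exact S.on_eq_of_touching hI' hI (htI.1.trans (hstart.trans (S.on_lt m I' hI').le))
        (ht'.trans htI.2.le)
    · rintro (rfl | ⟨hI', hu'⟩)
      exacts [⟨hI, htI.1⟩, ⟨hI', hu'.trans hut.le⟩]
  rw [turnOns, hinsert, Finset.card_insert_of_notMem fun hmem =>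
    (Finset.mem_filter.1 hmem).2.not_gt huI, turnOns]

theorem executed_nonneg (m : Fin k) (j : ι) {A : Set ℝ} (hA : MeasurableSet A) :
    0 ≤ S.executed m j A :=
  (S.executed_eq_volume m j hA).symm ▸ measureReal_nonneg

theorem executed_eq_zero_of_unstarted {J : ι → Job} {j : ι}
    (h : S.remaining J j t = (J j).exec) (m : Fin k) : S.executed m j (Icc 0 t) = 0 :=
  (Finset.sum_eq_zero_iff_of_nonneg fun m _ => S.executed_nonneg m j measurableSet_Icc).1
    (sub_eq_self.1 h) m (Finset.mem_univ m)

end Schedule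

end Accounting

section RunInvariant

variable {ι : Type*} [Fintype ι] {P : PowerModel} {J : ι → Job} {S : Schedule ι 2}
  {σ : ℝ → SysState} {s s' : SysState} {u t e e' : ℝ} {n n' : Fin 2 → ℕ}

theorem IsRun.turnOns_eq {lam : ℝ} (h : IsRun P lam J S σ) (hs : IsSteady J σ u t) (m : Fin 2) :
    S.turnOns m t = S.turnOns m u + (σ u).turnOn (σ t) m := by
  have hon : ∀ v ∈ Ico u t, (v ∈ S.onSet m ↔ (σ u).on m = true) := fun v hv => by
    rw [h.mem_onSet_iff (hs.nonneg.trans hv.1), hs.const v hv]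
  have hont : t ∈ S.onSet m ↔ (σ t).on m = true := h.mem_onSet_iff (hs.nonneg.trans hs.lt.le)
  cases hm : (σ u).on m
  · have hoff : ∀ v ∈ Ico u t, v ∉ S.onSet m := fun v hv => by simp [hon v hv, hm]
    cases hmt : (σ t).on m
    · rw [SysState.turnOn_eq_zero (by simp [hmt])]
      refine S.turnOns_eq_of_off hs.lt.le fun v hv => ?_
      obtain rfl | hvt := hv.2.eq_or_lt
      exacts [by simp [hont, hmt], hoff v ⟨hv.1, hvt⟩]
    · rw [SysState.turnOn_eq_one hm hmt]
      exact S.turnOns_eq_add_one hs.lt hoff (hont.2 hmt)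
  · rw [SysState.turnOn_eq_zero fun _ => hm]
    exact S.turnOns_eq_of_on hs.lt fun v hv => (hon v hv).2 hm

theorem IsRun.turnOns_zero {lam : ℝ} (h : IsRun P lam J S σ) (m : Fin 2) :
    S.turnOns m 0 = SysState.initial.turnOn (σ 0) m := by
  have hneg : ∀ v < 0, v ∉ S.onSet m := fun v hv hmem => by
    obtain ⟨I, hI, hvI⟩ := (S.mem_onSet m).1 hmem
    exact ((S.on_nonneg m I hI).trans hvI.1).not_gt hv
  have hstart : S.turnOns m (-1) = 0 := Finset.card_eq_zero.2 <|
    Finset.filter_eq_empty_iff.2 fun I hI => not_le.2 (by linarith [S.on_nonneg m I hI])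
  cases hm : (σ 0).on m
  · rw [SysState.turnOn_eq_zero (by simp [hm]), ← hstart]
    refine S.turnOns_eq_of_off (by norm_num) fun v hv => ?_
    obtain rfl | hv0 := hv.2.eq_or_lt
    exacts [by simp [h.mem_onSet_iff le_rfl, hm], hneg v hv0]
  · rw [SysState.turnOn_eq_one rfl hm, S.turnOns_eq_add_one (u := -1) (by norm_num)
      (fun v hv => hneg v hv.2) ((h.mem_onSet_iff le_rfl).2 hm), hstart]

theorem IsRun.onTime_eq {lam : ℝ} (h : IsRun P lam J S σ) (hs : IsSteady J σ u t) (m : Fin 2) :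
    S.onTime m (Icc 0 t) = S.onTime m (Icc 0 u) + if (σ u).on m = true then t - u else 0 := by
  have hsub := volume_Icc_inter_sub (S.measurableSet_onSet m) hs.nonneg hs.lt.le
  have hon : ∀ v ∈ Ioo u t, (v ∈ S.onSet m ↔ (σ u).on m = true) := fun v hv => by
    rw [h.mem_onSet_iff (hs.nonneg.trans hv.1.le), hs.const v ⟨hv.1.le, hv.2⟩]
  rw [Schedule.onTime, Schedule.onTime, inter_comm, inter_comm _ (Icc 0 u), ← sub_eq_iff_eq_add',
    hsub]
  split_ifs with hm
  · rw [inter_eq_left.2 fun v hv => (hon v hv).2 hm, Real.volume_real_Ioo_of_le hs.lt.le]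
  · rw [Disjoint.inter_eq (Set.disjoint_left.2 fun v hv => mt (hon v hv).1 hm), measureReal_empty]

/-- What is known about the past of the schedule `S` at time `t`, when the system is in state `s`,
has last been turned off at time `e`, and processor `m` has been turned on `n m` times. -/
structure Record (P : PowerModel) (J : ι → Job) (S : Schedule ι 2) (t e : ℝ) (s : SysState)
    (n : Fin 2 → ℕ) : Prop where
  cost : CostBound P J t e (S.remainingAt J t) s n (∑ m, S.onTime m (Icc 0 t))
  periods : PeriodCount P J e s (n 0)
  placement : Placement J e s fun m j => S.executed m j (Icc 0 t)

theorem Record.initial : Record P J S 0 (-1) SysState.initial 0 where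
  cost := by
    have hon : ∑ m, S.onTime m (Icc 0 0) = 0 := Finset.sum_eq_zero fun m _ => by
      rw [Schedule.onTime, measureReal_def, Icc_self,
        measure_mono_null inter_subset_right (by simp), ENNReal.toReal_zero]
    have hwork : work (execTimes J) (arriving J (Iic (-1))) ≥ 0 :=
      work_nonneg fun j _ => execTimes_nonneg J j
    rw [CostBound, ledger_of_isOff fun _ => rfl, hon, S.remainingAt_zero, sub_self,
      work_eq_zero (f := 0) fun _ _ => rfl]
    simpa using hwork
  periods := .inl ⟨fun _ => rfl, .zero⟩
  placement := ⟨fun j _ => .inl (S.executed_zero 0 j),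
    fun m j _ hne => (hne (S.executed_zero m j)).elim⟩

theorem Record.segment {lam : ℝ} (hr : Record P J S u e (σ u) n) (h : IsRun P lam J S σ)
    (hs : IsSteady J σ u t) (hp : Phase P J u e (S.remainingAt J u) (σ u))
    (hseg : Segment P J (σ u) u (S.remainingAt J u) t (S.remainingAt J t)) :
    Record P J S t e (σ u) n where
  cost := hr.cost.segment hp hseg <| by
    rw [← Finset.sum_add_distrib]
    exact Finset.sum_congr rfl fun m _ => h.onTime_eq hs m
  periods := hr.periods
  placement := by
    have hexec (m : Fin 2) (j : ι) := h.executed_sub m j hs.nonneg hs.lt.le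
    refine hr.placement.segment hp (fun m j hdone => ?_) fun m j hidle => ?_
    · have hsum := h.remaining_sub j hs.nonneg hs.lt.le
      have ht := (hseg.anti j).trans_eq hdone
      have hzero : ∑ m, volume.real (Ioo u t ∩ S.slot m j) = 0 := by
        linarith [hseg.nonneg j]
      exact sub_eq_zero.1 <| (hexec m j).trans <| (Finset.sum_eq_zero_iff_of_nonneg
        fun _ _ => measureReal_nonneg).1 hzero m (Finset.mem_univ m)
    · exact sub_eq_zero.1 <| (hexec m j).trans <|
        h.volume_slot_eq_zero hs fun hm hj => (hidle ⟨hm, hj⟩).elim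

theorem Record.transition (hr : Record P J S t e s n)
    (h : Transition P J t (S.remainingAt J t) e s e' s')
    (hn : ∀ m, n' m = n m + s.turnOn s' m) : Record P J S t e' s' n' where
  cost := hr.cost.transition h hn
  periods := hr.periods.transition h (hn 0)
  placement := hr.placement.transition h fun m _ hj => S.executed_eq_zero_of_unstarted hj m

namespace IsRun

theorem invariant (h : IsRun P 1 J S σ) (hJ : EDFCondition J) (ht : 0 ≤ t) :
    ∃ e, Phase P J t e (S.remainingAt J t) (σ t) ∧
      Record P J S t e (σ t) fun m => S.turnOns m t := by
  refine h.induction (p := fun t => ∃ e, Phase P J t e (S.remainingAt J t) (σ t) ∧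
    Record P J S t e (σ t) fun m => S.turnOns m t) ?_ (fun u t hs ⟨e, hp, hr⟩ => ?_) ht
  · have hpre : PrePhase P J 0 (-1) (S.remainingAt J 0) SysState.initial :=
      .inl (S.remainingAt_zero J ▸ PreOffPhase.initial hJ)
    obtain ⟨e', htr⟩ := hpre.exists_transition hJ (S.remainingAt_zero J ▸ h.init_eq_updateAt)
    exact ⟨e', htr.phase, Record.initial.transition htr fun m => by simp [h.turnOns_zero]⟩
  · have hseg := h.segment hs hp.coherent
    obtain ⟨e', htr⟩ := (hp.segment hJ hseg).exists_transition hJ (h.eq_updateAt hs)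
    exact ⟨e', htr.phase, (hr.segment h hs hp hseg).transition htr (h.turnOns_eq hs)⟩

theorem feasible (h : IsRun P 1 J S σ) (hJ : EDFCondition J) : S.Feasible J univ := by
  intro j _
  have harr := (J j).arrival_nonneg
  obtain ⟨e, hp, hr⟩ := h.invariant hJ (harr.trans (hJ.arrival_lt_deadline j).le)
  have hexec (m : Fin 2) : S.executed m j (Icc (J j).arrival (J j).deadline) =
      S.executed m j (Icc 0 (J j).deadline) := by
    rw [h.executed_eq_volume_slot (fun v hv => harr.trans hv.1) measurableSet_Icc,
      h.executed_eq_volume_slot Icc_subset_Ici_self measurableSet_Icc]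
    congr 1
    ext v
    exact ⟨fun hv => ⟨⟨harr.trans hv.1.1, hv.1.2⟩, hv.2⟩, fun hv =>
      ⟨⟨(h.mem_eligible hv.1.1 hv.2).1.1, hv.1.2⟩, hv.2⟩⟩
  have hdone : S.remaining J j (J j).deadline = 0 := hp.remainingInvariant.due j le_rfl
  rw [Schedule.remaining, Fin.sum_univ_two, ← hexec, ← hexec] at hdone
  obtain hidle | hidle := hr.placement.sole j <;> rw [← hexec] at hidle
  · exact ⟨1, by linarith⟩
  · exact ⟨0, by linarith⟩

end IsRun

end RunInvariant

section Energy

variable {ι : Type*} [Fintype ι] {k : ℕ}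

namespace Schedule

variable (S : Schedule ι k) (P : PowerModel)

theorem power_eq (m : Fin k) (t : ℝ) : S.power P m t =
    P.standby + (P.busy - P.standby) * ∑ j, (S.slot m j).indicator (fun _ => (1 : ℝ)) t := by
  classical
  simp only [indicator_apply, slot, mem_ofPred_eq]
  obtain hj | ⟨i, hj⟩ := Option.eq_none_or_eq_some (S.job m t) <;> simp [power, hj]

theorem sum_integral_power (m : Fin k) {A : Set ℝ} (hA : MeasurableSet A) :
    ∑ I ∈ S.on m, ∫ t in Ico I.1 I.2 ∩ A, S.power P m t =
      P.standby * S.onTime m A + (P.busy - P.standby) * ∑ j, S.executed m j A := by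
  unfold executed
  rw [onTime, ← S.sum_volume_on_inter m hA, Finset.sum_comm, Finset.mul_sum, Finset.mul_sum,
    ← Finset.sum_add_distrib]
  refine Finset.sum_congr rfl fun I _ => ?_
  have hfin : IsFiniteMeasure (volume.restrict (Ico I.1 I.2 ∩ A)) :=
    isFiniteMeasure_restrict.2 (measure_inter_lt_top_of_left_ne_top measure_Ico_lt_top.ne).ne
  have hint (j : ι) : Integrable ((S.slot m j).indicator fun _ => (1 : ℝ))
      (volume.restrict (Ico I.1 I.2 ∩ A)) :=
    (integrable_const 1).indicator (S.measurableSet_slot m j)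
  simp only [S.power_eq]
  rw [integral_add (integrable_const _) ((integrable_finsetSum _ fun j _ => hint j).const_mul _),
    integral_const_mul, integral_finsetSum _ fun j _ => hint j, setIntegral_const, smul_eq_mul,
    mul_comm]
  rfl

theorem energyUpTo_eq (T : ℝ) :
    S.energyUpTo P T = P.standby * (∑ m, (P.breakEven * S.turnOns m T + S.onTime m (Icc 0 T))) +
      (P.busy - P.standby) * ∑ m, ∑ j, S.executed m j (Icc 0 T) := by
  rw [Finset.mul_sum, Finset.mul_sum, ← Finset.sum_add_distrib]
  refine Finset.sum_congr rfl fun m _ => ?_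
  have hpast : ∀ I ∈ S.on m, Ico I.1 I.2 ∩ Iic T = Ico I.1 I.2 ∩ Icc 0 T := fun I hI => by
    have hnonneg : Ico I.1 I.2 ⊆ Ici 0 := fun v hv => (S.on_nonneg m I hI).trans hv.1
    rw [← Ici_inter_Iic, ← inter_assoc, inter_eq_left.2 hnonneg]
  rw [Finset.sum_congr rfl fun I hI => by rw [hpast I hI],
    S.sum_integral_power P m measurableSet_Icc, ← P.standby_mul_breakEven, turnOns]
  ring

theorem energy_eq :
    S.energy P = P.standby * (∑ m, (P.breakEven * (S.on m).card + S.onTime m univ)) +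
      (P.busy - P.standby) * ∑ m, ∑ j, S.executed m j univ := by
  rw [Finset.mul_sum, Finset.mul_sum, ← Finset.sum_add_distrib]
  refine Finset.sum_congr rfl fun m _ => ?_
  rw [mul_add, add_assoc, ← S.sum_integral_power P m MeasurableSet.univ, ← mul_assoc,
    P.standby_mul_breakEven]
  simp only [inter_univ]

end Schedule

end Energy

section Activity

variable {ι : Type*} {k : ℕ}

namespace Schedule

variable (O : Schedule ι k)

/-- The times at which some processor is on. -/
def activeSet : Set ℝ := ⋃ m, O.onSet m

/-- The multiset of the end points of all on-intervals of all processors. -/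
def endpoints : Multiset ℝ :=
  ∑ m, ((O.on m).val.map Prod.fst + (O.on m).val.map Prod.snd)

/-- The number of end points of on-intervals up to time `t`. -/
def endsBy (t : ℝ) : ℕ := (O.endpoints.filter (· ≤ t)).card

variable {O} {m : Fin k} {I : ℝ × ℝ} {p q t v : ℝ}

theorem volume_onSet_ne_top (O : Schedule ι k) (m : Fin k) : volume (O.onSet m) ≠ ⊤ :=
  ((measure_biUnion_finset_le _ _).trans_lt <|
    ENNReal.sum_lt_top.2 fun _ _ => measure_Ico_lt_top).ne

theorem volume_activeSet_ne_top (O : Schedule ι k) : volume O.activeSet ≠ ⊤ :=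
  ((measure_iUnion_fintype_le _ _).trans_lt <|
    ENNReal.sum_lt_top.2 fun m _ => (O.volume_onSet_ne_top m).lt_top).ne

theorem volume_activeSet_inter_le (O : Schedule ι k) (A : Set ℝ) :
    volume.real (O.activeSet ∩ A) ≤ ∑ m, O.onTime m A := by
  rw [activeSet, iUnion_inter]
  exact measureReal_iUnion_fintype_le _

theorem onTime_add_compl (O : Schedule ι k) (m : Fin k) {A : Set ℝ} (hA : MeasurableSet A) :
    O.onTime m A + O.onTime m Aᶜ = O.onTime m univ := by
  rw [onTime, onTime, onTime, inter_univ, ← sdiff_eq]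
  exact measureReal_inter_add_sdiff hA (O.volume_onSet_ne_top m)

theorem mem_endpoints (hI : I ∈ O.on m) : I.1 ∈ O.endpoints ∧ I.2 ∈ O.endpoints := by
  simp only [endpoints, Multiset.mem_sum, Multiset.mem_add, Multiset.mem_map]
  exact ⟨⟨m, Finset.mem_univ m, .inl ⟨I, hI, rfl⟩⟩, ⟨m, Finset.mem_univ m, .inr ⟨I, hI, rfl⟩⟩⟩

theorem card_endpoints (O : Schedule ι k) : O.endpoints.card = 2 * ∑ m, (O.on m).card := by
  simp only [endpoints, Multiset.card_sum, Multiset.card_add, Multiset.card_map, Finset.card_val,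
    ← two_mul, Finset.mul_sum]

theorem endsBy_mono (h : p ≤ q) : O.endsBy p ≤ O.endsBy q :=
  Multiset.card_le_card <| Multiset.monotone_filter_right _ fun _ hp => hp.trans h

theorem endsBy_lt (hv : v ∈ O.endpoints) (h : v ∈ Ioc p q) : O.endsBy p < O.endsBy q := by
  refine Multiset.card_lt_card <| lt_of_le_of_ne
    (Multiset.monotone_filter_right _ fun _ hp => hp.trans (h.1.le.trans h.2)) fun heq => ?_
  have hvp : v ∈ O.endpoints.filter (· ≤ p) := heq ▸ Multiset.mem_filter.2 ⟨hv, h.2⟩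
  exact (Multiset.mem_filter.1 hvp).2.not_gt h.1

theorem endsBy_le_card (O : Schedule ι k) (t : ℝ) : O.endsBy t ≤ O.endpoints.card :=
  Multiset.card_le_card (Multiset.filter_le _ _)

theorem endsBy_lt_card (hv : v ∈ O.endpoints) (h : t < v) : O.endsBy t < O.endpoints.card :=
  (endsBy_lt hv ⟨h, le_rfl⟩).trans_le (O.endsBy_le_card v)

theorem mem_activeSet : v ∈ O.activeSet ↔ ∃ m, ∃ I ∈ O.on m, v ∈ Ico I.1 I.2 := by
  simp only [activeSet, mem_iUnion, mem_onSet]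

theorem exists_endpoint_gt (hv : v ∈ O.activeSet) : ∃ x ∈ O.endpoints, v < x := by
  obtain ⟨m, I, hI, hvI⟩ := mem_activeSet.1 hv
  exact ⟨I.2, (mem_endpoints hI).2, hvI.2⟩

theorem exists_endpoint_or_subset_or_disjoint (O : Schedule ι k) (p q : ℝ) :
    (∃ v ∈ O.endpoints, v ∈ Ioc p q) ∨ Ioc p q ⊆ O.activeSet ∨
      Disjoint O.activeSet (Ioc p q) := by
  by_contra! hcon
  obtain ⟨hends, hsub, hdisj⟩ := hcon
  obtain ⟨v, hv, hvpq⟩ := Set.not_disjoint_iff.1 hdisj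
  obtain ⟨m, I, hI, hvI⟩ := mem_activeSet.1 hv
  have hstart : I.1 ≤ p := not_lt.1 fun hlt =>
    hends _ (mem_endpoints hI).1 ⟨hlt, hvI.1.trans hvpq.2⟩
  have hend : q < I.2 := not_le.1 fun hle =>
    hends _ (mem_endpoints hI).2 ⟨hvpq.1.trans hvI.2, hle⟩
  exact hsub fun x hx => mem_activeSet.2 ⟨m, I, hI, hstart.trans hx.1.le, hx.2.trans_lt hend⟩

theorem exists_energyUpTo_eq (O : Schedule ι k) (P : PowerModel) :
    ∃ T, 0 ≤ T ∧ O.energyUpTo P T = O.energy P := by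
  obtain ⟨T, hT⟩ := O.endpoints.toFinset.bddAbove
  have hend : ∀ m, ∀ I ∈ O.on m, I.2 ≤ max T 0 := fun m I hI =>
    (hT (Multiset.mem_toFinset.2 (mem_endpoints hI).2)).trans (le_max_left _ _)
  refine ⟨max T 0, le_max_right _ _, Finset.sum_congr rfl fun m _ => ?_⟩
  rw [Finset.filter_true_of_mem fun I hI => (O.on_lt m I hI).le.trans (hend m I hI)]
  congr 1
  refine Finset.sum_congr rfl fun I hI => ?_
  rw [inter_eq_left.2 fun v hv => hv.2.le.trans (hend m I hI)]

theorem sum_executed_le [Fintype ι] (O : Schedule ι k) (m : Fin k) {A : Set ℝ}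
    (hA : MeasurableSet A) : ∑ j, O.executed m j A ≤ O.onTime m A := by
  have hfin : volume (O.onSet m ∩ A) ≠ ⊤ :=
    (measure_inter_lt_top_of_left_ne_top (O.volume_onSet_ne_top m)).ne
  calc ∑ j, O.executed m j A
      = work (fun j => volume.real (O.onSet m ∩ A ∩ O.slot m j)) univ := by
        simp only [work_univ, O.executed_eq_volume m _ hA, inter_assoc]
    _ = volume.real (O.onSet m ∩ A ∩ ⋃ j ∈ univ, O.slot m j) :=
        (O.volume_inter_biUnion_slot m univ ((O.measurableSet_onSet m).inter hA) hfin).symm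
    _ ≤ O.onTime m A := measureReal_mono inter_subset_left hfin

variable {J : ι → Job} {A : Set ι} {R : Set ℝ} {j : ι}

theorem Feasible.nonempty_active (hO : O.Feasible J A) (hj : j ∈ A) :
    (O.activeSet ∩ Icc (J j).arrival (J j).deadline).Nonempty := by
  obtain ⟨m, hm⟩ := hO j hj
  rw [O.executed_eq_volume m j measurableSet_Icc] at hm
  obtain ⟨v, hv⟩ := nonempty_of_measureReal_ne_zero ((J j).exec_pos.trans_le hm).ne'
  exact ⟨v, mem_iUnion.2 ⟨m, hv.1⟩, hv.2.1⟩

theorem Feasible.work_le_sum_executed [Fintype ι] (hO : O.Feasible J A) (hR : MeasurableSet R)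
    (h : ∀ j ∈ A, O.activeSet ∩ Icc (J j).arrival (J j).deadline ⊆ R) :
    work (execTimes J) A ≤ ∑ m, ∑ j, O.executed m j R := by
  rw [Finset.sum_comm]
  refine Finset.sum_le_sum fun j _ => indicator_le' (fun j hj => ?_)
    (fun j _ => Finset.sum_nonneg fun m _ => O.executed_nonneg m j hR) j
  obtain ⟨m, hm⟩ := hO j hj
  have hmono : O.executed m j (Icc (J j).arrival (J j).deadline) ≤ O.executed m j R := by
    rw [O.executed_eq_volume m j measurableSet_Icc, O.executed_eq_volume m j hR]
    exact measureReal_mono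
      (fun v hv => ⟨hv.1, h j hj ⟨mem_iUnion.2 ⟨m, hv.1⟩, hv.2.1⟩, hv.2.2⟩)
      (measure_inter_lt_top_of_left_ne_top (O.volume_onSet_ne_top m)).ne
  exact hm.trans <| hmono.trans <| Finset.single_le_sum
    (fun m _ => O.executed_nonneg m j hR) (Finset.mem_univ m)

end Schedule

end Activity

section PeriodCover

variable {ι : Type*} [Fintype ι] {k : ℕ} {P : PowerModel} {J : ι → Job} {O : Schedule ι k}
  {D : Set ι} {R : Set ℝ} {n : ℕ} {e p q w : ℝ}

theorem volume_inter_Iic_add_le {U U' : Set ℝ} (hU : U ⊆ U') (hU' : volume U' ≠ ⊤) (hpw : p ≤ w)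
    (hwq : w ≤ q) (h : Ioc w q ⊆ U') :
    volume.real (U ∩ Iic p) + (q - w) ≤ volume.real (U' ∩ Iic q) := by
  have hdisj : Disjoint (U ∩ Iic p) (Ioc w q) := Set.disjoint_left.2 fun v hv hv' =>
    (hv'.1.trans_le (le_trans hv.2 hpw)).false
  rw [← Real.volume_real_Ioc_of_le hwq, ← measureReal_union
    (h₁ := (measure_inter_lt_top_of_left_ne_top (measure_ne_top_of_subset hU hU')).ne)
    (h₂ := measure_Ioc_lt_top.ne) hdisj measurableSet_Ioc]
  exact measureReal_mono (union_subset
      (inter_subset_inter hU (Iic_subset_Iic.2 (hpw.trans hwq))) (subset_inter h fun v hv => hv.2))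
    (measure_inter_lt_top_of_left_ne_top hU').ne

/-- The `n` complete periods up to time `e` are paid for by the end points of on-intervals of `O`
and by the time that is either active or reserved.  The reserved time `R` is all that is available
to `O` for the jobs in `D`, whose work is at least as long as `R`. -/
structure PeriodCover (P : PowerModel) (J : ι → Job) (O : Schedule ι k) (n : ℕ) (e : ℝ)
    (D : Set ι) (R : Set ℝ) : Prop where
  measurable : MeasurableSet R
  finite : volume R ≠ ⊤
  volume_le : volume.real R ≤ work (execTimes J) D
  arrived : D ⊆ arriving J (Iic e)
  reserved : ∀ j ∈ D, O.activeSet ∩ Icc (J j).arrival (J j).deadline ⊆ R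
  bound : P.breakEven * n ≤
    P.breakEven * O.endsBy e + volume.real ((O.activeSet ∪ R) ∩ Iic e)

namespace PeriodCover

theorem volume_union_ne_top (h : PeriodCover P J O n e D R) : volume (O.activeSet ∪ R) ≠ ⊤ :=
  measure_union_ne_top O.volume_activeSet_ne_top h.finite

theorem zero : PeriodCover P J O 0 e ∅ ∅ where
  measurable := .empty
  finite := by simp
  volume_le := by simp [work_eq_zero]
  arrived := empty_subset _
  reserved := by simp
  bound := by
    have := P.breakEven_nonneg
    rw [Nat.cast_zero, mul_zero]
    positivity

theorem succ_of_endpoint (h : PeriodCover P J O n p D R) {v : ℝ} (hv : v ∈ O.endpoints)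
    (hvpq : v ∈ Ioc p q) : PeriodCover P J O (n + 1) q D R where
  __ := h
  arrived := h.arrived.trans <| preimage_mono <| Iic_subset_Iic.2 (hvpq.1.le.trans hvpq.2)
  bound := by
    have hends : (O.endsBy p : ℝ) + 1 ≤ O.endsBy q := by
      exact_mod_cast Schedule.endsBy_lt hv hvpq
    have hvol : volume.real ((O.activeSet ∪ R) ∩ Iic p) ≤
        volume.real ((O.activeSet ∪ R) ∩ Iic q) :=
      measureReal_mono (inter_subset_inter_right _ (Iic_subset_Iic.2 (hvpq.1.le.trans hvpq.2)))
        (measure_inter_lt_top_of_left_ne_top h.volume_union_ne_top).ne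
    have hpaid := mul_le_mul_of_nonneg_left hends P.breakEven_nonneg
    push_cast
    linarith [h.bound]

theorem succ_of_subset (h : PeriodCover P J O n p D R) (hq : p + P.breakEven ≤ q)
    (hon : Ioc p q ⊆ O.activeSet) : PeriodCover P J O (n + 1) q D R := by
  have hpq : p ≤ q := by linarith [P.breakEven_nonneg]
  refine { h with
    arrived := h.arrived.trans <| preimage_mono <| Iic_subset_Iic.2 hpq
    bound := ?_ }
  have hends : P.breakEven * O.endsBy p ≤ P.breakEven * O.endsBy q :=
    mul_le_mul_of_nonneg_left (mod_cast Schedule.endsBy_mono hpq) P.breakEven_nonneg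
  have hvol := volume_inter_Iic_add_le subset_rfl h.volume_union_ne_top le_rfl hpq
    (hon.trans subset_union_left)
  push_cast
  linarith [h.bound]

theorem succ_of_disjoint (h : PeriodCover P J O n p D R) (hpw : p < w)
    (hwq : w + P.breakEven ≤ q) (htrig : Trigger P J p w)
    (hO : O.Feasible J (arriving J (Iic q))) (hoff : Disjoint O.activeSet (Ioc p q)) :
    ∃ D' R', PeriodCover P J O (n + 1) q D' R' := by
  have hwq' : w ≤ q := by linarith [P.breakEven_nonneg]
  have hlate : ∀ v ∈ O.activeSet, p < v → q < v := fun v hv hpv =>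
    not_le.1 fun hvq => Set.disjoint_left.1 hoff hv ⟨hpv, hvq⟩
  have hdeadline : ∀ j ∈ arriving J (Ioc p w), q < (J j).deadline := fun j hj => by
    obtain ⟨v, hv, hvj⟩ := hO.nonempty_active (j := j) (le_trans hj.2 hwq')
    exact (hlate v hv (hj.1.trans_le hvj.1)).trans_le hvj.2
  obtain ⟨j, hj, hdue⟩ | ⟨x, hwx, hx⟩ := htrig
  · exact absurd (hdue.trans hwq) (hdeadline j hj).not_ge
  obtain ⟨j, hj, -⟩ := exists_pos_of_work_pos ((sub_pos.2 hwx).trans_le hx)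
  have hqx : q < x := (hdeadline j hj.1).trans_le hj.2
  refine ⟨D ∪ arriving J (Ioc p w) ∩ dueBy J x, R ∪ Icc w x, h.measurable.union measurableSet_Icc,
    measure_union_ne_top h.finite measure_Icc_lt_top.ne, ?_, ?_, ?_, ?_⟩
  · have hdisj : Disjoint D (arriving J (Ioc p w)) :=
      (disjoint_arriving (Iic_disjoint_Ioc le_rfl)).mono_left h.arrived
    calc volume.real (R ∪ Icc w x) ≤ volume.real R + (x - w) :=
          (measureReal_union_le _ _).trans_eq <| by rw [Real.volume_real_Icc_of_le hwx.le]
      _ ≤ work (execTimes J) D + workDue J (execTimes J) (Ioc p w) x := add_le_add h.volume_le hx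
      _ = _ := (work_union _ (hdisj.mono_right inter_subset_left)).symm
  · exact union_subset (h.arrived.trans <| preimage_mono <| Iic_subset_Iic.2 (hpw.le.trans hwq'))
      fun j hj => le_trans hj.1.2 hwq'
  · rintro j (hj | hj) v hv
    · exact .inl (h.reserved j hj hv)
    · exact .inr ⟨hwq'.trans (hlate v hv.1 (hj.1.1.trans_le hv.2.1)).le, hv.2.2.trans hj.2⟩
  · have hends : P.breakEven * O.endsBy p ≤ P.breakEven * O.endsBy q :=
      mul_le_mul_of_nonneg_left (mod_cast Schedule.endsBy_mono (hpw.le.trans hwq'))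
        P.breakEven_nonneg
    have hvol := volume_inter_Iic_add_le (U := O.activeSet ∪ R)
      (U' := O.activeSet ∪ (R ∪ Icc w x)) (union_subset_union_right _ subset_union_left)
      (measure_union_ne_top O.volume_activeSet_ne_top
        (measure_union_ne_top h.finite measure_Icc_lt_top.ne)) hpw.le hwq'
      fun v hv => .inr (.inr ⟨hv.1.le, hv.2.trans hqx.le⟩)
    push_cast
    linarith [h.bound]

theorem volume_union_le (h : PeriodCover P J O n e D R) (hO : O.Feasible J (arriving J (Iic e))) :
    volume.real (O.activeSet ∪ R) ≤ ∑ m, O.onTime m univ := by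
  have hO' : O.Feasible J D := fun j hj => hO j (h.arrived hj)
  calc volume.real (O.activeSet ∪ R) ≤ volume.real R + volume.real (O.activeSet ∩ Rᶜ) := by
        rw [union_comm, ← union_sdiff_self, sdiff_eq]
        exact measureReal_union_le _ _
    _ ≤ ∑ m, O.onTime m R + ∑ m, O.onTime m Rᶜ := by
        refine add_le_add ?_ (O.volume_activeSet_inter_le _)
        exact h.volume_le.trans <| (hO'.work_le_sum_executed h.measurable h.reserved).trans <|
          Finset.sum_le_sum fun m _ => O.sum_executed_le m h.measurable
    _ = ∑ m, O.onTime m univ := by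
        rw [← Finset.sum_add_distrib]
        exact Finset.sum_congr rfl fun m _ => O.onTime_add_compl m h.measurable

end PeriodCover

theorem Periods.exists_cover (h : Periods P J n e) (hO : O.Feasible J (arriving J (Iic e))) :
    ∃ D R, PeriodCover P J O n e D R := by
  induction h with
  | zero => exact ⟨∅, ∅, .zero⟩
  | @succ n p w q _ hpw hwq htrig ih =>
    have hpq : p + P.breakEven ≤ q := by linarith
    have hp : p ≤ q := by linarith [P.breakEven_nonneg]
    obtain ⟨D, R, hcover⟩ := ih fun j hj => hO j (le_trans hj hp)
    obtain ⟨v, hv, hvpq⟩ | hon | hoff := O.exists_endpoint_or_subset_or_disjoint p q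
    · exact ⟨D, R, hcover.succ_of_endpoint hv hvpq⟩
    · exact ⟨D, R, hcover.succ_of_subset hpq hon⟩
    · exact hcover.succ_of_disjoint hpw hwq htrig hO hoff

theorem Periods.card_le (h : Periods P J n e) (hO : O.Feasible J (arriving J (Iic e))) :
    P.breakEven * n ≤ P.breakEven * O.endsBy e + ∑ m, O.onTime m univ := by
  obtain ⟨D, R, hcover⟩ := h.exists_cover hO
  have hmono : volume.real ((O.activeSet ∪ R) ∩ Iic e) ≤ volume.real (O.activeSet ∪ R) :=
    measureReal_mono inter_subset_left hcover.volume_union_ne_top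
  linarith [hcover.bound, hcover.volume_union_le hO]

end PeriodCover

section Competitiveness

variable {ι : Type*} [Fintype ι] {k : ℕ} {P : PowerModel} {J : ι → Job} {S : Schedule ι 2}
  {σ : ℝ → SysState} {O : Schedule ι k} {s : SysState} {r : ι → ℝ} {n : ℕ} {e t T : ℝ}

theorem PeriodCount.turnOns_le (h : PeriodCount P J e s n) (hp : Phase P J t e r s)
    (hO : O.Feasible J (arriving J (Iic t))) :
    P.breakEven * n ≤ 2 * P.breakEven * ∑ m, (O.on m).card + ∑ m, O.onTime m univ := by
  have hO' : O.Feasible J (arriving J (Iic e)) := fun j hj =>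
    hO j (le_trans hj hp.remainingInvariant.e_le)
  have hcard : ∀ a : ℕ, a ≤ O.endpoints.card →
      P.breakEven * a ≤ 2 * P.breakEven * ∑ m, (O.on m).card := fun a ha => by
    rw [O.card_endpoints] at ha
    have := mul_le_mul_of_nonneg_left (Nat.cast_le (α := ℝ).2 ha) P.breakEven_nonneg
    push_cast at this ⊢
    linarith
  obtain hoff | ⟨hon, -, ht1, htrig⟩ := hp.off_or_on
  · linarith [(h.periods hoff).card_le hO', hcard _ (O.endsBy_le_card e)]
  · obtain ⟨l, rfl, hl⟩ := h.exists_periods hon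
    obtain ⟨j, hj⟩ := htrig.exists_arrival_mem
    obtain ⟨v, hv, hvj⟩ := hO.nonempty_active (j := j) (le_trans hj.2 ht1)
    obtain ⟨x, hx, hvx⟩ := Schedule.exists_endpoint_gt hv
    have hends := hcard _ (Schedule.endsBy_lt_card hx (hj.1.trans_le (hvj.1.trans hvx.le)))
    push_cast at hends ⊢
    linarith [hl.card_le hO']

theorem Schedule.work_executed {k : ℕ} (S : Schedule ι k) (J : ι → Job) (T : ℝ) :
    work (execTimes J - S.remainingAt J T) univ = ∑ m, ∑ j, S.executed m j (Icc 0 T) := by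
  rw [work_univ, Finset.sum_comm]
  exact Finset.sum_congr rfl fun j _ => sub_sub_cancel _ _

namespace IsRun

theorem sum_executed_le (h : IsRun P 1 J S σ) (hJ : EDFCondition J) (hT : 0 ≤ T) :
    ∑ m, ∑ j, S.executed m j (Icc 0 T) ≤ work (execTimes J) (arriving J (Iic T)) := by
  obtain ⟨e, hp, -⟩ := h.invariant hJ hT
  rw [← S.work_executed J, work_univ]
  refine Finset.sum_le_sum fun j _ => ?_
  by_cases hj : j ∈ arriving J (Iic T)
  · rw [indicator_of_mem hj]
    exact sub_le_self _ (h.remaining_nonneg j hT)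
  · rw [indicator_of_notMem hj]
    exact (sub_eq_zero.2 (hp.remainingInvariant.future j (not_le.1 hj).le).symm).le

theorem turnOns_add_onTime_le (h : IsRun P 1 J S σ) (hJ : EDFCondition J) (hT : 0 ≤ T)
    (hO : O.Feasible J (arriving J (Iic T))) :
    ∑ m, (P.breakEven * S.turnOns m T + S.onTime m (Icc 0 T)) ≤
      4 * ∑ m, (P.breakEven * (O.on m).card + O.onTime m univ) := by
  obtain ⟨e, hp, hr⟩ := h.invariant hJ hT
  have hcost := hr.cost
  have hturnOns := hr.periods.turnOns_le hp hO
  have hwork : work (execTimes J) (arriving J (Iic T)) ≤ ∑ m, O.onTime m univ :=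
    (hO.work_le_sum_executed .univ fun _ _ => subset_univ _).trans <|
      Finset.sum_le_sum fun m _ => O.sum_executed_le m .univ
  have hledger := hp.ledger_le
  have hexec := h.sum_executed_le hJ hT
  rw [CostBound, S.work_executed] at hcost
  rw [Nat.cast_sum] at hturnOns
  rw [Finset.sum_add_distrib, Finset.sum_add_distrib, ← Finset.mul_sum, ← Finset.mul_sum,
    Fin.sum_univ_two fun m => (S.turnOns m T : ℝ)]
  linarith

theorem energyUpTo_le (h : IsRun P 1 J S σ) (hJ : EDFCondition J) (hT : 0 ≤ T)
    (hO : O.Feasible J (arriving J (Iic T))) : S.energyUpTo P T ≤ 4 * O.energy P := by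
  have hexec : ∑ m, ∑ j, S.executed m j (Icc 0 T) ≤ 4 * ∑ m, ∑ j, O.executed m j univ := by
    have hdone := (h.sum_executed_le hJ hT).trans <|
      hO.work_le_sum_executed .univ fun _ _ => subset_univ _
    have hnonneg : 0 ≤ ∑ m, ∑ j, O.executed m j univ :=
      Finset.sum_nonneg fun m _ => Finset.sum_nonneg fun j _ => O.executed_nonneg m j .univ
    linarith
  calc S.energyUpTo P T
      = P.standby * (∑ m, (P.breakEven * S.turnOns m T + S.onTime m (Icc 0 T))) +
          (P.busy - P.standby) * ∑ m, ∑ j, S.executed m j (Icc 0 T) := S.energyUpTo_eq P T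
    _ ≤ P.standby * (4 * ∑ m, (P.breakEven * (O.on m).card + O.onTime m univ)) +
          (P.busy - P.standby) * (4 * ∑ m, ∑ j, O.executed m j univ) :=
        add_le_add
          (mul_le_mul_of_nonneg_left (h.turnOns_add_onTime_le hJ hT hO) P.standby_pos.le)
          (mul_le_mul_of_nonneg_left hexec (sub_nonneg.2 P.standby_le_busy))
    _ = 4 * O.energy P := by rw [O.energy_eq]; ring

theorem isCompetitive (h : IsRun P 1 J S σ) (hJ : EDFCondition J) : IsCompetitive 4 P J S := by
  refine ⟨fun T hT n O hO => h.energyUpTo_le hJ hT hO, fun n O hO => ?_⟩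
  obtain ⟨T, hT, hS⟩ := S.exists_energyUpTo_eq P
  exact hS ▸ h.energyUpTo_le hJ hT fun j _ => hO j trivial

end IsRun

end Competitiveness

section SeparatedCover

/-- From time `T` on, the set `A` of times is the union of the finitely many intervals `[ℓ, r)` that
are stored in `F`; they are nonempty and separated, and do not start before `T`. -/
structure SeparatedCover (T : ℝ) (A : Set ℝ) (F : Finset (ℝ × ℝ)) : Prop where
  le_start : ∀ I ∈ F, T ≤ I.1
  lt : ∀ I ∈ F, I.1 < I.2
  separated : ∀ I ∈ F, ∀ I' ∈ F, I ≠ I' → I.2 < I'.1 ∨ I'.2 < I.1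
  mem_iff : ∀ t, T ≤ t → (t ∈ A ↔ ∃ I ∈ F, t ∈ Ico I.1 I.2)

namespace SeparatedCover

variable {T T' : ℝ} {A A' : Set ℝ} {F : Finset (ℝ × ℝ)} {I : ℝ × ℝ}

theorem congr (h : SeparatedCover T A F) (hA : ∀ t, T ≤ t → (t ∈ A' ↔ t ∈ A)) :
    SeparatedCover T A' F :=
  ⟨h.le_start, h.lt, h.separated, fun t ht => (hA t ht).trans (h.mem_iff t ht)⟩

theorem Ico_subset (h : SeparatedCover T A F) (hI : I ∈ F) : Ico I.1 I.2 ⊆ A :=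
  fun t ht => (h.mem_iff t ((h.le_start I hI).trans ht.1)).2 ⟨I, hI, ht⟩

theorem lt_start (h : SeparatedCover T A F) (hT : T ∉ A) (hI : I ∈ F) : T < I.1 :=
  (h.le_start I hI).lt_of_ne fun heq => hT (h.Ico_subset hI ⟨heq.ge, heq ▸ h.lt I hI⟩)

theorem of_disjoint (h : SeparatedCover T' A F) (hT : T ≤ T') (hA : Disjoint (Ico T T') A) :
    SeparatedCover T A F where
  le_start I hI := hT.trans (h.le_start I hI)
  lt := h.lt
  separated := h.separated
  mem_iff t ht := by
    obtain htT' | htT' := lt_or_ge t T'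
    · refine iff_of_false (disjoint_left.1 hA ⟨ht, htT'⟩) fun ⟨I, hI, htI⟩ => ?_
      exact ((h.le_start I hI).trans htI.1).not_gt htT'
    · exact h.mem_iff t htT'

theorem cons (h : SeparatedCover T' A F) (hT' : T' ∉ A) (hT : T < T') (hA : Ico T T' ⊆ A) :
    SeparatedCover T A (insert (T, T') F) where
  le_start := Finset.forall_mem_insert _ _ _ |>.2
    ⟨le_rfl, fun I hI => hT.le.trans (h.le_start I hI)⟩
  lt := Finset.forall_mem_insert _ _ _ |>.2 ⟨hT, h.lt⟩
  separated I hI I' hI' hne := by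
    obtain rfl | hIF := Finset.mem_insert.1 hI <;> obtain rfl | hIF' := Finset.mem_insert.1 hI'
    · exact absurd rfl hne
    · exact .inl (h.lt_start hT' hIF')
    · exact .inr (h.lt_start hT' hIF)
    · exact h.separated I hIF I' hIF' hne
  mem_iff t ht := by
    rw [Finset.exists_mem_insert]
    obtain htT' | htT' := lt_or_ge t T'
    · exact iff_of_true (hA ⟨ht, htT'⟩) (.inl ⟨ht, htT'⟩)
    · rw [h.mem_iff t htT', or_iff_right fun hmem : t ∈ Ico T T' => hmem.2.not_ge htT']

theorem exists_start_eq (h : SeparatedCover T A F) (hT : T ∈ A) : ∃ I ∈ F, I.1 = T :=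
  let ⟨I, hI, hTI⟩ := (h.mem_iff T le_rfl).1 hT
  ⟨I, hI, hTI.1.antisymm (h.le_start I hI)⟩

theorem lt_start_of_ne (h : SeparatedCover T A F) (hI : I ∈ F) (hIT : I.1 = T) {I' : ℝ × ℝ}
    (hI' : I' ∈ F) (hne : I' ≠ I) : I.2 < I'.1 :=
  (h.separated I hI I' hI' hne.symm).resolve_right fun hlt =>
    ((h.le_start I' hI').trans_lt (h.lt I' hI')).not_gt (hlt.trans_eq hIT)

theorem erase (h : SeparatedCover T A F) (hI : I ∈ F) (hIT : I.1 = T) :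
    SeparatedCover I.2 A (F.erase I) where
  le_start I' hI' :=
    (h.lt_start_of_ne hI hIT (Finset.mem_of_mem_erase hI') (Finset.ne_of_mem_erase hI')).le
  lt I' hI' := h.lt I' (Finset.mem_of_mem_erase hI')
  separated I' hI' I'' hI'' :=
    h.separated I' (Finset.mem_of_mem_erase hI') I'' (Finset.mem_of_mem_erase hI'')
  mem_iff t ht := by
    rw [h.mem_iff t (hIT.ge.trans ((h.lt I hI).le.trans ht))]
    refine exists_congr fun I' => and_congr_left fun htI' => ?_
    refine (Finset.mem_erase.trans (and_iff_right ?_)).symm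
    rintro rfl
    exact htI'.2.not_ge ht

theorem end_notMem (h : SeparatedCover T A F) (hI : I ∈ F) (hIT : I.1 = T) : I.2 ∉ A := by
  rw [(h.erase hI hIT).mem_iff I.2 le_rfl]
  rintro ⟨I', hI', hmem⟩
  exact hmem.1.not_gt
    (h.lt_start_of_ne hI hIT (Finset.mem_of_mem_erase hI') (Finset.ne_of_mem_erase hI'))

theorem exists_of_subset (h : SeparatedCover T' A F) (hT : T < T') (hA : Ico T T' ⊆ A) :
    ∃ F', SeparatedCover T A F' := by
  by_cases hT' : T' ∈ A
  · obtain ⟨I, hI, hIT⟩ := h.exists_start_eq hT'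
    have hlt : T' < I.2 := hIT ▸ h.lt I hI
    refine ⟨_, (h.erase hI hIT).cons (h.end_notMem hI hIT) (hT.trans hlt) ?_⟩
    rw [← Ico_union_Ico_eq_Ico hT.le hlt.le]
    exact union_subset hA (hIT ▸ h.Ico_subset hI)
  · exact ⟨_, h.cons hT' hT hA⟩

end SeparatedCover

end SeparatedCover

section Continuation

variable {ι : Type*}

/-- The remaining execution times at time `t` of a system that has remaining execution times `r` at
time `T` and executes the jobs `job m` on processor `m` from then on. -/
def remainingFrom (T : ℝ) (r : ι → ℝ) (job : Fin 2 → ℝ → Option ι) (t : ℝ) (j : ι) : ℝ :=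
  r j - ∑ m, volume.real (Icc T t ∩ {v | job m v = some j})

open Classical in
/-- The remaining execution times after each processor `m` has executed the job `jm m`, if any, for
`δ` units of time. -/
def advance (r : ι → ℝ) (jm : Fin 2 → Option ι) (δ : ℝ) (j : ι) : ℝ :=
  r j - ∑ m, if jm m = some j then δ else 0

variable {T T' t : ℝ} {r : ι → ℝ} {job job' : Fin 2 → ℝ → Option ι} {jm : Fin 2 → Option ι}

theorem remainingFrom_self (T : ℝ) (r : ι → ℝ) (job : Fin 2 → ℝ → Option ι) :
    remainingFrom T r job T = r := by
  funext j
  refine (congrArg _ (Finset.sum_eq_zero fun m _ => ?_)).trans (sub_zero _)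
  rw [Icc_self, measureReal_def, measure_mono_null inter_subset_left (measure_singleton T),
    ENNReal.toReal_zero]

theorem remainingFrom_congr (h : ∀ m, EqOn (job' m) (job m) (Ici T)) :
    remainingFrom T r job' t = remainingFrom T r job t := by
  funext j
  refine congrArg _ (Finset.sum_congr rfl fun m _ => congrArg _ (Set.ext fun v => ?_))
  exact and_congr_right fun hv => by rw [mem_ofPred_eq, mem_ofPred_eq, h m hv.1]

theorem remainingFrom_eq_advance (ht : T ≤ t) (h : ∀ m, ∀ v ∈ Ico T t, job m v = jm m) :
    remainingFrom T r job t = advance r jm (t - T) := by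
  funext j
  refine congrArg _ (Finset.sum_congr rfl fun m _ => ?_)
  have hpiece : Ico T t ∩ {v | job m v = some j} = Ico T t ∩ {_v | jm m = some j} :=
    Set.ext fun v => and_congr_right fun hv => by rw [mem_ofPred_eq, mem_ofPred_eq, h m v hv]
  have hae : volume.real (Ico T t ∩ {v | job m v = some j}) =
      volume.real (Icc T t ∩ {v | job m v = some j}) :=
    measureReal_congr (ae_eq_set_inter Ico_ae_eq_Icc (ae_eq_refl _))
  rw [← hae, hpiece]
  split_ifs with hj
  · simp [hj, ht]
  · simp [hj]

theorem remainingFrom_trans (hT : T ≤ T') (ht : T' ≤ t)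
    (hjob : ∀ m x, MeasurableSet {v | job m v = x}) :
    remainingFrom T r job t = remainingFrom T' (remainingFrom T r job T') job t := by
  funext j
  simp only [remainingFrom, sub_sub, ← Finset.sum_add_distrib]
  refine congrArg _ (Finset.sum_congr rfl fun m _ => ?_)
  rw [← sub_eq_iff_eq_add', volume_Icc_inter_sub (hjob m _) hT ht]
  exact measureReal_congr (ae_eq_set_inter Ioo_ae_eq_Icc (ae_eq_refl _))

variable [Fintype ι]

/-- The algorithm can be run from time `T` on, starting in state `s` with the remaining execution
times `r`: its state at time `t` is `σ t`, and the jobs `job m t` occupy the processors. -/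
structure Continuation (P : PowerModel) (J : ι → Job) (T : ℝ) (s : SysState) (r : ι → ℝ)
    (σ : ℝ → SysState) (job : Fin 2 → ℝ → Option ι) : Prop where
  start : σ T = s
  measurable : ∀ m x, MeasurableSet {v | job m v = x}
  nonneg : ∀ t, T ≤ t → ∀ j, 0 ≤ remainingFrom T r job t j
  step : ∀ t, T < t → ∃ s', (∀ᶠ u in 𝓝[<] t, σ u = s') ∧
    σ t = s'.updateAt P J (remainingFrom T r job t) t
  right : ∀ t, T ≤ t → ∀ᶠ u in 𝓝[>] t, σ u = σ t
  cover : ∀ m, ∃ F, SeparatedCover T {t | (σ t).on m = true} F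
  edf : ∀ t, T ≤ t → ∀ m,
    EDFChoice J ((σ t).eligible J (openJobs J (remainingFrom T r job t) t) m) (job m t)

namespace Continuation

variable {P : PowerModel} {J : ι → Job} {s : SysState} {σ σ' : ℝ → SysState}

theorem congr (h : Continuation P J T s r σ job) (hσ : EqOn σ' σ (Ici T))
    (hjob : ∀ m, EqOn (job' m) (job m) (Ici T)) (hmeas : ∀ m x, MeasurableSet {v | job' m v = x}) :
    Continuation P J T s r σ' job' where
  start := (hσ (mem_Ici.2 le_rfl)).trans h.start
  measurable := hmeas
  nonneg := fun t ht j => by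
    rw [remainingFrom_congr hjob]
    exact h.nonneg t ht j
  step := fun t ht => by
    obtain ⟨s', hs', hupdate⟩ := h.step t ht
    rw [remainingFrom_congr hjob, hσ (mem_Ici.2 ht.le)]
    refine ⟨s', ?_, hupdate⟩
    filter_upwards [hs', Ioo_mem_nhdsLT ht] with u hu hmem
    exact (hσ (mem_Ici.2 hmem.1.le)).trans hu
  right := fun t ht => by
    filter_upwards [h.right t ht, self_mem_nhdsWithin] with u hu hmem
    rw [hσ (mem_Ici.2 (ht.trans (le_of_lt hmem))), hσ (mem_Ici.2 ht), hu]
  cover := fun m => (h.cover m).imp fun F hF => hF.congr fun t ht => by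
    rw [mem_ofPred_eq, mem_ofPred_eq, hσ (mem_Ici.2 ht)]
  edf := fun t ht m => by
    rw [remainingFrom_congr hjob, hσ (mem_Ici.2 ht), hjob m (mem_Ici.2 ht)]
    exact h.edf t ht m

theorem step_of_const {v : ℝ} (hTv : T < v) (hσ : ∀ u ∈ Ico T v, σ u = s)
    (hv : σ v = s.updateAt P J r v) :
    ∃ s', (∀ᶠ u in 𝓝[<] v, σ u = s') ∧ σ v = s'.updateAt P J r v :=
  ⟨s, mem_of_superset (Ioo_mem_nhdsLT hTv) fun u hu => hσ u ⟨hu.1.le, hu.2⟩, hv⟩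

theorem exists_cover_of_const (hT : T < T') {m : Fin 2}
    (h : ∃ F, SeparatedCover T' {t | (σ t).on m = true} F) (hσ : ∀ v ∈ Ico T T', σ v = s) :
    ∃ F, SeparatedCover T {t | (σ t).on m = true} F := by
  obtain ⟨F, hF⟩ := h
  cases hm : s.on m with
  | true => exact hF.exists_of_subset hT fun v hv => by rw [mem_ofPred_eq, hσ v hv, hm]
  | false =>
    exact ⟨F, hF.of_disjoint hT.le <| disjoint_left.2 fun v hv => by simp [hσ v hv, hm]⟩

theorem prepend (hT : T < T')
    (h : Continuation P J T' (s.updateAt P J (advance r jm (T' - T)) T') (advance r jm (T' - T))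
      σ job)
    (hσ : ∀ v ∈ Ico T T', σ v = s) (hjob : ∀ m, ∀ v ∈ Ico T T', job m v = jm m)
    (hnonneg : ∀ v ∈ Ico T T', ∀ j, 0 ≤ advance r jm (v - T) j)
    (hfix : ∀ v ∈ Ioo T T', s.updateAt P J (advance r jm (v - T)) v = s)
    (hedf : ∀ v ∈ Ico T T', ∀ m,
      EDFChoice J (s.eligible J (openJobs J (advance r jm (v - T)) v) m) (jm m)) :
    Continuation P J T s r σ job := by
  have hadvance (v : ℝ) (hv : v ∈ Icc T T') :
      remainingFrom T r job v = advance r jm (v - T) :=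
    remainingFrom_eq_advance hv.1 fun m u hu => hjob m u ⟨hu.1, hu.2.trans_le hv.2⟩
  have hlater (v : ℝ) (hv : T' ≤ v) :
      remainingFrom T r job v = remainingFrom T' (advance r jm (T' - T)) job v := by
    rw [remainingFrom_trans hT.le hv h.measurable, hadvance T' ⟨hT.le, le_rfl⟩]
  refine ⟨hσ T ⟨le_rfl, hT⟩, h.measurable, fun v hv j => ?_, fun v hv => ?_, fun v hv => ?_,
    fun m => exists_cover_of_const hT (h.cover m) hσ, fun v hv m => ?_⟩
  · obtain hvT' | hvT' := lt_or_ge v T'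
    · exact hadvance v ⟨hv, hvT'.le⟩ ▸ hnonneg v ⟨hv, hvT'⟩ j
    · exact hlater v hvT' ▸ h.nonneg v hvT' j
  · obtain hvT' | rfl | hvT' := lt_trichotomy v T'
    · rw [hadvance v ⟨hv.le, hvT'.le⟩]
      exact step_of_const hv (fun u hu => hσ u ⟨hu.1, hu.2.trans hvT'⟩)
        ((hσ v ⟨hv.le, hvT'⟩).trans (hfix v ⟨hv, hvT'⟩).symm)
    · rw [hadvance v ⟨hv.le, le_rfl⟩]
      exact step_of_const hv hσ h.start
    · rw [hlater v hvT'.le]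
      exact h.step v hvT'
  · obtain hvT' | hvT' := lt_or_ge v T'
    · filter_upwards [Ioo_mem_nhdsGT hvT'] with u hu
      rw [hσ u ⟨hv.trans hu.1.le, hu.2⟩, hσ v ⟨hv, hvT'⟩]
    · exact h.right v hvT'
  · obtain hvT' | hvT' := lt_or_ge v T'
    · rw [hadvance v ⟨hv, hvT'.le⟩, hσ v ⟨hv, hvT'⟩, hjob m v ⟨hv, hvT'⟩]
      exact hedf v ⟨hv, hvT'⟩ m
    · exact hlater v hvT' ▸ h.edf v hvT' m

theorem exists_eq_on_Ico (h : Continuation P J T' s r σ job) (T : ℝ) (s' : SysState)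
    (jm : Fin 2 → Option ι) : ∃ σ' job', Continuation P J T' s r σ' job' ∧
      (∀ v ∈ Ico T T', σ' v = s') ∧ ∀ m, ∀ v ∈ Ico T T', job' m v = jm m := by
  classical
  refine ⟨(Ici T').piecewise σ fun _ => s', fun m => (Ici T').piecewise (job m) fun _ => jm m,
    h.congr (piecewise_eqOn _ _ _) (fun m => piecewise_eqOn _ _ _) fun m x => ?_,
    fun v hv => piecewise_eq_of_notMem _ _ _ hv.2.not_ge,
    fun m v hv => piecewise_eq_of_notMem _ _ _ hv.2.not_ge⟩
  change MeasurableSet ((Ici T').piecewise (job m) (fun _ => jm m) ⁻¹' {x})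
  rw [piecewise_preimage]
  exact measurableSet_Ici.ite (h.measurable m x) (MeasurableSet.const _)

end Continuation

theorem exists_continuation_of_isOff {P : PowerModel} {J : ι → Job} {s : SysState} (hoff : s.IsOff)
    (hr : ∀ j, 0 ≤ r j) (hfix : ∀ v, T < v → s.updateAt P J r v = s) :
    ∃ σ job, Continuation P J T s r σ job := by
  have hconst : remainingFrom T r (fun _ _ => none) = fun _ => r := by
    funext v j
    simp [remainingFrom]
  refine ⟨fun _ => s, fun _ _ => none, rfl, fun _ _ => MeasurableSet.const _, fun t _ => ?_,
    fun t ht => ⟨s, by simp, ?_⟩, fun t _ => by simp,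
    fun m => ⟨∅, by simp, by simp, by simp, fun t _ => by simp [hoff m]⟩, fun t _ m => ?_⟩
  · rwa [hconst]
  · rw [hconst, hfix t ht]
  · exact eq_empty_of_forall_notMem fun j hj => by simpa [hoff m] using hj.2.1

theorem Continuation.exists_isRun {P : PowerModel} {J : ι → Job} {σ : ℝ → SysState}
    (h : Continuation P J 0 (SysState.initial.updateAt P J (execTimes J) 0) (execTimes J) σ job) :
    ∃ S : Schedule ι 2, IsRun P 1 J S σ := by
  choose F hF using h.cover
  set S : Schedule ι 2 := ⟨F, job, fun m => (hF m).le_start, fun m => (hF m).lt,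
    fun m => (hF m).separated, h.measurable⟩
  have hremaining (t : ℝ) : S.remainingAt J t = remainingFrom 0 (execTimes J) job t := by
    funext j
    refine congrArg _ (Finset.sum_congr rfl fun m _ => ?_)
    rw [S.executed_eq_volume m j measurableSet_Icc, inter_eq_right.2]
    · rfl
    · intro v ⟨hv, hvj⟩
      have hedf := h.edf v hv.1 m
      rw [show job m v = some j from hvj] at hedf
      exact (S.mem_onSet m).2 (((hF m).mem_iff v hv.1).1 hedf.1.2.1)
  have hqueue (t : ℝ) : S.queue J t = openJobs J (remainingFrom 0 (execTimes J) job t) t := by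
    rw [← hremaining]
    rfl
  have hworkload (t : ℝ) (ht : 0 ≤ t) :
      S.workload J t = workDue J (remainingFrom 0 (execTimes J) job t) (Iic t) := by
    rw [← hremaining, S.workload_eq]
    exact fun j => (h.nonneg t ht j).trans_eq (congrFun (hremaining t) j).symm
  refine ⟨S, ?_, fun t ht => ?_, h.right, fun t ht m => (hF m).mem_iff t ht, fun t ht m => ?_⟩
  · rw [hqueue, hworkload 0 le_rfl, remainingFrom_self]
    exact h.start
  · rw [hqueue, hworkload t ht.le]
    exact h.step t ht
  · rw [hqueue]
    exact h.edf t ht m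

end Continuation

section Selection

variable {ι : Type*} {J : ι → Job} {T x δ : ℝ} {s : SysState} {r : ι → ℝ} {jm : Fin 2 → Option ι}
  {m : Fin 2} {j : ι}

/-- The jobs `jm m` occupy the processors by rule (B) when the algorithm is in state `s` at time `T`
and the remaining execution times are `r`. -/
def EDFSelection (J : ι → Job) (T : ℝ) (s : SysState) (r : ι → ℝ) (jm : Fin 2 → Option ι) : Prop :=
  ∀ m, EDFChoice J (s.eligible J (openJobs J r T) m) (jm m)

theorem SysState.exists_eligible_of_calm (hcalm : s.urgent = false) (hon : ¬ s.IsOff) {Q : Set ι}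
    (hQ : Q.Nonempty) : ∃ m, (s.eligible J Q m).Nonempty := by
  obtain ⟨m, hm⟩ := not_forall.1 hon
  obtain ⟨j, hj⟩ := hQ
  exact ⟨m, j, hj, by simpa using hm, fun hu => by simp [hcalm] at hu⟩

theorem exists_EDFChoice [Finite ι] (J : ι → Job) (A : Set ι) : ∃ o, EDFChoice J A o := by
  obtain rfl | hA := A.eq_empty_or_nonempty
  · exact ⟨none, rfl⟩
  · obtain ⟨i, hi, hmin⟩ := A.exists_min_image (fun i => (J i).deadline) A.toFinite hA
    exact ⟨some i, hi, hmin⟩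

namespace EDFSelection

theorem mem_eligible (h : EDFSelection J T s r jm) (hj : jm m = some j) :
    j ∈ s.eligible J (openJobs J r T) m := by
  have hm := h m
  rw [hj] at hm
  exact hm.1

theorem exists_eq_some (h : EDFSelection J T s r jm) (hj : j ∈ s.eligible J (openJobs J r T) m) :
    ∃ i, jm m = some i ∧ (J i).deadline ≤ (J j).deadline := by
  have hm := h m
  cases hi : jm m with
  | none =>
    rw [hi] at hm
    exact absurd hj (eq_empty_iff_forall_notMem.1 hm j)
  | some i =>
    rw [hi] at hm
    exact ⟨i, rfl, hm.2 j hj⟩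

theorem advance_of_isOff (h : EDFSelection J T s r jm) (hoff : s.IsOff) : advance r jm δ = r := by
  funext j
  refine (congrArg _ (Finset.sum_eq_zero fun m _ => if_neg fun hj => ?_)).trans (sub_zero _)
  simpa [hoff m] using (h.mem_eligible hj).2.1

theorem advance_eq_sub (h : EDFSelection J T s r jm) (hc : s.Coherent) (hj : jm m = some j) :
    advance r jm δ j = r j - δ := by
  have hmem := h.mem_eligible hj
  classical
  have hsum : ∑ m', (if jm m' = some j then δ else 0) = δ := by
    refine (Finset.sum_eq_single m (fun m' _ hne => if_neg fun hj' => hne ?_)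
      fun hm => absurd (Finset.mem_univ m) hm).trans (if_pos hj)
    have hmem' := h.mem_eligible hj'
    exact hc.eq_of_mem_window hmem'.2.1 hmem.2.1 hmem'.2.2 hmem.2.2
  rw [advance, hsum]

end EDFSelection

theorem advance_of_ne (h : ∀ m, jm m ≠ some j) : advance r jm δ j = r j := by
  simp [advance, h]

theorem advance_le (hδ : 0 ≤ δ) (j : ι) : advance r jm δ j ≤ r j :=
  sub_le_self _ <| Finset.sum_nonneg fun m _ => by split_ifs <;> [exact hδ; exact le_rfl]

namespace EDFSelection

theorem advance_cases (h : EDFSelection J T s r jm) (hc : s.Coherent) (δ : ℝ) (j : ι) :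
    advance r jm δ j = r j ∨ ∃ m, jm m = some j ∧ advance r jm δ j = r j - δ := by
  by_cases hj : ∃ m, jm m = some j
  · obtain ⟨m, hm⟩ := hj
    exact .inr ⟨m, hm, h.advance_eq_sub hc hm⟩
  · exact .inl (advance_of_ne (not_exists.1 hj))

variable [Fintype ι]

theorem workDue_advance_of_eq_some (h : EDFSelection J T s r jm) (hc : s.Coherent)
    (hj : jm m = some j) (hjx : (J j).deadline ≤ x) :
    workDue J (advance r jm δ) (Iic T ∩ s.window m) x = workDue J r (Iic T ∩ s.window m) x - δ := by
  have hmem := h.mem_eligible hj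
  rw [eq_sub_iff_add_eq, ← eq_sub_iff_add_eq', workDue, workDue, ← work_sub]
  rw [work, Finset.sum_eq_single j, indicator_of_mem, Pi.sub_apply, h.advance_eq_sub hc hj,
    sub_sub_cancel]
  · exact ⟨⟨hmem.1.1, hmem.2.2⟩, hjx⟩
  · intro i _ hij
    refine indicator_apply_eq_zero.2 fun hi => sub_eq_zero.2 (advance_of_ne fun m' hm' => ?_).symm
    have hmem' := h.mem_eligible hm'
    obtain rfl := hc.eq_of_mem_window hmem'.2.1 hmem.2.1 hmem'.2.2 hi.1.2
    exact hij (Option.some_injective _ (hm'.symm.trans hj))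
  · simp

theorem workDue_advance (h : EDFSelection J T s r jm) (hc : s.Coherent) (hr : ∀ j, 0 ≤ r j)
    (hδ : 0 ≤ δ) (hcompletion : ∀ m j, jm m = some j → δ ≤ r j) (hm : s.on m = true) (x : ℝ) :
    workDue J (advance r jm δ) (Iic T ∩ s.window m) x =
      max 0 (workDue J r (Iic T ∩ s.window m) x - δ) := by
  by_cases hpos : ∃ j, (j ∈ arriving J (Iic T ∩ s.window m) ∩ dueBy J x) ∧ 0 < r j
  · obtain ⟨j, ⟨hj, hjx⟩, hrj⟩ := hpos
    obtain ⟨i, hi, hij⟩ := h.exists_eq_some (j := j) ⟨⟨hj.1, hrj⟩, hm, hj.2⟩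
    have hmem := h.mem_eligible hi
    have hix : (J i).deadline ≤ x := hij.trans hjx
    have hle : r i ≤ workDue J r (Iic T ∩ s.window m) x := le_work hr ⟨⟨hmem.1.1, hmem.2.2⟩, hix⟩
    rw [h.workDue_advance_of_eq_some hc hi hix,
      max_eq_right (sub_nonneg.2 ((hcompletion m i hi).trans hle))]
  · have hzero : ∀ j ∈ arriving J (Iic T ∩ s.window m) ∩ dueBy J x, r j = 0 := fun j hj =>
      (not_lt.1 fun hrj => hpos ⟨j, hj, hrj⟩).antisymm (hr j)
    have hzero' : workDue J (advance r jm δ) (Iic T ∩ s.window m) x = 0 :=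
      work_eq_zero fun j hj => (advance_of_ne fun m' hm' =>
        (h.mem_eligible hm').1.2.ne' (hzero j hj)).trans (hzero j hj)
    have hdue : workDue J r (Iic T ∩ s.window m) x = 0 := work_eq_zero hzero
    rw [hzero', hdue, zero_sub, max_eq_left (neg_nonpos.2 hδ)]

end EDFSelection

end Selection

section Phases

variable {ι : Type*} [Fintype ι] {P : PowerModel} {J : ι → Job} {s : SysState} {t e x : ℝ}
  {r : ι → ℝ}

theorem exists_workDue_eq_deadline (hr : ∀ j, 0 ≤ r j) (h : 0 < workDue J r (Iic t) x) :
    ∃ j ∈ openJobs J r t, (J j).deadline ≤ x ∧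
      workDue J r (Iic t) (J j).deadline = workDue J r (Iic t) x := by
  have hne : (openJobs J r t ∩ dueBy J x).Nonempty :=
    let ⟨j, hj, hrj⟩ := exists_pos_of_work_pos h
    ⟨j, ⟨hj.1, hrj⟩, hj.2⟩
  obtain ⟨j, hj, hmax⟩ := (openJobs J r t ∩ dueBy J x).exists_max_image
    (fun j => (J j).deadline) (toFinite _) hne
  refine ⟨j, hj.1, hj.2, ?_⟩
  rw [← workDue_openJobs hr, ← workDue_openJobs hr]
  refine congrArg _ (Subset.antisymm (fun i hi => ?_) fun i hi => ⟨hi.1, hmax i hi⟩)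
  have hix : (J i).deadline ≤ x := le_trans hi.2 hj.2
  exact ⟨hi.1, hix⟩

namespace Phase

theorem updateAt_eq (h : Phase P J t e r s) (hJ : EDFCondition J) : s.updateAt P J r t = s := by
  obtain h | h | h | h := h
  · exact h.updateAt_eq
  · exact h.updateAt_eq
  · exact h.updateAt_eq
  · exact h.updateAt_eq hJ

theorem offPhase (h : Phase P J t e r s) (hoff : s.IsOff) : OffPhase P J t e r s := by
  obtain h | h | h | h := h
  · exact h
  · exact absurd hoff (SysState.not_isOff_of_on h.on0)
  · exact absurd hoff (SysState.not_isOff_of_on h.on0)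
  · exact absurd hoff (SysState.not_isOff_of_on h.on1)

theorem awake (h : Phase P J t e r s) (hon : ¬ s.IsOff) :
    (openJobs J r t).Nonempty ∨ t < s.t1 + P.breakEven := by
  obtain h | h | h | h := h
  · exact absurd h.off hon
  · exact h.awake
  · exact .inl (h.busy.imp fun _ hj => hj.1)
  · exact h.awake

theorem eligible_zero_nonempty (h : Phase P J t e r s) (hu : s.urgent = true) :
    (s.eligible J (openJobs J r t) 0).Nonempty := by
  obtain h | h | h | h := h
  · simp [h.calm] at hu
  · simp [h.calm] at hu
  · obtain ⟨j, hj, hlt⟩ := h.busy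
    exact ⟨j, hj, h.on0, fun _ => by simpa using hlt⟩
  · simp [h.calm] at hu

theorem exists_eligible (h : Phase P J t e r s) (hon : ¬ s.IsOff)
    (hQ : (openJobs J r t).Nonempty) : ∃ m, (s.eligible J (openJobs J r t) m).Nonempty := by
  cases hu : s.urgent with
  | false => exact SysState.exists_eligible_of_calm hu hon hQ
  | true => exact ⟨0, h.eligible_zero_nonempty hu⟩

end Phase

end Phases

section Uneventful

variable {ι : Type*} [Fintype ι] {P : PowerModel} {J : ι → Job} {T t v e : ℝ} {s : SysState}
  {r : ι → ℝ} {jm : Fin 2 → Option ι}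

/-- If processor `m` executes the job `jm m` from time `T` on, then nothing happens strictly between
the times `T` and `t` that could make the algorithm change its state, or select other jobs. -/
structure Uneventful (P : PowerModel) (J : ι → Job) (T : ℝ) (s : SysState) (r : ι → ℝ)
    (jm : Fin 2 → Option ι) (t : ℝ) : Prop where
  lt : T < t
  quiet : ∀ j, (J j).arrival ≤ T ∨ t ≤ (J j).arrival
  completion : ∀ m j, jm m = some j → t - T ≤ r j
  stay_off : s.IsOff → (∀ j ∈ openJobs J r T, t ≤ anchor P 1 (J j)) ∧
    ∀ x, t ≤ x → workDue J r (Iic T) x ≤ x - t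
  standby : ¬ s.IsOff → openJobs J r T = ∅ → t ≤ s.t1 + P.breakEven

namespace Uneventful

theorem workDue_le (h : Uneventful P J T s r jm t) (hr : ∀ j, 0 ≤ r j) (hoff : s.IsOff) (x : ℝ) :
    workDue J r (Iic T) x ≤ max 0 (x - t) := by
  obtain htx | hxt := le_total t x
  · exact ((h.stay_off hoff).2 x htx).trans (le_max_right _ _)
  · have hmono : workDue J r (Iic T) x ≤ workDue J r (Iic T) t :=
      work_mono_set hr (inter_subset_inter_right _ fun j hj => le_trans hj hxt)
    have hzero : workDue J r (Iic T) t ≤ t - t := (h.stay_off hoff).2 t le_rfl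
    exact (hmono.trans (hzero.trans_eq (sub_self t))).trans (le_max_left _ _)

theorem mono (h : Uneventful P J T s r jm t) (hr : ∀ j, 0 ≤ r j) (hv : v ∈ Ioo T t) :
    Uneventful P J T s r jm v where
  lt := hv.1
  quiet j := (h.quiet j).imp_right hv.2.le.trans
  completion m j hj := (sub_le_sub_right hv.2.le T).trans (h.completion m j hj)
  stay_off hoff := ⟨fun j hj => hv.2.le.trans ((h.stay_off hoff).1 j hj), fun x hx =>
    (h.workDue_le hr hoff x).trans (max_le (sub_nonneg.2 hx) (sub_le_sub_left hv.2.le x))⟩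
  standby hon hQ := hv.2.le.trans (h.standby hon hQ)

theorem advance_nonneg (h : Uneventful P J T s r jm t) (hs : EDFSelection J T s r jm)
    (hc : s.Coherent) (hr : ∀ j, 0 ≤ r j) (hv : v ≤ t) (j : ι) : 0 ≤ advance r jm (v - T) j := by
  obtain hj | ⟨m, hm, hj⟩ := hs.advance_cases hc (v - T) j
  · exact (hr j).trans_eq hj.symm
  · have hle := h.completion m j hm
    linarith

theorem openJobs_eq (h : Uneventful P J T s r jm t) (hs : EDFSelection J T s r jm)
    (hc : s.Coherent) (hv : v ∈ Ico T t) :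
    openJobs J (advance r jm (v - T)) v = openJobs J r T := by
  have harr (j : ι) : (J j).arrival ≤ v ↔ (J j).arrival ≤ T :=
    ⟨fun hj => (h.quiet j).resolve_right (hj.trans_lt hv.2).not_ge, fun hj => hj.trans hv.1⟩
  refine Set.ext fun j => and_congr (harr j) ?_
  obtain hj | ⟨m, hm, hj⟩ := hs.advance_cases hc (v - T) j
  · rw [hj]
  · have hle := h.completion m j hm
    have hlt := hv.2
    have hge := hv.1
    constructor <;> intro _ <;> linarith

theorem segment (h : Uneventful P J T s r jm t) (hs : EDFSelection J T s r jm)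
    (hp : Phase P J T e r s) : Segment P J s T r t (advance r jm (t - T)) := by
  have hr := hp.remainingInvariant.nonneg
  have hδ : 0 ≤ t - T := (sub_pos.2 h.lt).le
  refine ⟨h.lt, h.quiet, h.advance_nonneg hs hp.coherent hr le_rfl, advance_le hδ, fun j hj => ?_,
    hs.advance_of_isOff, fun m hm => hs.workDue_advance hp.coherent hr hδ h.completion hm,
    h.stay_off, fun hcalm hon hlt => ?_, fun hu => ?_⟩
  · exact advance_of_ne fun m hm => ((hs.mem_eligible hm).1.1.trans_lt h.lt).not_ge hj
  · refine h.standby hon (not_nonempty_iff_eq_empty.1 fun hQ => hlt.not_ge ?_)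
    obtain ⟨m, j, hj⟩ := s.exists_eligible_of_calm (J := J) hcalm hon hQ
    obtain ⟨i, hi, -⟩ := hs.exists_eq_some hj
    exact (h.completion m i hi).trans (le_work hr (hs.mem_eligible hi).1.1)
  · obtain ⟨j, hj⟩ := hp.eligible_zero_nonempty hu
    obtain ⟨i, hi, -⟩ := hs.exists_eq_some hj
    have hmem := hs.mem_eligible hi
    exact (h.completion 0 i hi).trans (le_work hr ⟨hmem.1.1, hmem.2.2⟩)

theorem awake (h : Uneventful P J T s r jm t) (hs : EDFSelection J T s r jm) (hc : s.Coherent)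
    (hv : v ∈ Ioo T t) (hon : ¬ s.IsOff) :
    (openJobs J (advance r jm (v - T)) v).Nonempty ∨ v < s.t1 + P.breakEven := by
  rw [h.openJobs_eq hs hc ⟨hv.1.le, hv.2⟩, or_iff_not_imp_left, not_nonempty_iff_eq_empty]
  exact fun hQ => hv.2.trans_le (h.standby hon hQ)

theorem phase (h : Uneventful P J T s r jm t) (hs : EDFSelection J T s r jm)
    (hp : Phase P J T e r s) (hJ : EDFCondition J) (hv : v ∈ Ioo T t) :
    Phase P J v e (advance r jm (v - T)) s := by
  have hr := hp.remainingInvariant.nonneg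
  have hseg := (h.mono hr hv).segment hs hp
  have hQ := h.openJobs_eq hs hp.coherent ⟨hv.1.le, hv.2⟩
  have hawake := h.awake hs hp.coherent hv
  have hIic (f : ι → ℝ) (x : ℝ) : workDue J f (Iic v) x = workDue J f (Iio v) x :=
    work_congr_set fun j hj => absurd (and_congr_left fun _ => ⟨fun hjv =>
      ((h.quiet j).resolve_right (lt_of_le_of_lt hjv hv.2).not_ge).trans_lt hv.1, le_of_lt⟩) hj
  obtain hp | hp | hp | hp := hp
  · have hpre := hp.segment hJ hseg
    refine .inl ⟨hpre.base, hpre.off, hpre.calm, hpre.unstarted, fun j hj => ?_, fun x hx => ?_⟩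
    · exact hv.2.trans_le ((h.stay_off hp.off).1 j (hQ ▸ hj))
    · rw [hIic, hseg.workDue_Iio, hs.advance_of_isOff hp.off]
      exact (h.workDue_le hr hp.off x).trans_lt
        (max_lt (sub_pos.2 hx) (sub_lt_sub_left hv.2 x))
  · have hpre := hp.segment hJ hseg
    exact .inr (.inl ⟨hpre, fun x hx => hIic _ x ▸ hpre.fits x hx.le,
      hawake (SysState.not_isOff_of_on hp.on0)⟩)
  · exact .inr (.inr (.inl ⟨hp.segment hJ hseg, hQ ▸ hp.busy⟩))
  · exact .inr (.inr (.inr ⟨hp.segment hJ hseg, hawake (SysState.not_isOff_of_on hp.on1)⟩))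

end Uneventful

end Uneventful

section Counting

variable {ι : Type*} [Finite ι] {J : ι → Job} {a b : ℝ}

theorem ncard_arriving_Ioi_anti (J : ι → Job) (h : a ≤ b) :
    (arriving J (Ioi b)).ncard ≤ (arriving J (Ioi a)).ncard :=
  ncard_le_ncard (preimage_mono (Ioi_subset_Ioi h)) (toFinite _)

theorem ncard_arriving_Ioi_lt {j : ι} (hj : (J j).arrival ∈ Ioc a b) :
    (arriving J (Ioi b)).ncard < (arriving J (Ioi a)).ncard :=
  ncard_lt_ncard ⟨preimage_mono (Ioi_subset_Ioi (hj.1.le.trans hj.2)),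
    fun h => (h (show j ∈ arriving J (Ioi a) from hj.1) : b < _).not_ge hj.2⟩ (toFinite _)

end Counting

section Events

variable {ι : Type*} [Fintype ι] {P : PowerModel} {J : ι → Job} {T t e e' b : ℝ} {s s' : SysState}
  {r : ι → ℝ} {jm : Fin 2 → Option ι}

/-- The times after `T` at which something may happen, in the sense of `Uneventful`. -/
inductive EventTime (P : PowerModel) (J : ι → Job) (T : ℝ) (s : SysState) (r : ι → ℝ)
    (jm : Fin 2 → Option ι) : ℝ → Prop
  | arrival (j : ι) (h : T < (J j).arrival) : EventTime P J T s r jm (J j).arrival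
  | completion (m : Fin 2) (j : ι) (h : jm m = some j) : EventTime P J T s r jm (T + r j)
  | anchor (j : ι) (hoff : s.IsOff) (hj : j ∈ openJobs J r T) :
      EventTime P J T s r jm (anchor P 1 (J j))
  | slack (j : ι) (hoff : s.IsOff) (hj : j ∈ openJobs J r T) :
      EventTime P J T s r jm ((J j).deadline - workDue J r (Iic T) (J j).deadline)
  | shutDown (hon : ¬ s.IsOff) (hQ : openJobs J r T = ∅) :
      EventTime P J T s r jm (s.t1 + P.breakEven)

theorem finite_setOf_eventTime : {b | EventTime P J T s r jm b}.Finite := by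
  have hfinite (f : ι → ℝ) : (range f).Finite := finite_range f
  refine ((((hfinite fun j => (J j).arrival).union (hfinite fun j => T + r j)).union
    (hfinite fun j => anchor P 1 (J j))).union ((hfinite fun j => (J j).deadline -
      workDue J r (Iic T) (J j).deadline).union (finite_singleton (s.t1 + P.breakEven)))).subset ?_
  rintro b (⟨j, h⟩ | ⟨m, j, h⟩ | ⟨j, hoff, hj⟩ | ⟨j, hoff, hj⟩ | ⟨hon, hQ⟩) <;> simp

theorem Phase.lt_of_eventTime (hp : Phase P J T e r s) (hs : EDFSelection J T s r jm)
    (hb : EventTime P J T s r jm b) : T < b := by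
  obtain ⟨j, h⟩ | ⟨m, j, h⟩ | ⟨j, hoff, hj⟩ | ⟨j, hoff, hj⟩ | ⟨hon, hQ⟩ := hb
  · exact h
  · exact lt_add_of_pos_right T (hs.mem_eligible h).1.2
  · exact (hp.offPhase hoff).relaxed j hj
  · have hdeadline : T < (J j).deadline :=
      not_le.1 fun h => hj.2.ne' (hp.remainingInvariant.due j h)
    exact lt_sub_comm.1 ((hp.offPhase hoff).loose _ hdeadline)
  · exact (hp.awake hon).resolve_left (not_nonempty_iff_eq_empty.2 hQ)

theorem uneventful_of_forall_le (hr : ∀ j, 0 ≤ r j) (ht : T < t)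
    (h : ∀ b, EventTime P J T s r jm b → t ≤ b) : Uneventful P J T s r jm t where
  lt := ht
  quiet j := or_iff_not_imp_left.2 fun hj => h _ (.arrival j (not_le.1 hj))
  completion m j hj := sub_le_iff_le_add'.2 (h _ (.completion m j hj))
  stay_off hoff := by
    refine ⟨fun j hj => h _ (.anchor j hoff hj), fun x hx => ?_⟩
    obtain hpos | hpos := lt_or_ge 0 (workDue J r (Iic T) x)
    · obtain ⟨j, hj, hjx, heq⟩ := exists_workDue_eq_deadline hr hpos
      have hslack := h _ (.slack j hoff hj)
      linarith
    · exact hpos.trans (sub_nonneg.2 hx)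
  standby hon hQ := h _ (.shutDown hon hQ)

theorem EventTime.arrival_or_completion (hb : EventTime P J T s r jm t)
    (h : Uneventful P J T s r jm t) (hs : EDFSelection J T s r jm) (hp : Phase P J T e r s)
    (hpt : Phase P J t e (advance r jm (t - T)) s) :
    (∃ j, (J j).arrival ∈ Ioc T t) ∨ ∃ j, 0 < r j ∧ advance r jm (t - T) j = 0 := by
  have hseg := h.segment hs hp
  have hr := hp.remainingInvariant.nonneg
  have hopen {j : ι} (hj : j ∈ openJobs J r T) (hoff : s.IsOff) :
      j ∈ openJobs J (advance r jm (t - T)) t :=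
    ⟨hj.1.trans h.lt.le, hj.2.trans_eq (congrFun (hseg.frozen hoff) j).symm⟩
  cases hb with
  | arrival j hj => exact .inl ⟨j, hj, le_rfl⟩
  | completion m j hj =>
    refine .inr ⟨j, (hs.mem_eligible hj).1.2, ?_⟩
    rw [hs.advance_eq_sub hp.coherent hj]
    ring
  | anchor j hoff hj => exact absurd ((hpt.offPhase hoff).relaxed j (hopen hj hoff)) (lt_irrefl _)
  | slack j hoff hj =>
    have hpos : 0 < workDue J r (Iic T) (J j).deadline :=
      hj.2.trans_le (le_work hr ⟨hj.1, le_refl (J j).deadline⟩)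
    have hloose := (hpt.offPhase hoff).loose (J j).deadline (sub_lt_self _ hpos)
    rw [hseg.frozen hoff, sub_sub_cancel] at hloose
    exact absurd hloose (workDue_mono_set hr (Iic_subset_Iic.2 h.lt.le) _).not_gt
  | shutDown hon hQ =>
    obtain ⟨j, hj, hrj⟩ := (hpt.awake hon).resolve_right (lt_irrefl _)
    refine .inl ⟨j, not_le.1 fun hjT => ?_, hj⟩
    exact notMem_empty j (hQ ▸ ⟨hjT, hrj.trans_le (hseg.anti j)⟩)

/-- The position of a state in the order in which the states of a period follow each other, counted
from the end of the period. -/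
def SysState.rank (s : SysState) : ℕ :=
  if s.on 0 = true then if s.on 1 = true then 2 else 3 else if s.on 1 = true then 1 else 4

/-- A bound for the number of events after time `T`: at each of them the state changes, a job
arrives or a job is completed. -/
def eventBound (J : ι → Job) (T e : ℝ) (r : ι → ℝ) (s : SysState) : ℕ :=
  5 * (arriving J (Ioi e)).ncard + s.rank + {j | 0 < r j}.ncard + (arriving J (Ioi T)).ncard

theorem Transition.stay_or_lt (h : Transition P J t r e s e' s') :
    (s' = s ∧ e' = e ∧ Phase P J t e r s) ∨
      5 * (arriving J (Ioi e')).ncard + s'.rank < 5 * (arriving J (Ioi e)).ncard + s.rank := by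
  cases h with
  | stay h => exact .inl ⟨rfl, rfl, h⟩
  | wake hp h =>
    right
    simp [SysState.rank, SysState.turnOnM1, hp.off 0, hp.off 1]
  | wakeRaise hp h =>
    right
    simp [SysState.rank, SysState.turnOnM1, SysState.raised, hp.off 0, hp.off 1]
  | raise hp h =>
    right
    simp [SysState.rank, SysState.raised, hp.on0, hp.on1]
  | clear hp h =>
    right
    simp [SysState.rank, SysState.cleared, hp.on0, hp.on1]
  | halt hs he htrig ht hp h =>
    obtain ⟨j, hj⟩ := htrig.exists_arrival_mem
    have hlt : (arriving J (Ioi t)).ncard < (arriving J (Ioi e)).ncard :=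
      ncard_arriving_Ioi_lt
        ⟨hj.1, hj.2.trans ((le_add_of_nonneg_right P.breakEven_nonneg).trans ht)⟩
    have hrank : s'.rank = 4 := by simp [SysState.rank, h.off 0, h.off 1]
    have hrank' : 0 < s.rank := by unfold SysState.rank; split_ifs <;> simp
    right
    omega

theorem EventTime.eventBound_lt (hb : EventTime P J T s r jm t)
    (h : Uneventful P J T s r jm t) (hs : EDFSelection J T s r jm) (hp : Phase P J T e r s)
    (htrans : Transition P J t (advance r jm (t - T)) e s e' s') :
    eventBound J t e' (advance r jm (t - T)) s' < eventBound J T e r s := by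
  have hanti := (h.segment hs hp).anti
  have hopen : {j | 0 < advance r jm (t - T) j} ⊆ {j | 0 < r j} := fun j hj =>
    lt_of_lt_of_le hj (hanti j)
  have harrivals := ncard_arriving_Ioi_anti J h.lt.le
  have hopen_le := ncard_le_ncard hopen (toFinite _)
  unfold eventBound
  obtain ⟨rfl, rfl, hpt⟩ | hlt := htrans.stay_or_lt
  · obtain ⟨j, hj⟩ | ⟨j, hj, hdone⟩ := hb.arrival_or_completion h hs hp hpt
    · have hlt := ncard_arriving_Ioi_lt hj
      omega
    · have hlt := ncard_lt_ncard ⟨hopen, fun hsub => (hsub hj).ne' hdone⟩ (toFinite _)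
      omega
  · omega

theorem Uneventful.prepend (h : Uneventful P J T s r jm t) (hs : EDFSelection J T s r jm)
    (hp : Phase P J T e r s) (hJ : EDFCondition J) {σ : ℝ → SysState} {job : Fin 2 → ℝ → Option ι}
    (hcont : Continuation P J t (s.updateAt P J (advance r jm (t - T)) t) (advance r jm (t - T))
      σ job) : ∃ σ' job', Continuation P J T s r σ' job' := by
  obtain ⟨σ', job', hcont', hσ', hjob'⟩ := hcont.exists_eq_on_Ico T s jm
  refine ⟨σ', job', hcont'.prepend h.lt hσ' hjob' (fun v hv => ?_) (fun v hv => ?_)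
    fun v hv m => ?_⟩
  · exact h.advance_nonneg hs hp.coherent hp.remainingInvariant.nonneg hv.2.le
  · exact (h.phase hs hp hJ hv).updateAt_eq hJ
  · rw [h.openJobs_eq hs hp.coherent hv]
    exact hs m

theorem Phase.exists_continuation_of_no_eventTime (hp : Phase P J T e r s)
    (hJ : EDFCondition J) (hs : EDFSelection J T s r jm) (h : ∀ b, ¬ EventTime P J T s r jm b) :
    ∃ σ job, Continuation P J T s r σ job := by
  have hr := hp.remainingInvariant.nonneg
  have hoff : s.IsOff := by
    by_contra hon
    have hQ : (openJobs J r T).Nonempty :=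
      nonempty_iff_ne_empty.2 fun hQ => h _ (.shutDown hon hQ)
    obtain ⟨m, j, hj⟩ := hp.exists_eligible hon hQ
    obtain ⟨i, hi, -⟩ := hs.exists_eq_some hj
    exact h _ (.completion m i hi)
  refine exists_continuation_of_isOff hoff hr fun v hv => ?_
  have hun : Uneventful P J T s r jm (v + 1) :=
    uneventful_of_forall_le hr (hv.trans (lt_add_one v)) fun b hb => absurd hb (h b)
  have hphase := hun.phase hs hp hJ ⟨hv, lt_add_one v⟩
  rw [hs.advance_of_isOff hoff] at hphase
  exact hphase.updateAt_eq hJ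

theorem Phase.exists_continuation (hp : Phase P J T e r s) (hJ : EDFCondition J) :
    ∃ σ job, Continuation P J T s r σ job := by
  induction hn : eventBound J T e r s using Nat.strong_induction_on generalizing T e r s with
  | _ n ih =>
    subst hn
    choose jm hs using fun m => exists_EDFChoice J (s.eligible J (openJobs J r T) m)
    obtain hnone | hsome := {b | EventTime P J T s r jm b}.eq_empty_or_nonempty
    · exact hp.exists_continuation_of_no_eventTime hJ hs (eq_empty_iff_forall_notMem.1 hnone)
    · obtain ⟨t, ht, hmin⟩ := exists_min_image _ id finite_setOf_eventTime hsome
      have hun : Uneventful P J T s r jm t :=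
        uneventful_of_forall_le hp.remainingInvariant.nonneg (hp.lt_of_eventTime hs ht) hmin
      obtain ⟨e', htrans⟩ := (hp.segment hJ (hun.segment hs hp)).exists_transition hJ rfl
      obtain ⟨σ, job, hcont⟩ := ih _ (ht.eventBound_lt hun hs hp htrans) htrans.phase rfl
      exact hun.prepend hs hp hJ hcont

theorem exists_isRun (P : PowerModel) (hJ : EDFCondition J) :
    ∃ (S : Schedule ι 2) (σ : ℝ → SysState), IsRun P 1 J S σ := by
  obtain ⟨e, htrans⟩ :=
    PrePhase.exists_transition (P := P) (.inl (PreOffPhase.initial hJ)) hJ rfl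
  obtain ⟨σ, job, hcont⟩ := htrans.phase.exists_continuation hJ
  obtain ⟨S, hS⟩ := hcont.exists_isRun
  exact ⟨S, σ, hS⟩

end Events

end PowerSched

end

theorem mainTheorem2 {ι : Type*} [Fintype ι] (P : PowerSched.PowerModel) (J : ι → PowerSched.Job)
    (hJ : PowerSched.EDFCondition J) :
    (∃ (S : PowerSched.Schedule ι 2) (σ : ℝ → PowerSched.SysState),
      PowerSched.IsRun P 1 J S σ) ∧
    ∀ (S : PowerSched.Schedule ι 2) (σ : ℝ → PowerSched.SysState),
      PowerSched.IsRun P 1 J S σ →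
        S.Feasible J univ ∧ PowerSched.IsCompetitive 4 P J S :=
  ⟨PowerSched.exists_isRun P hJ, fun _ _ h => ⟨h.feasible hJ, h.isCompetitive hJ⟩⟩
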